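/- Let $\Bbbk$ be a field and $n,m\ge 0$. **The algebra $R(n,m)$.** Let $\mathbf i$ range over sequences of $n$ ones (fermionic labels) and $m$ twos (bosonic labels), and let $s_t\mathbf i$ be $\mathbf i$ with its $t$-th and $(t+1)$-st entries exchanged. $R(n,m)$ is the associative unital $\Bbbk$-algebra generated by the diagrams $1_{\mathbf i}$ (vertical lines), $x_a1_{\mathbf i}$ ($1\le a\le m$; vertical lines with a dot on the $a$-th bosonic strand from the left) and $\psi_t1_{\mathbf i}$ ($1\le t<n+m$; crossing of the $t$-th and $(t+1)$-st strands, with lower labels $\mathbf i$ and upper labels $s_t\mathbf i$). The product $xy$ is $x$ placed on top of $y$, and it is $0$ if the labels do not match; $1=\sum_{\mathbf i}1_{\mathbf i}$. Writing $x_a$, $\psi_t$ for the sums over $\mathbf i$, the defining relations are: 1. if $|t-u|>1$, then $\psi_t\psi_u1_{\mathbf i}=-\psi_u\psi_t1_{\mathbf i}$ if both crossings are between two fermionic strands, and $\psi_t\psi_u1_{\mathbf i}=\psi_u\psi_t1_{\mathbf i}$ otherwise; 2. $x_ax_b=x_bx_a$, and $x_a\psi_t1_{\mathbf i}=\psi_tx_a1_{\mathbf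 i}$ unless the crossing is between two bosonic strands one of which is the $a$-th; 3. if the $t$-th and $(t+1)$-st strands of $\mathbf i$ are the $a$-th and $(a+1)$-st bosonic ones, then $(x_a\psi_t-\psi_tx_{a+1})1_{\mathbf i}=1_{\mathbf i}=(\psi_tx_a-x_{a+1}\psi_t)1_{\mathbf i}$; 4. $\psi_t^21_{\mathbf i}=0$ if $i_t=i_{t+1}$, and $\psi_t^21_{\mathbf i}=x_a1_{\mathbf i}$ if exactly one of the two strands is bosonic, and it is the $a$-th one; 5. $\psi_t\psi_{t+1}\psi_t1_{\mathbf i}=\psi_{t+1}\psi_t\psi_{t+1}1_{\mathbf i}$ unless $(i_t,i_{t+1},i_{t+2})=(2,1,2)$, in which case $(\psi_t\psi_{t+1}\psi_t-\psi_{t+1}\psi_t\psi_{t+1})1_{\mathbf i}=1_{\mathbf i}$. **Signs.** Let $LOT_n$ be the $\Bbbk$-algebra with generators $\sigma_1,\dots,\sigma_{n-1}$ and relations $\sigma_a^2=0$, $\sigma_a\sigma_b=-\sigma_b\sigma_a$ for $|a-b|>1$, $\sigma_a\sigma_{a+1}\sigma_a=\sigma_{a+1}\sigma_a\sigma_{a+1}$.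 For $w\in S_n$ with a reduced presentation $w'=(a_1,\dots,a_r)$, $w=s_{a_1}\cdots s_{a_r}$, put $\sigma_w=\epsilon(w')\sigma_{a_1}\cdots\sigma_{a_r}$. Here $\epsilon(w')$ is the product, over all pairs of inversions $(j_1,j_2)$, $(k_1,k_2)$ of $w$ with $j_1,j_2,k_1,k_2$ distinct and $j_1<k_1$, of $1$ if the term of $w'$ that creates the inversion $(j_1,j_2)$ is to the right of the term that creates $(k_1,k_2)$, and of $-1$ otherwise; $\sigma_w$ does not depend on $w'$. Let $\ell$ be the length function. There are signs $\epsilon_w^a\in\{1,-1\}$ with $\sigma_{s_aw}=\epsilon_w^a\sigma_a\sigma_w$ whenever $\ell(s_aw)=\ell(w)+1$. **The action.** Let $Pol=\bigoplus_{\mathbf i,\,w\in S_n}Pol(\mathbf i,w)$, $Pol(\mathbf i,w)=\Bbbk[x_1(\mathbf i,w),\dots,x_m(\mathbf i,w)]$. The following rules define an action of $R(n,m)$ on $Pol$. Each of $1_{\mathbf i}$, $x_a1_{\mathbf i}$, $\psi_t1_{\mathbf i}$ is zero on $Pol(\mathbf j,w)$ for $\mathbf j\ne\mathbf i$, and for $f\in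 Pol(\mathbf i,w)$ (identifying the variables of the different summands): * $1_{\mathbf i}f=f\in Pol(\mathbf i,w)$ and $(x_a1_{\mathbf i})f=x_af\in Pol(\mathbf i,w)$; * if strands $t,t+1$ are the $a$-th and $(a+1)$-st bosonic ones, $(\psi_t1_{\mathbf i})f=\frac{f-s_af}{x_a-x_{a+1}}\in Pol(\mathbf i,w)$, where $s_a$ exchanges $x_a$ and $x_{a+1}$; * if $(i_t,i_{t+1})=(1,2)$, $(\psi_t1_{\mathbf i})f=f\in Pol(s_t\mathbf i,w)$; * if $(i_t,i_{t+1})=(2,1)$ and strand $t$ is the $a$-th bosonic one, $(\psi_t1_{\mathbf i})f=x_af\in Pol(s_t\mathbf i,w)$; * if strands $t,t+1$ are the $a$-th and $(a+1)$-st fermionic ones, $(\psi_t1_{\mathbf i})f=\epsilon_w^af\in Pol(\mathbf i,s_aw)$ if $\ell(s_aw)=\ell(w)+1$, and $(\psi_t1_{\mathbf i})f=0$ if $\ell(s_aw)=\ell(w)-1$. This action is faithful. **Basis.** Fix a reduced presentation $w=s_{t_1}\cdots s_{t_r}$ of each $w\in S_{n+m}$. Then the diagrams $x_1^{e_1}\cdots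 x_m^{e_m}\psi_{t_1}\cdots\psi_{t_r}1_{\mathbf i}$ (dots only at the tops of the bosonic strands), over all $\mathbf i$, all $w\in S_{n+m}$ and all $e\in\mathbb Z_{\ge0}^m$, form a basis of $R(n,m)$ as a $\Bbbk$-vector space. **Consequences.** The homomorphism $\Bbbk[x_1,\dots,x_m]\to R(n,m)$ that takes $x_a$ to $\sum_{\mathbf i}x_a1_{\mathbf i}$ is injective. The image $\mathrm{Sym}(n,m)$ of the symmetric polynomials lies in the center of $R(n,m)$, $R(n,m)$ is a free $\mathrm{Sym}(n,m)$-module of finite rank, and $R(n,m)$ is both left and right Noetherian. -/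

import Mathlib

open MvPolynomial

noncomputable section

namespace GL12

/-! ### Words in the simple transpositions of a symmetric group -/

/-- The left one of the two adjacent positions indexed by `t` (`t`-th and `(t+1)`-st). -/
def lo {N : ℕ} (t : Fin (N - 1)) : Fin N := ⟨t, by omega⟩

/-- The right one of the two adjacent positions indexed by `t`. -/
def hi {N : ℕ} (t : Fin (N - 1)) : Fin N := ⟨t + 1, by omega⟩

/-- The simple transposition `s_t`. -/
def simple {N : ℕ} (t : Fin (N - 1)) : Equiv.Perm (Fin N) := Equiv.swap (lo t) (hi t)

/-- The permutation `s_{t₁} ⋯ s_{t_r}` presented by the word `(t₁, …, t_r)`. -/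
def wordPerm {N : ℕ} (l : List (Fin (N - 1))) : Equiv.Perm (Fin N) := (l.map simple).prod

theorem exists_word {N : ℕ} (w : Equiv.Perm (Fin N)) : ∃ l, wordPerm l = w := by
  obtain _ | N := N
  · exact ⟨[], Subsingleton.elim _ _⟩
  have h : w ∈ Submonoid.closure
      (Set.range fun i : Fin N => Equiv.swap i.castSucc i.succ) := by
    rw [Equiv.Perm.mclosure_swap_castSucc_succ]; trivial
  induction h using Submonoid.closure_induction with
  | mem x hx =>
    obtain ⟨i, rfl⟩ := hx
    refine ⟨[i], ?_⟩
    simp only [wordPerm, List.map_cons, List.map_nil, List.prod_cons, List.prod_nil, mul_one]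
    rfl
  | one => exact ⟨[], rfl⟩
  | mul x y _ _ hx hy =>
    obtain ⟨a, rfl⟩ := hx
    obtain ⟨b, rfl⟩ := hy
    exact ⟨a ++ b, by simp [wordPerm]⟩

/-- The length of a permutation: the least length of a word that presents it. -/
def len {N : ℕ} (w : Equiv.Perm (Fin N)) : ℕ :=
  sInf {r | ∃ l : List (Fin (N - 1)), wordPerm l = w ∧ l.length = r}

/-- `l` is a reduced (minimal length) presentation of `w`. -/
def IsReducedWord {N : ℕ} (l : List (Fin (N - 1))) (w : Equiv.Perm (Fin N)) : Prop :=
  wordPerm l = w ∧ l.length = len w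

theorem exists_reducedWord {N : ℕ} (w : Equiv.Perm (Fin N)) : ∃ l, IsReducedWord l w :=
  Nat.sInf_mem (s := {r | ∃ l : List (Fin (N - 1)), wordPerm l = w ∧ l.length = r})
    (let ⟨l, hl⟩ := exists_word w; ⟨_, l, hl, rfl⟩)

/-! ### The algebra of fermionic strands and the signed elements `σ_w` -/

/-- Defining relations for the generators `σ_1, …, σ_{n-1}`. -/
inductive LOTRel (k : Type*) [Field k] (n : ℕ) :
    FreeAlgebra k (Fin (n - 1)) → FreeAlgebra k (Fin (n - 1)) → Prop
  | sq (a : Fin (n - 1)) : LOTRel k n (FreeAlgebra.ι k a * FreeAlgebra.ι k a) 0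
  | far (a b : Fin (n - 1)) (h : (a : ℕ) + 1 < b ∨ (b : ℕ) + 1 < a) :
      LOTRel k n
        (FreeAlgebra.ι k a * FreeAlgebra.ι k b + FreeAlgebra.ι k b * FreeAlgebra.ι k a) 0
  | braid (a b : Fin (n - 1)) (h : (a : ℕ) + 1 = b) :
      LOTRel k n (FreeAlgebra.ι k a * FreeAlgebra.ι k b * FreeAlgebra.ι k a)
        (FreeAlgebra.ι k b * FreeAlgebra.ι k a * FreeAlgebra.ι k b)

/-- The algebra of `n` fermionic strands (its differential plays no role here). -/
abbrev LOT (k : Type*) [Field k] (n : ℕ) : Type _ := RingQuot (LOTRel k n)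

/-- The generator `σ_a`. -/
def sigmaGen (k : Type*) [Field k] {n : ℕ} (a : Fin (n - 1)) : LOT k n :=
  RingQuot.mkAlgHom k (LOTRel k n) (FreeAlgebra.ι k a)

/-- The pairs of strands, named by their lower endpoints, that cross at the successive terms of
a word. The first term of the word is the top crossing of the diagram. -/
def crossings {n : ℕ} : List (Fin (n - 1)) → List (Fin n × Fin n)
  | [] => []
  | t :: l => ((wordPerm l)⁻¹ (lo t), (wordPerm l)⁻¹ (hi t)) :: crossings l

/-- `(p.1, p.2)` is an inversion of `w`. -/
def IsInversion {n : ℕ} (w : Equiv.Perm (Fin n)) (p : Fin n × Fin n) : Prop :=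
  p.1 < p.2 ∧ w p.2 < w p.1

open Classical in
/-- Pairs of disjoint inversions `((j₁, j₂), (k₁, k₂))` of `w`, ordered by `j₁ < k₁`. -/
def disjointInversions {n : ℕ} (w : Equiv.Perm (Fin n)) :
    Finset ((Fin n × Fin n) × (Fin n × Fin n)) :=
  Finset.univ.filter fun x => IsInversion w x.1 ∧ IsInversion w x.2 ∧ x.1.1 < x.2.1 ∧
    x.1.1 ≠ x.2.2 ∧ x.1.2 ≠ x.2.1 ∧ x.1.2 ≠ x.2.2

/-- The sign of a reduced word: the product over the pairs of disjoint inversions of `1` if the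
`(j₁, j₂)`-crossing appears in the word to the right of the `(k₁, k₂)`-crossing, and of `-1`
if it appears to the left. -/
def wordSign {n : ℕ} (l : List (Fin (n - 1))) : ℤ :=
  ∏ x ∈ disjointInversions (wordPerm l),
    if (crossings l).idxOf x.2 < (crossings l).idxOf x.1 then 1 else -1

/-- The element `σ_w`: the product of the generators along a reduced word of `w`, multiplied by
the sign of that word. -/
def sigma (k : Type*) [Field k] {n : ℕ} (w : Equiv.Perm (Fin n)) : LOT k n :=
  wordSign (exists_reducedWord w).choose •
    ((exists_reducedWord w).choose.map (sigmaGen k)).prod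

open Classical in
/-- The sign `ε_w^a`, for which `σ_{s_a w} = ε_w^a σ_a σ_w` if `s_a w` is longer than `w`. -/
def eps (k : Type*) [Field k] {n : ℕ} (w : Equiv.Perm (Fin n)) (a : Fin (n - 1)) : k :=
  if sigma k (simple a * w) = sigmaGen k a * sigma k w then 1 else -1

/-! ### The algebra `R(n,m)` -/

/-- Sequences of `n` fermionic labels (`false`) and `m` bosonic labels (`true`). -/
abbrev Labels (n m : ℕ) : Type :=
  {c : Fin (n + m) → Bool // (Finset.univ.filter fun p => c p = true).card = m}

variable {n m : ℕ}

theorem card_fermionic (i : Labels n m) :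
    (Finset.univ.filter fun p => i.1 p = false).card = n := by
  have h := Finset.card_filter_add_card_filter_not (s := (Finset.univ : Finset (Fin (n + m))))
    (fun p => i.1 p = true)
  simp only [Bool.not_eq_true, Finset.card_univ, Fintype.card_fin] at h
  have := i.2
  omega

/-- The position of the `k`-th bosonic strand, counting from the left. -/
def bos (i : Labels n m) (k : Fin m) : Fin (n + m) :=
  (Finset.univ.filter fun p => i.1 p = true).orderEmbOfFin i.2 k

/-- The position of the `a`-th fermionic strand, counting from the left. -/
def ferm (i : Labels n m) (a : Fin n) : Fin (n + m) :=
  (Finset.univ.filter fun p => i.1 p = false).orderEmbOfFin (card_fermionic i) a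

/-- The sequence `s_t i`, with the `t`-th and `(t+1)`-st labels exchanged. -/
def Labels.sw (i : Labels n m) (t : Fin (n + m - 1)) : Labels n m :=
  ⟨fun p => i.1 (simple t p), by
    refine Eq.trans (Finset.card_bij (fun p _ => simple t p) ?_ ?_ ?_) i.2
    · intro p hp
      simpa using hp
    · intro p _ q _ h
      exact (simple t).injective h
    · intro q hq
      exact ⟨(simple t).symm q, by simpa using hq, by simp⟩⟩

/-- The generating diagrams of `R(n,m)`. -/
inductive Gen (n m : ℕ) : Type
  /-- the vertical lines diagram `1_i` -/
  | idem (i : Labels n m)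
  /-- vertical lines with one dot, on the `k`-th bosonic strand from the left -/
  | dot (i : Labels n m) (k : Fin m)
  /-- the crossing of the `t`-th and `(t+1)`-st strands, with lower labels `i` -/
  | cross (i : Labels n m) (t : Fin (n + m - 1))

section Relations

variable (k : Type*) [Field k]

/-- `idem` in the free algebra. -/
abbrev fI (i : Labels n m) : FreeAlgebra k (Gen n m) := FreeAlgebra.ι k (Gen.idem i)
/-- `dot` in the free algebra. -/
abbrev fD (i : Labels n m) (a : Fin m) : FreeAlgebra k (Gen n m) := FreeAlgebra.ι k (Gen.dot i a)
/-- `cross` in the free algebra. -/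
abbrev fC (i : Labels n m) (t : Fin (n + m - 1)) : FreeAlgebra k (Gen n m) :=
  FreeAlgebra.ι k (Gen.cross i t)

/-- The defining relations. A product `x * y` is the diagram `x` placed on top of `y`. -/
inductive Rel (n m : ℕ) : FreeAlgebra k (Gen n m) → FreeAlgebra k (Gen n m) → Prop
  -- concatenation: diagrams with different labels at the common ends multiply to zero
  | idem_mul_self (i : Labels n m) : Rel n m (fI k i * fI k i) (fI k i)
  | idem_mul_ne (i j : Labels n m) (h : i ≠ j) : Rel n m (fI k i * fI k j) 0
  | sum_idem : Rel n m (∑ i : Labels n m, fI k i) 1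
  | idem_dot (i : Labels n m) (a : Fin m) : Rel n m (fI k i * fD k i a) (fD k i a)
  | dot_idem (i : Labels n m) (a : Fin m) : Rel n m (fD k i a * fI k i) (fD k i a)
  | idem_cross (i : Labels n m) (t : Fin (n + m - 1)) :
      Rel n m (fI k (i.sw t) * fC k i t) (fC k i t)
  | cross_idem (i : Labels n m) (t : Fin (n + m - 1)) : Rel n m (fC k i t * fI k i) (fC k i t)
  -- far away crossings anticommute if both are fermionic, and commute otherwise
  | far_odd (i : Labels n m) (t u : Fin (n + m - 1)) (h : (t : ℕ) + 1 < u)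
      (ht : i.1 (lo t) = false ∧ i.1 (hi t) = false)
      (hu : i.1 (lo u) = false ∧ i.1 (hi u) = false) :
      Rel n m (fC k (i.sw t) u * fC k i t) (-(fC k (i.sw u) t * fC k i u))
  | far_even (i : Labels n m) (t u : Fin (n + m - 1)) (h : (t : ℕ) + 1 < u)
      (hb : ¬ ((i.1 (lo t) = false ∧ i.1 (hi t) = false) ∧
        (i.1 (lo u) = false ∧ i.1 (hi u) = false))) :
      Rel n m (fC k (i.sw t) u * fC k i t) (fC k (i.sw u) t * fC k i u)
  -- a dot commutes with far away crossings, and two dots commute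
  | dot_far (i : Labels n m) (t : Fin (n + m - 1)) (a : Fin m)
      (h₁ : bos i a ≠ lo t) (h₂ : bos i a ≠ hi t) :
      Rel n m (fD k (i.sw t) a * fC k i t) (fC k i t * fD k i a)
  | dot_dot (i : Labels n m) (a b : Fin m) :
      Rel n m (fD k i a * fD k i b) (fD k i b * fD k i a)
  -- a dot moves freely through a crossing of a bosonic and a fermionic strand
  -- (such a crossing does not change the order of the bosonic strands)
  | dot_mixed (i : Labels n m) (t : Fin (n + m - 1)) (a : Fin m)
      (hm : i.1 (lo t) ≠ i.1 (hi t)) (ha : bos i a = lo t ∨ bos i a = hi t) :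
      Rel n m (fD k (i.sw t) a * fC k i t) (fC k i t * fD k i a)
  -- a dot moves through a crossing of two bosonic strands as in the nilHecke algebra
  | nil_top (i : Labels n m) (t : Fin (n + m - 1)) (a b : Fin m)
      (ha : bos i a = lo t) (hb : bos i b = hi t) :
      Rel n m (fD k i a * fC k i t - fC k i t * fD k i b) (fI k i)
  | nil_bot (i : Labels n m) (t : Fin (n + m - 1)) (a b : Fin m)
      (ha : bos i a = lo t) (hb : bos i b = hi t) :
      Rel n m (fC k i t * fD k i a - fD k i b * fC k i t) (fI k i)
  -- double crossings
  | double_same (i : Labels n m) (t : Fin (n + m - 1)) (h : i.1 (lo t) = i.1 (hi t)) :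
      Rel n m (fC k (i.sw t) t * fC k i t) 0
  | double_mixed (i : Labels n m) (t : Fin (n + m - 1)) (a : Fin m)
      (hm : i.1 (lo t) ≠ i.1 (hi t)) (ha : bos i a = lo t ∨ bos i a = hi t) :
      Rel n m (fC k (i.sw t) t * fC k i t) (fD k i a)
  -- triple intersections, with an additional term for labels even, odd, even
  | triple (i : Labels n m) (t u : Fin (n + m - 1)) (h : (t : ℕ) + 1 = u)
      (hb : ¬ (i.1 (lo t) = true ∧ i.1 (hi t) = false ∧ i.1 (hi u) = true)) :
      Rel n m (fC k ((i.sw t).sw u) t * fC k (i.sw t) u * fC k i t)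
        (fC k ((i.sw u).sw t) u * fC k (i.sw u) t * fC k i u)
  | triple_even_odd_even (i : Labels n m) (t u : Fin (n + m - 1)) (h : (t : ℕ) + 1 = u)
      (hb : i.1 (lo t) = true ∧ i.1 (hi t) = false ∧ i.1 (hi u) = true) :
      Rel n m (fC k ((i.sw t).sw u) t * fC k (i.sw t) u * fC k i t)
        (fC k ((i.sw u).sw t) u * fC k (i.sw u) t * fC k i u + fI k i)

end Relations

/-- The algebra `R(n,m)`. -/
abbrev RAlg (k : Type*) [Field k] (n m : ℕ) : Type _ := RingQuot (Rel k n m)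

section Elements

variable (k : Type*) [Field k]

/-- The idempotent `1_i`. -/
def idem (i : Labels n m) : RAlg k n m := RingQuot.mkAlgHom k (Rel k n m) (fI k i)

/-- The dot on the `a`-th bosonic strand of `1_i`. -/
def dot (i : Labels n m) (a : Fin m) : RAlg k n m := RingQuot.mkAlgHom k (Rel k n m) (fD k i a)

/-- The crossing of the `t`-th and `(t+1)`-st strands, with lower labels `i`. -/
def cross (i : Labels n m) (t : Fin (n + m - 1)) : RAlg k n m :=
  RingQuot.mkAlgHom k (Rel k n m) (fC k i t)

/-- The labels at the top of the diagram of a word with lower labels `i`. -/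
def topLabels (i : Labels n m) : List (Fin (n + m - 1)) → Labels n m
  | [] => i
  | t :: l => (topLabels i l).sw t

/-- The (undotted) diagram of a word with lower labels `i`. -/
def wordDiagram (i : Labels n m) : List (Fin (n + m - 1)) → RAlg k n m
  | [] => idem k i
  | t :: l => cross k (topLabels i l) t * wordDiagram i l

/-- The diagram of a word with lower labels `i` and with `e a` dots at the top of the bosonic
strand whose upper endpoint is the `a`-th bosonic one from the left. -/
def dottedDiagram (i : Labels n m) (l : List (Fin (n + m - 1))) (e : Fin m → ℕ) : RAlg k n m :=
  (List.ofFn fun a => dot k (topLabels i l) a ^ e a).prod * wordDiagram k i l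

/-! ### Symmetric polynomials in dots -/

theorem dot_mul_dot_comm (i j : Labels n m) (a b : Fin m) :
    dot k i a * dot k j b = dot k j b * dot k i a := by
  have key : ∀ (i j : Labels n m) (a b : Fin m), i ≠ j → dot k i a * dot k j b = 0 := by
    intro i j a b h
    have h1 : dot k i a = dot k i a * idem k i := by
      simpa [dot, idem] using (RingQuot.mkAlgHom_rel k (Rel.dot_idem (k := k) i a)).symm
    have h2 : dot k j b = idem k j * dot k j b := by
      simpa [dot, idem] using (RingQuot.mkAlgHom_rel k (Rel.idem_dot (k := k) j b)).symm
    have h3 : idem k i * idem k j = 0 := by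
      simpa [idem] using RingQuot.mkAlgHom_rel k (Rel.idem_mul_ne (k := k) i j h)
    rw [h1, h2, mul_assoc, ← mul_assoc (idem k i), h3, zero_mul, mul_zero]
  by_cases h : i = j
  · subst h
    simpa [dot] using RingQuot.mkAlgHom_rel k (Rel.dot_dot (k := k) i a b)
  · rw [key i j a b h, key j i b a (Ne.symm h)]

/-- The dot on the `a`-th bosonic strand, summed over all sequences of labels. -/
def dotSum (n : ℕ) {m : ℕ} (a : Fin m) : RAlg k n m := ∑ i : Labels n m, dot k i a

theorem dotSum_comm (n m : ℕ) : ∀ x ∈ Set.range (dotSum k n (m := m)),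
    ∀ y ∈ Set.range (dotSum k n (m := m)), x * y = y * x := by
  rintro _ ⟨a, rfl⟩ _ ⟨b, rfl⟩
  simp only [dotSum, Finset.sum_mul_sum]
  rw [Finset.sum_comm]
  exact Finset.sum_congr rfl fun i _ => Finset.sum_congr rfl fun j _ =>
    dot_mul_dot_comm k j i a b

/-- Polynomials in dots: the algebra homomorphism `k[x_1, …, x_m] → R(n,m)` that sends `x_a` to
the dot on the `a`-th bosonic strand. -/
def polyDots (n m : ℕ) : MvPolynomial (Fin m) k →ₐ[k] RAlg k n m :=
  haveI := Algebra.isMulCommutative_adjoin k (dotSum_comm k n m)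
  letI : CommRing (Algebra.adjoin k (Set.range (dotSum k n (m := m)))) :=
    { (inferInstance : Ring (Algebra.adjoin k (Set.range (dotSum k n (m := m))))) with
      mul_comm := fun x y => IsMulCommutative.is_comm.comm x y }
  (Algebra.adjoin k (Set.range (dotSum k n (m := m)))).val.comp
    (aeval fun a => ⟨dotSum k n a, Algebra.subset_adjoin ⟨a, rfl⟩⟩)

theorem polyDots_X (n : ℕ) {m : ℕ} (a : Fin m) : polyDots k n m (X a) = dotSum k n a := by
  simp [polyDots]

/-- `Sym(n,m)`, the symmetric polynomials in dots on the bosonic strands. -/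
def symDots (n m : ℕ) : Subalgebra k (RAlg k n m) := (symmetricSubalgebra (Fin m) k).map (polyDots k n m)

/-! ### The representation `Pol` -/

theorem sub_dvd_sub_swap {m : ℕ} (a b : Fin m) (f : MvPolynomial (Fin m) k) :
    (X a - X b : MvPolynomial (Fin m) k) ∣ f - rename (Equiv.swap a b) f := by
  induction f using MvPolynomial.induction_on with
  | C c => simp
  | add p q hp hq =>
    have : p + q - rename (Equiv.swap a b) (p + q) =
        (p - rename (Equiv.swap a b) p) + (q - rename (Equiv.swap a b) q) := by
      rw [map_add]; ring
    rw [this]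
    exact dvd_add hp hq
  | mul_X p c hp =>
    have : p * X c - rename (Equiv.swap a b) (p * X c) =
        (p - rename (Equiv.swap a b) p) * X c +
          rename (Equiv.swap a b) p * (X c - X (Equiv.swap a b c)) := by
      rw [map_mul, rename_X]; ring
    rw [this]
    refine dvd_add (dvd_mul_of_dvd_left hp _) (dvd_mul_of_dvd_right ?_ _)
    by_cases hca : c = a
    · subst hca; rw [Equiv.swap_apply_left]
    · by_cases hcb : c = b
      · subst hcb; rw [Equiv.swap_apply_right, ← neg_sub (X a) (X c)]
        exact (dvd_refl _).neg_right
      · rw [Equiv.swap_apply_of_ne_of_ne hca hcb, sub_self]; exact dvd_zero _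

/-- The divided difference `(f - s f) / (x_a - x_b)`, where `s` exchanges `x_a` and `x_b`
(used only for `a ≠ b`). -/
def divDiff {m : ℕ} (a b : Fin m) (f : MvPolynomial (Fin m) k) : MvPolynomial (Fin m) k :=
  (sub_dvd_sub_swap k a b f).choose

theorem divDiff_spec {m : ℕ} (a b : Fin m) (f : MvPolynomial (Fin m) k) :
    f - rename (Equiv.swap a b) f = (X a - X b) * divDiff k a b f :=
  (sub_dvd_sub_swap k a b f).choose_spec

/-- `Pol`: the direct sum over pairs `(i, w)` of polynomial algebras in `m` variables. The
element `f` of the summand `Pol(i,w)` is `Finsupp.single (i, w) f`. -/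
abbrev Pol (n m : ℕ) : Type _ := (Labels n m × Equiv.Perm (Fin n)) →₀ MvPolynomial (Fin m) k

variable {k}

/-- The linear representation `ρ` of `R(n,m)` on `Pol` is given by the stated rules on the
generators. -/
structure IsPolAction (ρ : RAlg k n m →ₐ[k] Module.End k (Pol k n m)) : Prop where
  idem_self : ∀ (i : Labels n m) (w : Equiv.Perm (Fin n)) (f : MvPolynomial (Fin m) k),
    ρ (idem k i) (Finsupp.single (i, w) f) = Finsupp.single (i, w) f
  idem_ne : ∀ (i j : Labels n m) (w : Equiv.Perm (Fin n)) (f : MvPolynomial (Fin m) k), j ≠ i →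
    ρ (idem k i) (Finsupp.single (j, w) f) = 0
  dot_self : ∀ (i : Labels n m) (a : Fin m) (w : Equiv.Perm (Fin n))
    (f : MvPolynomial (Fin m) k),
    ρ (dot k i a) (Finsupp.single (i, w) f) = Finsupp.single (i, w) (X a * f)
  dot_ne : ∀ (i j : Labels n m) (a : Fin m) (w : Equiv.Perm (Fin n))
    (f : MvPolynomial (Fin m) k), j ≠ i → ρ (dot k i a) (Finsupp.single (j, w) f) = 0
  cross_ne : ∀ (i j : Labels n m) (t : Fin (n + m - 1)) (w : Equiv.Perm (Fin n))
    (f : MvPolynomial (Fin m) k), j ≠ i → ρ (cross k i t) (Finsupp.single (j, w) f) = 0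
  /-- two bosonic strands -/
  cross_bos_bos : ∀ (i : Labels n m) (t : Fin (n + m - 1)) (a b : Fin m)
    (w : Equiv.Perm (Fin n)) (f : MvPolynomial (Fin m) k), bos i a = lo t → bos i b = hi t →
    ρ (cross k i t) (Finsupp.single (i, w) f) = Finsupp.single (i, w) (divDiff k a b f)
  /-- lower labels `…12…`, upper labels `…21…` -/
  cross_ferm_bos : ∀ (i : Labels n m) (t : Fin (n + m - 1)) (w : Equiv.Perm (Fin n))
    (f : MvPolynomial (Fin m) k), i.1 (lo t) = false → i.1 (hi t) = true →
    ρ (cross k i t) (Finsupp.single (i, w) f) = Finsupp.single (i.sw t, w) f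
  /-- lower labels `…21…`, upper labels `…12…`, where the `2` is the `a`-th one -/
  cross_bos_ferm : ∀ (i : Labels n m) (t : Fin (n + m - 1)) (a : Fin m)
    (w : Equiv.Perm (Fin n)) (f : MvPolynomial (Fin m) k), bos i a = lo t →
    i.1 (hi t) = false →
    ρ (cross k i t) (Finsupp.single (i, w) f) = Finsupp.single (i.sw t, w) (X a * f)
  /-- the `a`-th and `(a+1)`-st fermionic strands -/
  cross_ferm_ferm_up : ∀ (i : Labels n m) (t : Fin (n + m - 1)) (a : Fin (n - 1))
    (w : Equiv.Perm (Fin n)) (f : MvPolynomial (Fin m) k),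
    ferm i (lo a) = lo t → ferm i (hi a) = hi t → len (simple a * w) = len w + 1 →
    ρ (cross k i t) (Finsupp.single (i, w) f) = Finsupp.single (i, simple a * w) (eps k w a • f)
  cross_ferm_ferm_down : ∀ (i : Labels n m) (t : Fin (n + m - 1)) (a : Fin (n - 1))
    (w : Equiv.Perm (Fin n)) (f : MvPolynomial (Fin m) k),
    ferm i (lo a) = lo t → ferm i (hi a) = hi t → len (simple a * w) + 1 = len w →
    ρ (cross k i t) (Finsupp.single (i, w) f) = 0

end Elements

end GL12

end

open GL12

noncomputable section

namespace GL12

/-! ### Inversions and length -/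

section Inversions

variable {N : ℕ}

/-! A crossing acts on a summand of `Pol` through three independent pieces: an operator on
polynomials (divided difference, multiplication by a variable, or the identity), a left
multiplication in `S_n`, and a sign. Each depends only on the two labels and on the number of
bosonic or fermionic strands to the left. Checking the relations of `R(n,m)` thus reduces to
identities for divided differences and identities for signs.

The sign of a crossing placed on top of `w` is a product of pair signs over the inversions of `w`.
Exchanging two far crossings flips exactly one pair sign, and a braid move flips none because any
two crossings among three strands share a strand (`fermCoef_far`, `fermCoef_braid`). The same
identities define a representation of `LOT_n` with basis indexed by `S_n`; it shows that `σ_w` is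
nonzero, so that `ε_w^a` is determined by its defining equation.

The basis rests on Matsumoto's theorem, `rel_of_reduced`: reduced words of one permutation are
connected by commutation and braid moves. It gives the independence of `σ_w` of the word, and it
bounds `R(n,m)` from above. Dots can be moved to the top at the cost of terms with fewer crossings,
different reduced words agree up to a nonzero scalar and fewer crossings, and a non-reduced word
reduces to fewer crossings. Hence one reduced diagram for each permutation and each lower label
sequence spans over the polynomials in dots (`span_wordDiagram`).

The bound from below comes from `Pol`. A reduced diagram sends `Pol(i,1)` to one summand, indexed by
its top labels and by the permutation `u` of its fermionic strands. The polynomial operator is a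
combination of permutations of the variables over the field of fractions, whose unique longest term
is the permutation `v` of the bosonic strands (`exists_polRep_wordDiagram`). Bottom labels, top
labels, `u` and `v` determine the whole permutation, and by Dedekind's theorem distinct permutations
of the variables are linearly independent over that field. So the reduced diagrams act independently
over polynomials, which yields the basis and faithfulness at once.

Finally, `ψ p = s(p) ψ + ∂p` shows that symmetric polynomials are central. The `m!` monomials below
the staircase span all polynomials over the symmetric ones and are independent, again by Dedekind.
Composing the two bases makes `R(n,m)` free of finite rank over a central polynomial ring, hence
Noetherian on both sides. -/

theorem lo_lt_hi (t : Fin (N - 1)) : lo t < hi t := by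
  simp [lo, hi, Fin.lt_def]

theorem lo_ne_hi (t : Fin (N - 1)) : lo t ≠ hi t := (lo_lt_hi t).ne

theorem simple_lo (t : Fin (N - 1)) : simple t (lo t) = hi t := Equiv.swap_apply_left _ _

theorem simple_hi (t : Fin (N - 1)) : simple t (hi t) = lo t := Equiv.swap_apply_right _ _

theorem simple_of_ne {t : Fin (N - 1)} {p : Fin N} (h₁ : p ≠ lo t) (h₂ : p ≠ hi t) :
    simple t p = p := Equiv.swap_apply_of_ne_of_ne h₁ h₂

theorem simple_mul_self (t : Fin (N - 1)) : simple t * simple t = 1 := Equiv.swap_mul_self _ _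

theorem simple_simple (t : Fin (N - 1)) (p : Fin N) : simple t (simple t p) = p :=
  Equiv.swap_apply_self _ _ _

theorem simple_mul_cancel (t : Fin (N - 1)) (w : Equiv.Perm (Fin N)) :
    simple t * (simple t * w) = w := by
  rw [← mul_assoc, simple_mul_self, one_mul]

theorem simple_inv (t : Fin (N - 1)) : (simple t)⁻¹ = simple t := Equiv.swap_inv _ _

theorem simple_mul_inv_apply (t : Fin (N - 1)) (w : Equiv.Perm (Fin N)) (p : Fin N) :
    (simple t * w)⁻¹ p = w⁻¹ (simple t p) := by
  rw [mul_inv_rev, simple_inv, Equiv.Perm.mul_apply]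

theorem simple_val (t : Fin (N - 1)) (p : Fin N) :
    (simple t p : ℕ) = if (p : ℕ) = t then (t : ℕ) + 1 else if (p : ℕ) = t + 1 then t else p := by
  split_ifs with h h'
  · rw [show p = lo t from Fin.ext h, simple_lo]; rfl
  · rw [show p = hi t from Fin.ext h', simple_hi]; rfl
  · rw [simple_of_ne (fun e => h (by rw [e]; rfl)) (fun e => h' (by rw [e]; rfl))]

theorem simple_comm {a b : Fin (N - 1)} (h : (a : ℕ) + 1 < b) :
    simple a * simple b = simple b * simple a := by
  ext p
  simp only [Equiv.Perm.mul_apply, simple_val]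
  grind

theorem simple_braid {a b : Fin (N - 1)} (h : (a : ℕ) + 1 = b) :
    simple a * simple b * simple a = simple b * simple a * simple b := by
  ext p
  simp only [Equiv.Perm.mul_apply, simple_val]
  grind

open Classical in
/-- The set of inversions of a permutation. -/
def invs (w : Equiv.Perm (Fin N)) : Finset (Fin N × Fin N) :=
  Finset.univ.filter (IsInversion w)

@[simp]
theorem mem_invs {w : Equiv.Perm (Fin N)} {p : Fin N × Fin N} :
    p ∈ invs w ↔ p.1 < p.2 ∧ w p.2 < w p.1 := by
  simp [invs, IsInversion]

/-- Multiplying `w` by `s_a` on the left creates an inversion. -/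
def Up (a : Fin (N - 1)) (w : Equiv.Perm (Fin N)) : Prop := w⁻¹ (lo a) < w⁻¹ (hi a)

/-- The pair of lower endpoints of the strands that `s_a` crosses on top of `w`. -/
def cr (a : Fin (N - 1)) (w : Equiv.Perm (Fin N)) : Fin N × Fin N := (w⁻¹ (lo a), w⁻¹ (hi a))

theorem up_simple_mul {a : Fin (N - 1)} {w : Equiv.Perm (Fin N)} :
    Up a (simple a * w) ↔ ¬ Up a w := by
  unfold Up
  rw [simple_mul_inv_apply, simple_mul_inv_apply, simple_lo, simple_hi, not_lt]
  exact ⟨le_of_lt, fun h => lt_of_le_of_ne h fun e => lo_ne_hi a (w⁻¹.injective e).symm⟩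

/-- Multiplying by `s_a` on the left exchanges the values `a` and `a + 1`, and these compare in the
same way with every other value. So only the pair of positions carrying these two values changes its
status. -/
theorem invs_simple_mul {a : Fin (N - 1)} {w : Equiv.Perm (Fin N)} (h : Up a w) :
    invs (simple a * w) = insert (cr a w) (invs w) := by
  ext ⟨p, q⟩
  simp only [mem_invs, Finset.mem_insert, cr, Prod.mk.injEq, Equiv.Perm.mul_apply]
  unfold Up at h
  have hp : p = w⁻¹ (lo a) ↔ (w p : ℕ) = a := by
    rw [Equiv.Perm.eq_inv_iff_eq, Fin.ext_iff]; rfl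
  have hq : q = w⁻¹ (hi a) ↔ (w q : ℕ) = a + 1 := by
    rw [Equiv.Perm.eq_inv_iff_eq, Fin.ext_iff]; rfl
  have hp' : p = w⁻¹ (hi a) ↔ (w p : ℕ) = a + 1 := by
    rw [Equiv.Perm.eq_inv_iff_eq, Fin.ext_iff]; rfl
  have hq' : q = w⁻¹ (lo a) ↔ (w q : ℕ) = a := by
    rw [Equiv.Perm.eq_inv_iff_eq, Fin.ext_iff]; rfl
  rw [hp, hq]
  by_cases hpq : p = q
  · subst hpq; simp; omega
  have hne : (w p : ℕ) ≠ w q := fun e => hpq (w.injective (Fin.ext e))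
  -- `Up` puts the position with value `a` before the one with value `a + 1`, so the adjacent pair
  -- of values occurs in increasing order only.
  have key : p < q → ¬ ((w p : ℕ) = a + 1 ∧ (w q : ℕ) = a) := by
    rintro hlt ⟨h1, h2⟩
    rw [hp'.2 h1, hq'.2 h2] at hlt
    exact absurd h hlt.asymm
  have key2 : (w p : ℕ) = a ∧ (w q : ℕ) = a + 1 → p < q := by
    rintro ⟨h1, h2⟩
    rw [hp.2 h1, hq.2 h2]; exact h
  rw [Fin.lt_def (a := simple a (w q)), Fin.lt_def (a := w q), simple_val, simple_val]
  by_cases hlt : p < q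
  · have := key hlt
    simp only [hlt, true_and]
    split_ifs <;> omega
  · simp only [hlt, false_and, or_false, false_iff]
    exact fun h => hlt (key2 h)

theorem cr_notMem_invs {a : Fin (N - 1)} {w : Equiv.Perm (Fin N)} : cr a w ∉ invs w := by
  simp only [mem_invs, cr, not_and, not_lt]
  intro _
  simpa using (lo_lt_hi a).le

theorem card_invs_up {a : Fin (N - 1)} {w : Equiv.Perm (Fin N)} (h : Up a w) :
    (invs (simple a * w)).card = (invs w).card + 1 := by
  rw [invs_simple_mul h, Finset.card_insert_of_notMem cr_notMem_invs]

theorem card_invs_down {a : Fin (N - 1)} {w : Equiv.Perm (Fin N)} (h : ¬ Up a w) :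
    (invs (simple a * w)).card + 1 = (invs w).card := by
  have := card_invs_up (up_simple_mul.2 h)
  rwa [simple_mul_cancel, eq_comm] at this

theorem wordPerm_cons (a : Fin (N - 1)) (l : List (Fin (N - 1))) :
    wordPerm (a :: l) = simple a * wordPerm l := by simp [wordPerm]

theorem card_invs_wordPerm_le (l : List (Fin (N - 1))) :
    (invs (wordPerm l)).card ≤ l.length := by
  induction l with
  | nil =>
    rw [List.length_nil, Nat.le_zero, Finset.card_eq_zero, Finset.eq_empty_iff_forall_notMem]
    rintro ⟨p, q⟩
    simp only [mem_invs, wordPerm, List.map_nil, List.prod_nil, Equiv.Perm.one_apply]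
    exact fun h => h.1.asymm h.2
  | cons a l ih =>
    rw [wordPerm_cons, List.length_cons]
    by_cases h : Up a (wordPerm l)
    · rw [card_invs_up h]; omega
    · have := card_invs_down h; omega

/-- Without descents `w⁻¹` is strictly increasing, and the only order automorphism of a finite chain
is the identity. -/
theorem eq_one_of_forall_up {w : Equiv.Perm (Fin N)} (h : ∀ a, Up a w) : w = 1 := by
  obtain _ | N := N
  · exact Subsingleton.elim _ _
  have hm : StrictMono (w⁻¹ : Equiv.Perm (Fin (N + 1))) :=
    Fin.strictMono_iff_lt_succ.2 fun i => h i
  have : w⁻¹ = 1 := by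
    ext p
    have := Subsingleton.elim (StrictMono.orderIsoOfSurjective _ hm w⁻¹.surjective)
      (OrderIso.refl (Fin (N + 1)))
    exact congrArg Fin.val (DFunLike.congr_fun this p)
  rwa [inv_eq_one] at this

/-- Sorting: as long as some `s_a` removes an inversion, apply it; the word of the steps has one
letter for each inversion. -/
theorem exists_word_length_eq (w : Equiv.Perm (Fin N)) :
    ∃ l, wordPerm l = w ∧ l.length = (invs w).card := by
  induction hc : (invs w).card using Nat.strong_induction_on generalizing w with
  | _ c ih =>
    by_cases h : ∀ a, Up a w
    · refine ⟨[], (eq_one_of_forall_up h).symm, ?_⟩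
      have := card_invs_wordPerm_le ([] : List (Fin (N - 1)))
      rw [show wordPerm [] = w from (eq_one_of_forall_up h).symm] at this
      simp only [List.length_nil] at this ⊢
      omega
    · push Not at h
      obtain ⟨a, ha⟩ := h
      have hd := card_invs_down ha
      obtain ⟨l, hl, hlen⟩ := ih _ (by omega) (simple a * w) rfl
      refine ⟨a :: l, by rw [wordPerm_cons, hl, simple_mul_cancel], ?_⟩
      rw [List.length_cons]; omega

theorem len_eq_card_invs (w : Equiv.Perm (Fin N)) : len w = (invs w).card := by
  apply le_antisymm
  · exact Nat.sInf_le (exists_word_length_eq w)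
  · obtain ⟨l, hl, hlen⟩ := exists_reducedWord w
    rw [← hlen, ← hl]
    exact card_invs_wordPerm_le l

theorem len_up {a : Fin (N - 1)} {w : Equiv.Perm (Fin N)} (h : Up a w) :
    len (simple a * w) = len w + 1 := by
  rw [len_eq_card_invs, len_eq_card_invs, card_invs_up h]

theorem len_down {a : Fin (N - 1)} {w : Equiv.Perm (Fin N)} (h : ¬ Up a w) :
    len (simple a * w) + 1 = len w := by
  rw [len_eq_card_invs, len_eq_card_invs, card_invs_down h]

theorem up_iff_len {a : Fin (N - 1)} {w : Equiv.Perm (Fin N)} :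
    Up a w ↔ len (simple a * w) = len w + 1 := by
  refine ⟨len_up, fun h => ?_⟩
  by_contra h'
  have := len_down h'
  omega

theorem len_simple_mul_le (a : Fin (N - 1)) (w : Equiv.Perm (Fin N)) :
    len (simple a * w) ≤ len w + 1 := by
  by_cases h : Up a w
  · exact (len_up h).le
  · have := len_down h; omega

/-! ### Reduced words and descents -/

theorem len_wordPerm_le (l : List (Fin (N - 1))) : len (wordPerm l) ≤ l.length :=
  Nat.sInf_le ⟨l, rfl, rfl⟩

/-- The word `l` is reduced. -/
def Reduced (l : List (Fin (N - 1))) : Prop := l.length = len (wordPerm l)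

theorem reduced_cons {a : Fin (N - 1)} {l : List (Fin (N - 1))} :
    Reduced (a :: l) ↔ Reduced l ∧ Up a (wordPerm l) := by
  unfold Reduced
  rw [wordPerm_cons, List.length_cons]
  have h1 := len_wordPerm_le l
  constructor
  · intro h
    have h2 := len_simple_mul_le a (wordPerm l)
    exact ⟨by omega, up_iff_len.2 (by omega)⟩
  · rintro ⟨h, hu⟩
    rw [len_up hu, h]

theorem reduced_nil : Reduced ([] : List (Fin (N - 1))) := by
  have := len_wordPerm_le ([] : List (Fin (N - 1)))
  unfold Reduced
  simp only [List.length_nil] at this ⊢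
  omega

theorem isReducedWord_iff {l : List (Fin (N - 1))} {w : Equiv.Perm (Fin N)} :
    IsReducedWord l w ↔ wordPerm l = w ∧ Reduced l := by
  unfold IsReducedWord Reduced
  constructor <;> rintro ⟨rfl, h⟩ <;> exact ⟨rfl, h⟩

theorem exists_reduced (w : Equiv.Perm (Fin N)) : ∃ l, wordPerm l = w ∧ Reduced l :=
  let ⟨l, hl⟩ := exists_reducedWord w; ⟨l, isReducedWord_iff.1 hl⟩

/-- This replaces the exchange condition: a left descent of `w` is the first letter of some reduced
word of `w`. -/
theorem exists_reduced_cons {a : Fin (N - 1)} {w : Equiv.Perm (Fin N)} (h : ¬ Up a w) :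
    ∃ l, wordPerm (a :: l) = w ∧ Reduced (a :: l) := by
  obtain ⟨l, hl, hr⟩ := exists_reduced (simple a * w)
  refine ⟨l, by rw [wordPerm_cons, hl, simple_mul_cancel], reduced_cons.2 ⟨hr, ?_⟩⟩
  rw [hl]; exact up_simple_mul.2 h

theorem cr_far {a b : Fin (N - 1)} (h : (a : ℕ) + 1 < b ∨ (b : ℕ) + 1 < a)
    (w : Equiv.Perm (Fin N)) : cr a (simple b * w) = cr a w := by
  simp only [cr, simple_mul_inv_apply]
  rw [simple_of_ne, simple_of_ne] <;> simp only [lo, hi, ne_eq, Fin.ext_iff] <;> omega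

theorem up_iff_cr {a : Fin (N - 1)} {w : Equiv.Perm (Fin N)} :
    Up a w ↔ (cr a w).1 < (cr a w).2 := Iff.rfl

theorem up_far_iff {a b : Fin (N - 1)} (h : (a : ℕ) + 1 < b ∨ (b : ℕ) + 1 < a)
    (w : Equiv.Perm (Fin N)) : Up a (simple b * w) ↔ Up a w := by
  rw [up_iff_cr, up_iff_cr, cr_far h]

/-! The crossings of three adjacent strands. -/

theorem hi_eq_lo {a b : Fin (N - 1)} (h : (a : ℕ) + 1 = b) : hi a = lo b := Fin.ext h

theorem simple_hi_adj {a b : Fin (N - 1)} (h : (a : ℕ) + 1 = b) : simple a (hi b) = hi b := by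
  apply simple_of_ne <;> simp only [lo, hi, ne_eq, Fin.ext_iff] <;> omega

theorem simple_lo_adj {a b : Fin (N - 1)} (h : (a : ℕ) + 1 = b) : simple b (lo a) = lo a := by
  apply simple_of_ne <;> simp only [lo, hi, ne_eq, Fin.ext_iff] <;> omega

theorem cr_right_of_left {a b : Fin (N - 1)} (h : (a : ℕ) + 1 = b)
    (w : Equiv.Perm (Fin N)) : cr b (simple a * w) = (w⁻¹ (lo a), w⁻¹ (hi b)) := by
  simp only [cr, simple_mul_inv_apply, ← hi_eq_lo h, simple_hi, simple_hi_adj h]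

theorem cr_left_of_right {a b : Fin (N - 1)} (h : (a : ℕ) + 1 = b)
    (w : Equiv.Perm (Fin N)) : cr a (simple b * w) = (w⁻¹ (lo a), w⁻¹ (hi b)) := by
  simp only [cr, simple_mul_inv_apply, hi_eq_lo h, simple_lo, simple_lo_adj h]

theorem cr_left_of_right_left {a b : Fin (N - 1)} (h : (a : ℕ) + 1 = b)
    (w : Equiv.Perm (Fin N)) : cr a (simple b * (simple a * w)) = cr b w := by
  rw [cr_left_of_right h, simple_mul_inv_apply, simple_mul_inv_apply, simple_lo, simple_hi_adj h,
    hi_eq_lo h]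
  rfl

theorem cr_right_of_left_right {a b : Fin (N - 1)} (h : (a : ℕ) + 1 = b)
    (w : Equiv.Perm (Fin N)) : cr b (simple a * (simple b * w)) = cr a w := by
  rw [cr_right_of_left h, simple_mul_inv_apply, simple_mul_inv_apply, simple_hi, simple_lo_adj h,
    ← hi_eq_lo h]
  rfl

/-- Any two reduced words of a permutation are related by a relation that is compatible with
prefixing letters and contains the commutation and braid moves. -/
theorem rel_of_reduced {r : List (Fin (N - 1)) → List (Fin (N - 1)) → Prop}
    (refl : ∀ l, Reduced l → r l l) (symm : ∀ l l', r l l' → r l' l)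
    (trans : ∀ l l' l'', r l l' → r l' l'' → r l l'')
    (cons : ∀ a l l', wordPerm l = wordPerm l' → Reduced (a :: l) → Reduced (a :: l') →
      r l l' → r (a :: l) (a :: l'))
    (far : ∀ (a b : Fin (N - 1)) l, (a : ℕ) + 1 < b → Reduced (a :: b :: l) → Reduced (b :: a :: l) →
      r (a :: b :: l) (b :: a :: l))
    (braid : ∀ (a b : Fin (N - 1)) l, (a : ℕ) + 1 = b → Reduced (a :: b :: a :: l) →
      Reduced (b :: a :: b :: l) → r (a :: b :: a :: l) (b :: a :: b :: l))
    {l l' : List (Fin (N - 1))} (hw : wordPerm l = wordPerm l') (hl : Reduced l)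
    (hl' : Reduced l') : r l l' := by
  induction hd : l.length generalizing l l' with
  | zero =>
    have h1 : l = [] := List.length_eq_zero_iff.1 hd
    have h2 : l' = [] := by
      apply List.length_eq_zero_iff.1
      rw [hl', ← hw, ← hl, hd]
    subst h1 h2
    exact refl _ reduced_nil
  | succ d ih =>
    -- If the first letters agree, they cancel. Otherwise both are descents of the common
    -- permutation, and by symmetry of the relation the smaller one may be taken first.
    have main : ∀ (a b : Fin (N - 1)) (l l' : List (Fin (N - 1))), (a : ℕ) < b →
        wordPerm (a :: l) = wordPerm (b :: l') → Reduced (a :: l) → Reduced (b :: l') →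
        l.length = d → r (a :: l) (b :: l') := by
      intro a b l l' hab hw hl hl' hlen
      have hlen' : l'.length = d := by
        have : (b :: l').length = (a :: l).length := by rw [hl, hl', hw]
        simpa [hlen] using this
      have hra := reduced_cons.1 hl
      have hrb := reduced_cons.1 hl'
      have hda : ¬ Up a (wordPerm (a :: l)) := by
        rw [wordPerm_cons, up_simple_mul, not_not]; exact hra.2
      have hdb : ¬ Up b (wordPerm (a :: l)) := by
        rw [hw, wordPerm_cons, up_simple_mul, not_not]; exact hrb.2
      have hwl : wordPerm l = simple a * wordPerm (a :: l) := by
        rw [wordPerm_cons, simple_mul_cancel]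
      have hwl' : wordPerm l' = simple b * wordPerm (a :: l) := by
        rw [hw, wordPerm_cons, simple_mul_cancel]
      rcases Nat.lt_or_ge (a + 1) b with hfar | hadj
      -- Both `a` and `b` are descents and they commute, so the permutation has reduced words `a b
      -- u` and `b a u`. The chain is `a l`, `a b u`, `b a u`, `b l'`; its outer links follow from
      -- the induction hypothesis on the tails.
      · have hb : ¬ Up b (wordPerm l) := by
          rw [hwl, up_far_iff (Or.inr hfar)]; exact hdb
        obtain ⟨u, hu, hur⟩ := exists_reduced_cons hb
        have e1 : wordPerm (a :: u) = wordPerm l' := by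
          rw [hwl', wordPerm_cons, wordPerm_cons, ← hu, wordPerm_cons,
            ← mul_assoc (simple a) (simple b), simple_comm hfar, mul_assoc, simple_mul_cancel]
        have r1 : Reduced (a :: b :: u) := reduced_cons.2 ⟨hur, by rw [hu]; exact hra.2⟩
        have r2 : Reduced (a :: u) := reduced_cons.2 ⟨(reduced_cons.1 hur).1, by
          have := (reduced_cons.1 r1).2
          rwa [wordPerm_cons, up_far_iff (Or.inl hfar)] at this⟩
        have r3 : Reduced (b :: a :: u) := reduced_cons.2 ⟨r2, by rw [e1]; exact hrb.2⟩
        refine trans _ _ _ (cons a l (b :: u) hu.symm hl r1 (ih hu.symm hra.1 hur hlen)) ?_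
        refine trans _ _ _ (far a b u hfar r1 r3) ?_
        exact cons b _ _ e1 r3 hl' (symm _ _ (ih e1.symm hrb.1 r2 hlen'))
      · have hab' : (a : ℕ) + 1 = b := by omega
        set w := wordPerm (a :: l) with hwdef
        -- Two adjacent descents `a`, `b` mean that three adjacent strands are completely reversed.
        -- Hence there are reduced words `a b a u` and `b a b u`, and the chain runs through these
        -- two.
        have hb : ¬ Up b (wordPerm l) := by
          rw [hwl, up_iff_cr, cr_right_of_left hab', not_lt]
          unfold Up at hda hdb
          rw [not_lt] at hda hdb
          rw [← hi_eq_lo hab'] at hdb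
          exact hdb.trans hda
        have ha' : ¬ Up a (simple b * wordPerm l) := by
          rw [hwl, up_iff_cr, cr_left_of_right_left hab']; exact hdb
        obtain ⟨u, hu, hur⟩ := exists_reduced_cons ha'
        have e0 : wordPerm (b :: a :: u) = wordPerm l := by
          rw [wordPerm_cons, hu, simple_mul_cancel]
        have r1 : Reduced (b :: a :: u) := reduced_cons.2 ⟨hur, by
          rw [hu]; exact up_simple_mul.2 hb⟩
        have r2 : Reduced (a :: b :: a :: u) := reduced_cons.2 ⟨r1, by rw [e0]; exact hra.2⟩
        have e1 : wordPerm (a :: b :: u) = wordPerm l' := by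
          have : wordPerm (b :: a :: b :: u) = w := by
            have hbr := congrArg (· * wordPerm u) (simple_braid hab')
            simp only [mul_assoc] at hbr
            simp only [wordPerm_cons, ← hbr]
            rw [← wordPerm_cons a u, hu, simple_mul_cancel, hwdef, wordPerm_cons]
          rw [hwl', ← this, wordPerm_cons b (a :: b :: u), simple_mul_cancel]
        have hlenu : (a :: b :: u).length = len (wordPerm l') := by
          rw [← hrb.1, hlen', ← hlen, hra.1, ← e0, ← r1]; simp
        have r3 : Reduced (a :: b :: u) := by unfold Reduced; rw [e1]; exact hlenu
        have r4 : Reduced (b :: a :: b :: u) := reduced_cons.2 ⟨r3, by rw [e1]; exact hrb.2⟩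
        refine trans _ _ _ (cons a l _ e0.symm hl r2 (ih e0.symm hra.1 r1 hlen)) ?_
        refine trans _ _ _ (braid a b u hab' r2 r4) ?_
        exact cons b _ _ e1 r4 hl' (symm _ _ (ih e1.symm hrb.1 r3 hlen'))
    obtain _ | ⟨a, l⟩ := l
    · simp at hd
    have hlen : l.length = d := by simpa using hd
    obtain _ | ⟨b, l'⟩ := l'
    · have : ([] : List (Fin (N - 1))).length = (a :: l).length := by rw [hl, hl', hw]
      simp at this
    have hlen' : l'.length = d := by
      have : (b :: l').length = (a :: l).length := by rw [hl, hl', hw]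
      simpa [hlen] using this
    rcases lt_trichotomy (a : ℕ) b with hab | hab | hab
    · exact main a b l l' hab hw hl hl' hlen
    · obtain rfl : a = b := Fin.ext hab
      have hw' : wordPerm l = wordPerm l' := by
        rw [wordPerm_cons, wordPerm_cons] at hw
        exact mul_left_cancel hw
      exact cons a l l' hw' hl hl' (ih hw' (reduced_cons.1 hl).1 (reduced_cons.1 hl').1 hlen)
    · exact symm _ _ (main b a l' l hab hw.symm hl' hl hlen')

end Inversions

/-! ### Signs -/

section Signs

variable {n : ℕ}

/-- The sign of a pair of crossings `p`, `q` with `p` on top of `q`. -/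
def pairSign (p q : Fin n × Fin n) : ℤ :=
  if p.1 < q.1 ∧ p.1 ≠ q.2 ∧ p.2 ≠ q.1 ∧ p.2 ≠ q.2 then -1 else 1

/-- The sign of a crossing `p` on top of all the inversions of `w`. -/
def topSign (w : Equiv.Perm (Fin n)) (p : Fin n × Fin n) : ℤ := ∏ q ∈ invs w, pairSign p q

/-- The coefficient of `s_a w` in the product of the crossing `σ_a` with `σ_w`. -/
def fermCoef (w : Equiv.Perm (Fin n)) (a : Fin (n - 1)) : ℤ :=
  open Classical in if Up a w then topSign w (cr a w) else 0

theorem fermCoef_up {w : Equiv.Perm (Fin n)} {a : Fin (n - 1)} (h : Up a w) :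
    fermCoef w a = topSign w (cr a w) := if_pos h

theorem fermCoef_down {w : Equiv.Perm (Fin n)} {a : Fin (n - 1)} (h : ¬ Up a w) :
    fermCoef w a = 0 := if_neg h

theorem pairSign_mul_self (p q : Fin n × Fin n) : pairSign p q * pairSign p q = 1 := by
  unfold pairSign; split_ifs <;> norm_num

theorem topSign_mul_self (w : Equiv.Perm (Fin n)) (p : Fin n × Fin n) :
    topSign w p * topSign w p = 1 := by
  simp [topSign, ← Finset.prod_mul_distrib, pairSign_mul_self]

theorem topSign_simple_mul {w : Equiv.Perm (Fin n)} {a : Fin (n - 1)} (h : Up a w)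
    (p : Fin n × Fin n) : topSign (simple a * w) p = pairSign p (cr a w) * topSign w p := by
  rw [topSign, invs_simple_mul h, Finset.prod_insert cr_notMem_invs, topSign]

theorem fermCoef_sq (w : Equiv.Perm (Fin n)) (a : Fin (n - 1)) :
    fermCoef (simple a * w) a * fermCoef w a = 0 := by
  by_cases h : Up a w
  · rw [fermCoef_down (w := simple a * w), zero_mul]
    rw [up_simple_mul, not_not]; exact h
  · rw [fermCoef_down h, mul_zero]

theorem pairSign_antisymm {p q : Fin n × Fin n} (h₀ : p.1 ≠ q.1) (h₁ : p.1 ≠ q.2)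
    (h₂ : p.2 ≠ q.1) (h₃ : p.2 ≠ q.2) : pairSign p q = -pairSign q p := by
  unfold pairSign
  rcases lt_or_gt_of_ne h₀ with h | h
  · rw [if_pos ⟨h, h₁, h₂, h₃⟩, if_neg (fun h' => h.asymm h'.1)]
  · rw [if_neg (fun h' => h.asymm h'.1), if_pos ⟨h, h₂.symm, h₁.symm, h₃.symm⟩]; rfl

/-- The two crossings involve four different strands. The only difference between the two orders is
the sign between these crossings, and `pairSign` is antisymmetric on disjoint pairs. -/
theorem fermCoef_far (w : Equiv.Perm (Fin n)) {a b : Fin (n - 1)} (h : (a : ℕ) + 1 < b) :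
    fermCoef (simple b * w) a * fermCoef w b = -(fermCoef (simple a * w) b * fermCoef w a) := by
  have h1 := up_far_iff (Or.inl h) w
  have h2 := up_far_iff (Or.inr h) w
  by_cases ha : Up a w
  · by_cases hb : Up b w
    · rw [fermCoef_up ha, fermCoef_up hb, fermCoef_up (h1.2 ha), fermCoef_up (h2.2 hb),
        topSign_simple_mul ha, topSign_simple_mul hb, cr_far (Or.inl h), cr_far (Or.inr h),
        pairSign_antisymm]
      · ring
      all_goals
        simp only [cr, ne_eq, EmbeddingLike.apply_eq_iff_eq, lo, hi, Fin.ext_iff]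
        omega
    · rw [fermCoef_down hb, fermCoef_down (fun h' => hb (h2.1 h'))]; simp
  · rw [fermCoef_down ha, fermCoef_down (fun h' => ha (h1.1 h'))]; simp

/-- Any two of the three crossings share a strand and hence have trivial pair sign. What remains on
either side is the product of the signs of the same three crossings relative to the inversions of
`w`. -/
theorem fermCoef_braid (w : Equiv.Perm (Fin n)) {a b : Fin (n - 1)} (h : (a : ℕ) + 1 = b) :
    fermCoef (simple b * (simple a * w)) a * fermCoef (simple a * w) b * fermCoef w a =
      fermCoef (simple a * (simple b * w)) b * fermCoef (simple b * w) a * fermCoef w b := by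
  have u1 : Up a (simple b * (simple a * w)) ↔ Up b w := by
    rw [up_iff_cr, up_iff_cr, cr_left_of_right_left h]
  have u2 : Up b (simple a * (simple b * w)) ↔ Up a w := by
    rw [up_iff_cr, up_iff_cr, cr_right_of_left_right h]
  have u3 : Up a (simple b * w) ↔ Up b (simple a * w) := by
    rw [up_iff_cr, up_iff_cr, cr_right_of_left h, cr_left_of_right h]
  by_cases ha : Up a w
  swap
  · rw [fermCoef_down ha, fermCoef_down (fun h' => ha (u2.1 h'))]; simp
  by_cases hb : Up b w
  swap
  · rw [fermCoef_down hb, fermCoef_down (fun h' => hb (u1.1 h'))]; simp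
  by_cases hc : Up b (simple a * w)
  swap
  · rw [fermCoef_down hc, fermCoef_down (fun h' => hc (u3.1 h'))]; simp
  have hc' := u3.2 hc
  rw [fermCoef_up ha, fermCoef_up hb, fermCoef_up hc, fermCoef_up hc', fermCoef_up (u1.2 hb),
    fermCoef_up (u2.2 ha), cr_left_of_right_left h, cr_right_of_left_right h, topSign_simple_mul hc, topSign_simple_mul hc',
    topSign_simple_mul ha, topSign_simple_mul ha, topSign_simple_mul hb, topSign_simple_mul hb,
    cr_right_of_left h, cr_left_of_right h]
  have e1 : pairSign (w⁻¹ (lo a), w⁻¹ (hi b)) (cr a w) = 1 := if_neg (by simp [cr])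
  have e2 : pairSign (w⁻¹ (lo a), w⁻¹ (hi b)) (cr b w) = 1 := if_neg (by simp [cr])
  have e3 : pairSign (cr b w) (cr a w) = 1 := if_neg (by simp [cr, hi_eq_lo h])
  have e4 : pairSign (cr a w) (cr b w) = 1 := if_neg (by simp [cr, hi_eq_lo h])
  have e5 : pairSign (cr b w) (w⁻¹ (lo a), w⁻¹ (hi b)) = 1 := if_neg (by simp [cr])
  have e6 : pairSign (cr a w) (w⁻¹ (lo a), w⁻¹ (hi b)) = 1 := if_neg (by simp [cr])
  rw [e1, e2, e3, e4, e5, e6]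
  ring

/-- Pairs that are not disjoint, or not ordered by first entry, contribute `1` through `pairSign`.
The index set thereby becomes a full product, which splits well when an inversion is added. -/
theorem wordSign_eq_prod (l : List (Fin (n - 1))) :
    wordSign l = ∏ p ∈ invs (wordPerm l), ∏ q ∈ invs (wordPerm l),
      if (crossings l).idxOf q < (crossings l).idxOf p then 1 else pairSign p q := by
  rw [← Finset.prod_product', wordSign, disjointInversions]
  classical
  have : (invs (wordPerm l) ×ˢ invs (wordPerm l)) =
      Finset.univ.filter fun x : (Fin n × Fin n) × (Fin n × Fin n) =>
        IsInversion (wordPerm l) x.1 ∧ IsInversion (wordPerm l) x.2 := by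
    ext x
    simp only [Finset.mem_product, mem_invs, Finset.mem_filter, Finset.mem_univ, true_and]
    rfl
  rw [this, Finset.prod_filter, Finset.prod_filter]
  refine Finset.prod_congr rfl fun x _ => ?_
  unfold pairSign
  split_ifs <;> first | rfl | (exfalso; tauto)

theorem crossings_cons (a : Fin (n - 1)) (l : List (Fin (n - 1))) :
    crossings (a :: l) = cr a (wordPerm l) :: crossings l := rfl

/-- The new crossing is at index `0`. As first member of a pair it is always on top and contributes
`pairSign`; as second member it contributes `1`; the indices of the old crossings shift by one and
keep their order. -/
theorem wordSign_cons {a : Fin (n - 1)} {l : List (Fin (n - 1))} (h : Up a (wordPerm l)) :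
    wordSign (a :: l) = topSign (wordPerm l) (cr a (wordPerm l)) * wordSign l := by
  rw [wordSign_eq_prod, wordSign_eq_prod, wordPerm_cons, invs_simple_mul h, crossings_cons]
  have hne : ∀ q ∈ invs (wordPerm l), cr a (wordPerm l) ≠ q := fun q hq e =>
    cr_notMem_invs (e ▸ hq)
  simp only [Finset.prod_insert cr_notMem_invs, List.idxOf_cons_self, Nat.not_lt_zero, if_false]
  have e1 : pairSign (cr a (wordPerm l)) (cr a (wordPerm l)) = 1 := if_neg (by simp)
  rw [e1, one_mul, topSign, ← Finset.prod_congr rfl fun q _ => rfl]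
  congr 1
  refine Finset.prod_congr rfl fun p hp => ?_
  rw [List.idxOf_cons_ne _ (hne p hp), if_pos (Nat.succ_pos _), one_mul]
  refine Finset.prod_congr rfl fun q hq => ?_
  rw [List.idxOf_cons_ne _ (hne q hq)]
  simp

end Signs

/-! ### The algebra of fermionic strands -/

section LOT

variable (k : Type*) [Field k] {n : ℕ}

theorem sigmaGen_far {a b : Fin (n - 1)} (h : (a : ℕ) + 1 < b) :
    sigmaGen k a * sigmaGen k b = (-1 : ℤ) • (sigmaGen k b * sigmaGen k a) := by
  rw [neg_one_smul, ← add_eq_zero_iff_eq_neg]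
  simpa [sigmaGen] using RingQuot.mkAlgHom_rel k (LOTRel.far (k := k) a b (Or.inl h))

theorem sigmaGen_braid {a b : Fin (n - 1)} (h : (a : ℕ) + 1 = b) :
    sigmaGen k a * sigmaGen k b * sigmaGen k a = sigmaGen k b * sigmaGen k a * sigmaGen k b := by
  simpa [sigmaGen] using RingQuot.mkAlgHom_rel k (LOTRel.braid (k := k) a b h)

/-- The signed product of generators along a word. -/
def signedProd (l : List (Fin (n - 1))) : LOT k n := wordSign l • (l.map (sigmaGen k)).prod

theorem signedProd_cons {a : Fin (n - 1)} {l : List (Fin (n - 1))} (h : Up a (wordPerm l)) :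
    signedProd k (a :: l) = fermCoef (wordPerm l) a • (sigmaGen k a * signedProd k l) := by
  rw [signedProd, signedProd, wordSign_cons h, fermCoef_up h, List.map_cons, List.prod_cons,
    mul_smul_comm, smul_smul]

/-- In a commutation move the sign from anticommuting generators cancels the sign from
`fermCoef_far`; in a braid move both the products and the coefficients agree. -/
theorem signedProd_eq_of_reduced {l l' : List (Fin (n - 1))} (hw : wordPerm l = wordPerm l')
    (hl : Reduced l) (hl' : Reduced l') : signedProd k l = signedProd k l' := by
  refine rel_of_reduced (r := fun l l' => signedProd k l = signedProd k l') (fun _ _ => rfl)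
    (fun _ _ h => h.symm) (fun _ _ _ h h' => h.trans h') ?_ ?_ ?_ hw hl hl'
  · intro a l l' hw hl hl' h
    rw [signedProd_cons k (reduced_cons.1 hl).2, signedProd_cons k (reduced_cons.1 hl').2, hw, h]
  · intro a b l h hl hl'
    have h1 := reduced_cons.1 hl
    have h2 := reduced_cons.1 hl'
    rw [signedProd_cons k h1.2, signedProd_cons k h2.2, signedProd_cons k (reduced_cons.1 h1.1).2,
      signedProd_cons k (reduced_cons.1 h2.1).2, wordPerm_cons, wordPerm_cons]
    simp only [mul_smul_comm, smul_smul]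
    rw [fermCoef_far _ h, ← mul_assoc, ← mul_assoc, sigmaGen_far k h, smul_mul_assoc,
      smul_smul, mul_neg_one, neg_neg]
  · intro a b l h hl hl'
    have h1 := reduced_cons.1 hl
    have h2 := reduced_cons.1 hl'
    have h3 := reduced_cons.1 h1.1
    have h4 := reduced_cons.1 h2.1
    rw [signedProd_cons k h1.2, signedProd_cons k h2.2, signedProd_cons k h3.2,
      signedProd_cons k h4.2, signedProd_cons k (reduced_cons.1 h3.1).2,
      signedProd_cons k (reduced_cons.1 h4.1).2]
    simp only [wordPerm_cons, mul_smul_comm, smul_smul]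
    have e := congrArg (· * signedProd k l) (sigmaGen_braid k h)
    simp only [mul_assoc] at e
    rw [← mul_assoc (fermCoef _ _), ← mul_assoc (fermCoef _ _), fermCoef_braid _ h, e]

theorem sigma_eq_of_reduced {w : Equiv.Perm (Fin n)} {l : List (Fin (n - 1))}
    (hl : IsReducedWord l w) : sigma k w = wordSign l • (l.map (sigmaGen k)).prod := by
  have h0 := isReducedWord_iff.1 (exists_reducedWord w).choose_spec
  have h1 := isReducedWord_iff.1 hl
  exact signedProd_eq_of_reduced k (h0.1.trans h1.1.symm) h0.2 h1.2

theorem sigma_simple_mul {w : Equiv.Perm (Fin n)} {a : Fin (n - 1)} (h : Up a w) :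
    sigma k (simple a * w) = fermCoef w a • (sigmaGen k a * sigma k w) := by
  obtain ⟨l, rfl, hr⟩ := exists_reduced w
  rw [sigma_eq_of_reduced k (l := a :: l)
      (isReducedWord_iff.2 ⟨wordPerm_cons a l, reduced_cons.2 ⟨hr, h⟩⟩),
    sigma_eq_of_reduced k (isReducedWord_iff.2 ⟨rfl, hr⟩)]
  exact signedProd_cons k h

/-- The action of a generator of `LOT` on the regular representation. -/
def regGen (a : Fin (n - 1)) : Module.End k (Equiv.Perm (Fin n) →₀ k) :=
  Finsupp.lsum k fun w => (fermCoef w a : k) • Finsupp.lsingle (simple a * w)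

theorem regGen_single (a : Fin (n - 1)) (w : Equiv.Perm (Fin n)) (c : k) :
    regGen k a (Finsupp.single w c) = (fermCoef w a : k) • Finsupp.single (simple a * w) c := by
  simp [regGen]

/-- The regular representation of `LOT`, in the basis `σ_w`. -/
def reg (n : ℕ) : LOT k n →ₐ[k] Module.End k (Equiv.Perm (Fin n) →₀ k) :=
  RingQuot.liftAlgHom k ⟨FreeAlgebra.lift k (regGen k), by
    intro x y h
    induction h with
    | sq a =>
      refine Finsupp.lhom_ext fun w c => ?_
      simp only [map_mul, FreeAlgebra.lift_ι_apply, Module.End.mul_apply, regGen_single, map_smul,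
        smul_smul, map_zero, LinearMap.zero_apply]
      rw [mul_comm, ← Int.cast_mul, fermCoef_sq, Int.cast_zero, zero_smul]
    | far a b h =>
      have key : ∀ a b : Fin (n - 1), (a : ℕ) + 1 < b →
          regGen k a * regGen k b + regGen k b * regGen k a = 0 := by
        intro a b h
        refine Finsupp.lhom_ext fun w c => ?_
        simp only [Module.End.mul_apply, regGen_single, map_smul, smul_smul,
          LinearMap.add_apply, LinearMap.zero_apply]
        rw [mul_comm, ← Int.cast_mul, fermCoef_far _ h, mul_comm (fermCoef w a : k),
          ← Int.cast_mul, ← mul_assoc, ← mul_assoc, simple_comm h]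
        simp
      simp only [map_add, map_mul, FreeAlgebra.lift_ι_apply, map_zero]
      rcases h with h | h
      · exact key a b h
      · rw [add_comm]; exact key b a h
    | braid a b h =>
      simp only [map_mul, FreeAlgebra.lift_ι_apply]
      refine Finsupp.lhom_ext fun w c => ?_
      simp only [Module.End.mul_apply, regGen_single, map_smul, smul_smul]
      have e1 := congrArg (· * w) (simple_braid h)
      have e2 := congrArg (Int.cast : ℤ → k) (fermCoef_braid w h)
      simp only [mul_assoc] at e1
      push_cast at e2
      rw [e1]
      congr 1
      linear_combination e2⟩

theorem reg_sigmaGen (a : Fin (n - 1)) : reg k n (sigmaGen k a) = regGen k a := by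
  rw [reg, sigmaGen, RingQuot.liftAlgHom_mkAlgHom_apply, FreeAlgebra.lift_ι_apply]

/-- Each letter enters with its sign twice, once from `wordSign` and once from the action, so all
signs cancel and the basis vector of `1` goes exactly to that of `w`. -/
theorem reg_sigma (w : Equiv.Perm (Fin n)) :
    reg k n (sigma k w) (Finsupp.single 1 1) = Finsupp.single w 1 := by
  obtain ⟨l, rfl, hr⟩ := exists_reduced w
  rw [sigma_eq_of_reduced k (isReducedWord_iff.2 ⟨rfl, hr⟩)]
  change reg k n (signedProd k l) (Finsupp.single 1 1) = _
  induction l with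
  | nil =>
    have : wordSign ([] : List (Fin (n - 1))) = 1 := by
      rw [wordSign_eq_prod, Finset.card_eq_zero.1 (Nat.le_zero.1
        (card_invs_wordPerm_le ([] : List (Fin (n - 1))))), Finset.prod_empty]
    rw [signedProd, this, one_smul, List.map_nil, List.prod_nil, map_one]
    rfl
  | cons a l ih =>
    have h := reduced_cons.1 hr
    rw [signedProd_cons k h.2, map_zsmul, map_mul, reg_sigmaGen, LinearMap.smul_apply,
      Module.End.mul_apply, ih h.1, regGen_single, ← Int.cast_smul_eq_zsmul k, smul_smul,
      ← Int.cast_mul, fermCoef_up h.2, topSign_mul_self, Int.cast_one, one_smul, wordPerm_cons]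

theorem sigma_ne_zero (w : Equiv.Perm (Fin n)) : sigma k w ≠ 0 := by
  intro h
  have := reg_sigma k w
  rw [h, map_zero, LinearMap.zero_apply, eq_comm, Finsupp.single_eq_zero] at this
  exact one_ne_zero this

theorem topSign_eq_or (w : Equiv.Perm (Fin n)) (p : Fin n × Fin n) :
    topSign w p = 1 ∨ topSign w p = -1 := mul_self_eq_one_iff.1 (topSign_mul_self w p)

/-- The definition of `eps` tests an equality in `LOT`, and because `σ_{s_a w} ≠ 0` the test detects
the sign as an element of `k`. In characteristic two the integer sign may be `-1` while the test
succeeds, but both are then `1` in `k`. -/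
theorem eps_eq_fermCoef {w : Equiv.Perm (Fin n)} {a : Fin (n - 1)} (h : Up a w) :
    eps k w a = fermCoef w a := by
  have hs := sigma_simple_mul k h
  have hne := sigma_ne_zero k (simple a * w)
  rw [eps]
  split_ifs with he
  · rw [← he, ← Int.cast_smul_eq_zsmul k] at hs
    exact smul_left_injective k hne (by simpa using hs)
  · rw [fermCoef_up h] at hs ⊢
    rcases topSign_eq_or w (cr a w) with h1 | h1
    · rw [h1, one_smul] at hs; exact absurd hs he
    · simp [h1]

theorem sigma_simple_mul_eps {w : Equiv.Perm (Fin n)} {a : Fin (n - 1)} (h : Up a w) :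
    sigma k (simple a * w) = eps k w a • (sigmaGen k a * sigma k w) := by
  rw [eps_eq_fermCoef k h, sigma_simple_mul k h]
  exact (Int.cast_smul_eq_zsmul k _ _).symm

end LOT

/-! ### Labels -/

section Labels

variable {n m : ℕ}

/-- The `a`-th element of a finite set is the one with exactly `a` smaller elements. This turns
statements about `bos` and `ferm` into statements about labels and counts. -/
theorem orderEmbOfFin_eq_iff {N r : ℕ} (s : Finset (Fin N)) (h : s.card = r) (a : Fin r)
    (p : Fin N) : s.orderEmbOfFin h a = p ↔ p ∈ s ∧ (s.filter (· < p)).card = a := by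
  have key : ∀ b : Fin r, (s.filter (· < s.orderEmbOfFin h b)).card = b := by
    intro b
    rw [← Fin.card_Iio b, ← Finset.card_map (s.orderEmbOfFin h).toEmbedding]
    congr 1
    ext q
    simp only [Finset.mem_filter, Finset.mem_map, Finset.mem_Iio]
    constructor
    · rintro ⟨hq, hlt⟩
      have : q ∈ Set.range (s.orderEmbOfFin h) := by rw [Finset.range_orderEmbOfFin]; exact hq
      obtain ⟨c, rfl⟩ := this
      exact ⟨c, (s.orderEmbOfFin h).lt_iff_lt.1 hlt, rfl⟩
    · rintro ⟨c, hc, rfl⟩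
      exact ⟨s.orderEmbOfFin_mem h c, (s.orderEmbOfFin h).lt_iff_lt.2 hc⟩
  constructor
  · rintro rfl
    exact ⟨s.orderEmbOfFin_mem h a, key a⟩
  · rintro ⟨hp, hc⟩
    have : p ∈ Set.range (s.orderEmbOfFin h) := by rw [Finset.range_orderEmbOfFin]; exact hp
    obtain ⟨b, rfl⟩ := this
    rw [key] at hc
    rw [Fin.ext hc]

/-- The number of strands with label `c` in the first `t` positions. -/
def cnt (i : Labels n m) (c : Bool) (t : ℕ) : ℕ :=
  (Finset.univ.filter fun p : Fin (n + m) => i.1 p = c ∧ (p : ℕ) < t).card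

theorem bos_eq_iff {i : Labels n m} {a : Fin m} {p : Fin (n + m)} :
    bos i a = p ↔ i.1 p = true ∧ cnt i true p = a := by
  rw [bos, orderEmbOfFin_eq_iff, Finset.filter_filter]
  simp only [Finset.mem_filter, Finset.mem_univ, true_and]
  rfl

theorem ferm_eq_iff {i : Labels n m} {a : Fin n} {p : Fin (n + m)} :
    ferm i a = p ↔ i.1 p = false ∧ cnt i false p = a := by
  rw [ferm, orderEmbOfFin_eq_iff, Finset.filter_filter]
  simp only [Finset.mem_filter, Finset.mem_univ, true_and]
  rfl

theorem label_bos (i : Labels n m) (a : Fin m) : i.1 (bos i a) = true := (bos_eq_iff.1 rfl).1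

theorem label_ferm (i : Labels n m) (a : Fin n) : i.1 (ferm i a) = false := (ferm_eq_iff.1 rfl).1

theorem bos_strictMono (i : Labels n m) : StrictMono (bos i) :=
  (Finset.orderEmbOfFin _ _).strictMono

theorem ferm_strictMono (i : Labels n m) : StrictMono (ferm i) :=
  (Finset.orderEmbOfFin _ _).strictMono

theorem exists_bos {i : Labels n m} {p : Fin (n + m)} (h : i.1 p = true) : ∃ a, bos i a = p := by
  have : p ∈ Set.range (Finset.orderEmbOfFin _ i.2) := by
    rw [Finset.range_orderEmbOfFin]; simpa using h
  exact this

theorem exists_ferm {i : Labels n m} {p : Fin (n + m)} (h : i.1 p = false) :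
    ∃ a, ferm i a = p := by
  have : p ∈ Set.range (Finset.orderEmbOfFin _ (card_fermionic i)) := by
    rw [Finset.range_orderEmbOfFin]; simpa using h
  exact this

theorem cnt_succ (i : Labels n m) (c : Bool) (p : Fin (n + m)) :
    cnt i c (p + 1) = cnt i c p + if i.1 p = c then 1 else 0 := by
  unfold cnt
  have : ∀ q : Fin (n + m), (i.1 q = c ∧ (q : ℕ) < p + 1) ↔
      (i.1 q = c ∧ (q : ℕ) < p) ∨ (i.1 p = c ∧ q = p) := by
    intro q
    rw [Nat.lt_succ_iff_lt_or_eq]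
    constructor
    · rintro ⟨h, h' | h'⟩
      · exact Or.inl ⟨h, h'⟩
      · obtain rfl : q = p := Fin.ext h'
        exact Or.inr ⟨h, rfl⟩
    · rintro (⟨h, h'⟩ | ⟨h, rfl⟩)
      · exact ⟨h, Or.inl h'⟩
      · exact ⟨h, Or.inr rfl⟩
  simp only [this]
  split_ifs with h
  · rw [Finset.filter_or, Finset.card_union_of_disjoint]
    · congr 1
      rw [Finset.card_eq_one]
      exact ⟨p, by ext q; simp [h]⟩
    · rw [Finset.disjoint_filter]
      rintro q _ ⟨_, h1⟩ ⟨_, rfl⟩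
      exact lt_irrefl _ h1
  · simp [h]

theorem cnt_hi (i : Labels n m) (c : Bool) (t : Fin (n + m - 1)) :
    cnt i c (t + 1) = cnt i c t + if i.1 (lo t) = c then 1 else 0 := cnt_succ i c (lo t)

theorem cnt_two (i : Labels n m) (c : Bool) (t : Fin (n + m - 1)) :
    cnt i c (t + 2) = cnt i c t + (if i.1 (lo t) = c then 1 else 0) +
      if i.1 (hi t) = c then 1 else 0 := by
  rw [← cnt_hi]; exact cnt_succ i c (hi t)

theorem cnt_mono (i : Labels n m) (c : Bool) {s t : ℕ} (h : s ≤ t) : cnt i c s ≤ cnt i c t :=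
  Finset.card_le_card (Finset.monotone_filter_right _ fun _ _ hp => ⟨hp.1, hp.2.trans_le h⟩)

theorem Labels.sw_apply (i : Labels n m) (t : Fin (n + m - 1)) (p : Fin (n + m)) :
    (i.sw t).1 p = i.1 (simple t p) := rfl

theorem Labels.sw_lo (i : Labels n m) (t : Fin (n + m - 1)) : (i.sw t).1 (lo t) = i.1 (hi t) := by
  rw [Labels.sw_apply, simple_lo]

theorem Labels.sw_hi (i : Labels n m) (t : Fin (n + m - 1)) : (i.sw t).1 (hi t) = i.1 (lo t) := by
  rw [Labels.sw_apply, simple_hi]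

theorem Labels.sw_sw (i : Labels n m) (t : Fin (n + m - 1)) : (i.sw t).sw t = i := by
  apply Subtype.ext
  funext p
  rw [Labels.sw_apply, Labels.sw_apply, simple_simple]

theorem Labels.sw_eq_self {i : Labels n m} {t : Fin (n + m - 1)}
    (h : i.1 (lo t) = i.1 (hi t)) : i.sw t = i := by
  apply Subtype.ext
  funext p
  rw [Labels.sw_apply]
  by_cases h1 : p = lo t
  · rw [h1, simple_lo, h]
  by_cases h2 : p = hi t
  · rw [h2, simple_hi, h]
  rw [simple_of_ne h1 h2]

theorem Labels.sw_comm (i : Labels n m) {t u : Fin (n + m - 1)} (h : (t : ℕ) + 1 < u) :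
    (i.sw t).sw u = (i.sw u).sw t := by
  apply Subtype.ext
  funext p
  simp only [Labels.sw_apply, ← Equiv.Perm.mul_apply, simple_comm h]

theorem Labels.sw_braid (i : Labels n m) {t u : Fin (n + m - 1)} (h : (t : ℕ) + 1 = u) :
    ((i.sw t).sw u).sw t = ((i.sw u).sw t).sw u := by
  apply Subtype.ext
  funext p
  simp only [Labels.sw_apply, ← Equiv.Perm.mul_apply, simple_braid h, ← mul_assoc]

/-- Unless `u` separates the two exchanged positions, `s_t` permutes the positions below `u`. -/
theorem cnt_sw (i : Labels n m) (c : Bool) {t : Fin (n + m - 1)} {u : ℕ} (h : u ≠ t + 1) :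
    cnt (i.sw t) c u = cnt i c u := by
  unfold cnt
  have hv : ∀ p : Fin (n + m), (p : ℕ) < u → (simple t p : ℕ) < u := by
    intro p hp
    rw [simple_val]; split_ifs <;> omega
  refine Finset.card_bij (fun p _ => simple t p) ?_ (fun p _ q _ e => (simple t).injective e) ?_
  · intro p hp
    simp only [Finset.mem_filter, Finset.mem_univ, true_and] at hp ⊢
    exact ⟨hp.1, hv p hp.2⟩
  · intro q hq
    simp only [Finset.mem_filter, Finset.mem_univ, true_and] at hq
    refine ⟨simple t q, ?_, simple_simple t q⟩
    rw [Finset.mem_filter, Labels.sw_apply, simple_simple]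
    exact ⟨Finset.mem_univ _, hq.1, hv q hq.2⟩

/-- A strand of label `c` that moves past a strand of the other label keeps its number among the
strands of label `c`. -/
theorem cnt_simple {i : Labels n m} {c : Bool} {t : Fin (n + m - 1)} {p : Fin (n + m)}
    (hp : i.1 p = c) (h : ¬ (i.1 (lo t) = c ∧ i.1 (hi t) = c)) :
    cnt (i.sw t) c (simple t p) = cnt i c p := by
  by_cases h1 : p = lo t
  · subst h1
    rw [simple_lo]
    change cnt (i.sw t) c (t + 1) = cnt i c t
    rw [cnt_hi, cnt_sw i c (by omega), Labels.sw_lo, if_neg (fun e => h ⟨hp, e⟩), add_zero]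
  by_cases h2 : p = hi t
  · subst h2
    rw [simple_hi]
    change cnt (i.sw t) c t = cnt i c (t + 1)
    rw [cnt_hi, cnt_sw i c (by omega), if_neg (fun e => h ⟨e, hp⟩), add_zero]
  rw [simple_of_ne h1 h2, cnt_sw]
  intro e
  exact h2 (Fin.ext e)

theorem simple_bos_of_not {i : Labels n m} {t : Fin (n + m - 1)}
    (h : ¬ (i.1 (lo t) = true ∧ i.1 (hi t) = true)) (a : Fin m) :
    simple t (bos i a) = bos (i.sw t) a := by
  rw [eq_comm, bos_eq_iff, cnt_simple (label_bos i a) h, Labels.sw_apply, simple_simple]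
  exact bos_eq_iff.1 rfl

theorem simple_ferm_of_not {i : Labels n m} {t : Fin (n + m - 1)}
    (h : ¬ (i.1 (lo t) = false ∧ i.1 (hi t) = false)) (a : Fin n) :
    simple t (ferm i a) = ferm (i.sw t) a := by
  rw [eq_comm, ferm_eq_iff, cnt_simple (label_ferm i a) h, Labels.sw_apply, simple_simple]
  exact ferm_eq_iff.1 rfl

/-- Two adjacent bosonic strands have consecutive numbers. -/
theorem exists_bos_bos {i : Labels n m} {t : Fin (n + m - 1)}
    (h₁ : i.1 (lo t) = true) (h₂ : i.1 (hi t) = true) :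
    ∃ a : Fin (m - 1), bos i (lo a) = lo t ∧ bos i (hi a) = hi t := by
  obtain ⟨b, hb⟩ := exists_bos h₂
  have hb' := (bos_eq_iff.1 hb).2
  have e : cnt i true (hi t) = cnt i true t + 1 := by
    have := cnt_hi i true t; rwa [if_pos h₁] at this
  refine ⟨⟨cnt i true t, by omega⟩, ?_, ?_⟩
  · exact bos_eq_iff.2 ⟨h₁, rfl⟩
  · exact bos_eq_iff.2 ⟨h₂, e⟩

/-- Two adjacent fermionic strands have consecutive numbers. -/
theorem exists_ferm_ferm {i : Labels n m} {t : Fin (n + m - 1)}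
    (h₁ : i.1 (lo t) = false) (h₂ : i.1 (hi t) = false) :
    ∃ a : Fin (n - 1), ferm i (lo a) = lo t ∧ ferm i (hi a) = hi t := by
  obtain ⟨b, hb⟩ := exists_ferm h₂
  have hb' := (ferm_eq_iff.1 hb).2
  have e : cnt i false (hi t) = cnt i false t + 1 := by
    have := cnt_hi i false t; rwa [if_pos h₁] at this
  refine ⟨⟨cnt i false t, by omega⟩, ?_, ?_⟩
  · exact ferm_eq_iff.2 ⟨h₁, rfl⟩
  · exact ferm_eq_iff.2 ⟨h₂, e⟩

theorem simple_bos {i : Labels n m} {t : Fin (n + m - 1)} {a : Fin (m - 1)}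
    (h₁ : bos i (lo a) = lo t) (h₂ : bos i (hi a) = hi t) (x : Fin m) :
    simple t (bos i x) = bos i (simple a x) := by
  unfold simple
  rw [← h₁, ← h₂, (bos_strictMono i).injective.map_swap]

theorem simple_ferm {i : Labels n m} {t : Fin (n + m - 1)} {a : Fin (n - 1)}
    (h₁ : ferm i (lo a) = lo t) (h₂ : ferm i (hi a) = hi t) (x : Fin n) :
    simple t (ferm i x) = ferm i (simple a x) := by
  unfold simple
  rw [← h₁, ← h₂, (ferm_strictMono i).injective.map_swap]

theorem topLabels_apply (i : Labels n m) (l : List (Fin (n + m - 1))) (p : Fin (n + m)) :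
    (topLabels i l).1 p = i.1 ((wordPerm l)⁻¹ p) := by
  induction l generalizing p with
  | nil => simp [topLabels, wordPerm]
  | cons t l ih => rw [topLabels, Labels.sw_apply, ih, wordPerm_cons, simple_mul_inv_apply]

theorem topLabels_congr (i : Labels n m) {l l' : List (Fin (n + m - 1))}
    (h : wordPerm l = wordPerm l') : topLabels i l = topLabels i l' := by
  apply Subtype.ext
  funext p
  rw [topLabels_apply, topLabels_apply, h]

end Labels

/-! ### Divided differences -/

section DividedDifferences

variable {k : Type*} [Field k] {m : ℕ}

theorem X_sub_X_ne_zero {a b : Fin m} (h : a ≠ b) :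
    (X a - X b : MvPolynomial (Fin m) k) ≠ 0 :=
  sub_ne_zero.2 fun e => h (X_injective e)

theorem divDiff_eq_of_mul_eq {a b : Fin m} (h : a ≠ b) {f g : MvPolynomial (Fin m) k}
    (e : (X a - X b) * g = f - rename (Equiv.swap a b) f) : divDiff k a b f = g :=
  mul_left_cancel₀ (X_sub_X_ne_zero h) (by rw [e, divDiff_spec])

/-- The divided difference as a linear map. -/
def divDiffₗ (k : Type*) [Field k] {m : ℕ} (a b : Fin m) (h : a ≠ b) :
    MvPolynomial (Fin m) k →ₗ[k] MvPolynomial (Fin m) k where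
  toFun := divDiff k a b
  map_add' f g := divDiff_eq_of_mul_eq h (by
    rw [mul_add, ← divDiff_spec, ← divDiff_spec, map_add]; ring)
  map_smul' c f := divDiff_eq_of_mul_eq h (by
    rw [RingHom.id_apply, mul_smul_comm, ← divDiff_spec, map_smul, smul_sub])

theorem divDiffₗ_apply {a b : Fin m} (h : a ≠ b) (f : MvPolynomial (Fin m) k) :
    divDiffₗ k a b h f = divDiff k a b f := rfl

theorem divDiff_mul {a b : Fin m} (h : a ≠ b) (f g : MvPolynomial (Fin m) k) :
    divDiff k a b (f * g) =
      divDiff k a b f * g + rename (Equiv.swap a b) f * divDiff k a b g :=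
  divDiff_eq_of_mul_eq h (by
    rw [map_mul]
    linear_combination -g * divDiff_spec k a b f -
      rename (Equiv.swap a b) f * divDiff_spec k a b g)

theorem divDiff_of_symm {a b : Fin m} (h : a ≠ b) {f : MvPolynomial (Fin m) k}
    (hf : rename (Equiv.swap a b) f = f) : divDiff k a b f = 0 :=
  divDiff_eq_of_mul_eq h (by rw [hf, mul_zero, sub_self])

theorem divDiff_X_left {a b : Fin m} (h : a ≠ b) :
    divDiff k a b (X a) = 1 :=
  divDiff_eq_of_mul_eq h (by rw [rename_X, Equiv.swap_apply_left, mul_one])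

theorem divDiff_X_right {a b : Fin m} (h : a ≠ b) :
    divDiff k a b (X b) = -1 :=
  divDiff_eq_of_mul_eq h (by rw [rename_X, Equiv.swap_apply_right]; ring)

theorem divDiff_X_mul_left {a b : Fin m} (h : a ≠ b) (f : MvPolynomial (Fin m) k) :
    divDiff k a b (X a * f) = f + X b * divDiff k a b f := by
  rw [divDiff_mul h, divDiff_X_left h, rename_X, Equiv.swap_apply_left, one_mul]

theorem divDiff_X_mul_right {a b : Fin m} (h : a ≠ b) (f : MvPolynomial (Fin m) k) :
    divDiff k a b (X b * f) = X a * divDiff k a b f - f := by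
  rw [divDiff_mul h, divDiff_X_right h, rename_X, Equiv.swap_apply_right]; ring

theorem divDiff_X_mul_of_ne {a b c : Fin m} (h : a ≠ b) (hca : c ≠ a) (hcb : c ≠ b)
    (f : MvPolynomial (Fin m) k) : divDiff k a b (X c * f) = X c * divDiff k a b f := by
  have e : rename (Equiv.swap a b) (X c : MvPolynomial (Fin m) k) = X c := by
    rw [rename_X, Equiv.swap_apply_of_ne_of_ne hca hcb]
  rw [divDiff_mul h, divDiff_of_symm h e, e, zero_mul, zero_add]

theorem rename_swap_divDiff {a b : Fin m} (h : a ≠ b) (f : MvPolynomial (Fin m) k) :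
    rename (Equiv.swap a b) (divDiff k a b f) = divDiff k a b f := by
  refine mul_left_cancel₀ (X_sub_X_ne_zero h) ?_
  have e := congrArg (rename (Equiv.swap a b)) (divDiff_spec k a b f)
  rw [map_sub, map_mul, rename_rename, map_sub, rename_X, rename_X, Equiv.swap_apply_left,
    Equiv.swap_apply_right] at e
  have e2 : (Equiv.swap a b : Fin m → Fin m) ∘ Equiv.swap a b = id := by
    funext x; simp
  rw [e2, rename_id_apply] at e
  linear_combination e + divDiff_spec k a b f

theorem divDiff_divDiff_self {a b : Fin m} (h : a ≠ b) (f : MvPolynomial (Fin m) k) :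
    divDiff k a b (divDiff k a b f) = 0 :=
  divDiff_of_symm h (rename_swap_divDiff h f)

theorem rename_divDiff (e : Equiv.Perm (Fin m)) {a b : Fin m} (h : a ≠ b)
    (f : MvPolynomial (Fin m) k) :
    rename e (divDiff k a b f) = divDiff k (e a) (e b) (rename e f) := by
  refine (divDiff_eq_of_mul_eq (e.injective.ne h) ?_).symm
  have := congrArg (rename e) (divDiff_spec k a b f)
  rw [map_sub, map_mul, map_sub, rename_X, rename_X, rename_rename] at this
  rw [← this, rename_rename]
  congr 3
  funext x
  exact (e.injective.map_swap a b x)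

/-- The difference `x_a - x_b` does not involve `x_c` and `x_d`, so it can be moved inside the other
divided difference, where it turns `∂_{ab} f` into `f - s f`. -/
theorem divDiff_comm {a b c d : Fin m} (hab : a ≠ b) (hcd : c ≠ d) (hac : a ≠ c) (had : a ≠ d)
    (hbc : b ≠ c) (hbd : b ≠ d) (f : MvPolynomial (Fin m) k) :
    divDiff k a b (divDiff k c d f) = divDiff k c d (divDiff k a b f) := by
  refine divDiff_eq_of_mul_eq hab ?_
  rw [rename_divDiff _ hcd, Equiv.swap_apply_of_ne_of_ne hac.symm hbc.symm,
    Equiv.swap_apply_of_ne_of_ne had.symm hbd.symm, ← divDiffₗ_apply hcd, ← divDiffₗ_apply hcd,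
    ← divDiffₗ_apply hcd, ← map_sub, divDiff_spec, sub_mul (X a) (X b) (divDiff k a b f), map_sub,
    divDiffₗ_apply, divDiffₗ_apply, divDiffₗ_apply, divDiff_X_mul_of_ne hcd hac had, divDiff_X_mul_of_ne hcd hbc hbd,
    sub_mul]

/-- The triple divided difference is the alternating sum over `S_3` divided by the Vandermonde
product. This expression makes the symmetry behind the braid relation visible. -/
theorem divDiff_braid_formula {a b c : Fin m} (hab : a ≠ b) (hbc : b ≠ c) (hac : a ≠ c)
    (f : MvPolynomial (Fin m) k) :
    (X a - X b) * (X a - X c) * (X b - X c) *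
        divDiff k a b (divDiff k b c (divDiff k a b f)) =
      f - rename (Equiv.swap a b) f - rename (Equiv.swap b c) f
        + rename (Equiv.swap b c) (rename (Equiv.swap a b) f)
        + rename (Equiv.swap a b) (rename (Equiv.swap b c) f)
        - rename (Equiv.swap a b) (rename (Equiv.swap b c) (rename (Equiv.swap a b) f)) := by
  set s := rename (R := k) (Equiv.swap a b) with hs
  set t := rename (R := k) (Equiv.swap b c) with ht
  have sa : s (X a) = X b := by rw [hs, rename_X, Equiv.swap_apply_left]
  have sb : s (X b) = X a := by rw [hs, rename_X, Equiv.swap_apply_right]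
  have sc : s (X c) = X c := by
    rw [hs, rename_X, Equiv.swap_apply_of_ne_of_ne hac.symm hbc.symm]
  have ta : t (X a) = X a := by rw [ht, rename_X, Equiv.swap_apply_of_ne_of_ne hab hac]
  have tb : t (X b) = X c := by rw [ht, rename_X, Equiv.swap_apply_left]
  have ss : ∀ g, s (s g) = g := by
    intro g
    have e2 : (Equiv.swap a b : Fin m → Fin m) ∘ Equiv.swap a b = id := by funext x; simp
    rw [hs, rename_rename, e2, rename_id_apply]
  have e1 := divDiff_spec k a b f
  have e1t := congrArg t e1
  have e2 := divDiff_spec k b c (divDiff k a b f)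
  have e2s := congrArg s e2
  have e3 := divDiff_spec k a b (divDiff k b c (divDiff k a b f))
  have e1ts := congrArg s e1t
  have e1s := congrArg s e1
  simp only [map_sub, map_mul, ← hs, ← ht, sa, sb, sc, ta, tb, ss] at e1 e1t e2 e2s e3 e1ts e1s
  -- After the outer differences are expanded, `∂f` and its image under `s` remain. The extra factor
  -- `x_a - x_b` allows both to be eliminated through `e1` and `e1s`.
  refine mul_left_cancel₀ (X_sub_X_ne_zero hab) ?_
  linear_combination (-(X a - X b) * (X a - X c) * (X b - X c)) * e3
    - (X a - X b) * (X a - X c) * e2 + (X a - X b) * (X b - X c) * e2s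
    - (X a - X c) * e1 + (X a - X b) * e1t - (X b - X c) * e1s - (X a - X b) * e1ts

end DividedDifferences

/-! ### Braid relation for divided differences -/

section DividedDifferences

variable {k : Type*} [Field k] {m : ℕ}

theorem divDiff_neg {a b : Fin m} (h : a ≠ b) (f : MvPolynomial (Fin m) k) :
    divDiff k a b (-f) = -divDiff k a b f := map_neg (divDiffₗ k a b h) f

theorem divDiff_swap {a b : Fin m} (h : a ≠ b) (f : MvPolynomial (Fin m) k) :
    divDiff k b a f = -divDiff k a b f :=
  divDiff_eq_of_mul_eq h.symm (by
    rw [Equiv.swap_comm]; linear_combination -divDiff_spec k a b f)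

/-- Applied to `(c, b, a)`, the formula for the triple difference gives the other side. The three
sign changes of the differences match those of the Vandermonde product, and the longest terms agree
by the braid relation in `S_3`. -/
theorem divDiff_braid {a b c : Fin m} (hab : a ≠ b) (hbc : b ≠ c) (hac : a ≠ c)
    (f : MvPolynomial (Fin m) k) :
    divDiff k a b (divDiff k b c (divDiff k a b f)) =
      divDiff k b c (divDiff k a b (divDiff k b c f)) := by
  have e1 := divDiff_braid_formula hab hbc hac f
  have e2 := divDiff_braid_formula hbc.symm hab.symm hac.symm f
  simp only [divDiff_swap hbc, divDiff_swap hab, divDiff_neg hab, neg_neg] at e2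
  rw [Equiv.swap_comm c b, Equiv.swap_comm b a] at e2
  have e3 : rename (Equiv.swap a b) (rename (Equiv.swap b c) (rename (Equiv.swap a b) f)) =
      rename (Equiv.swap b c) (rename (Equiv.swap a b) (rename (Equiv.swap b c) f)) := by
    simp only [rename_rename]
    have h : Equiv.swap a b * Equiv.swap b c * Equiv.swap a b =
        Equiv.swap b c * Equiv.swap a b * Equiv.swap b c := by
      rw [Equiv.swap_mul_swap_mul_swap hab hac, Equiv.swap_comm a b, Equiv.swap_comm b c,
        Equiv.swap_mul_swap_mul_swap hbc.symm hac.symm, Equiv.swap_comm]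
    have h' := congrArg (fun e : Equiv.Perm (Fin m) => (e : Fin m → Fin m)) h
    simp only [Equiv.Perm.coe_mul, Function.comp_assoc] at h'
    rw [h']
  refine mul_left_cancel₀ (mul_ne_zero (mul_ne_zero (X_sub_X_ne_zero hab)
    (X_sub_X_ne_zero hac)) (X_sub_X_ne_zero hbc)) ?_
  linear_combination e1 - e2 - e3

end DividedDifferences

/-! ### The operators of the crossings on polynomials and on permutations -/

section Operators

variable (k : Type*) [Field k] {n m : ℕ}

/-- The `a`-th divided difference, counting from zero. -/
def ddOp (m a : ℕ) : Module.End k (MvPolynomial (Fin m) k) :=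
  if h : a + 1 < m then divDiffₗ k ⟨a, by omega⟩ ⟨a + 1, h⟩ (by simp) else 0

/-- Multiplication by the `a`-th variable, counting from zero. -/
def xOp (m a : ℕ) : Module.End k (MvPolynomial (Fin m) k) :=
  if h : a < m then LinearMap.mulLeft k (X ⟨a, h⟩) else 0

variable {k}

theorem ddOp_apply {a b : Fin m} (h : (a : ℕ) + 1 = b) (f : MvPolynomial (Fin m) k) :
    ddOp k m a f = divDiff k a b f := by
  have hb : (a : ℕ) + 1 < m := by omega
  rw [ddOp, dif_pos hb, divDiffₗ_apply]
  congr 1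
  exact Fin.ext h

theorem xOp_apply (a : Fin m) (f : MvPolynomial (Fin m) k) : xOp k m a f = X a * f := by
  rw [xOp, dif_pos a.2]; rfl

theorem xOp_comm (a b : ℕ) : xOp k m a * xOp k m b = xOp k m b * xOp k m a := by
  unfold xOp
  split_ifs <;> try simp
  refine LinearMap.ext fun f => ?_
  simp only [Module.End.mul_apply, LinearMap.mulLeft_apply]
  ring

/-- Operators with an index out of range are zero, so no bounds on the indices are needed. -/
theorem ddOp_xOp_comm {a b : ℕ} (h₁ : b ≠ a) (h₂ : b ≠ a + 1) :
    ddOp k m a * xOp k m b = xOp k m b * ddOp k m a := by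
  unfold ddOp xOp
  split_ifs <;> try simp
  refine LinearMap.ext fun f => ?_
  exact divDiff_X_mul_of_ne (by simp) (by simpa using h₁) (by simpa using h₂) f

theorem ddOp_comm {a b : ℕ} (h : a + 1 < b) :
    ddOp k m a * ddOp k m b = ddOp k m b * ddOp k m a := by
  unfold ddOp
  split_ifs <;> try simp
  refine LinearMap.ext fun f => ?_
  refine divDiff_comm ?_ ?_ ?_ ?_ ?_ ?_ f <;> simp only [ne_eq, Fin.mk.injEq] <;> omega

theorem ddOp_braid (a : ℕ) : ddOp k m a * ddOp k m (a + 1) * ddOp k m a =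
    ddOp k m (a + 1) * ddOp k m a * ddOp k m (a + 1) := by
  unfold ddOp
  split_ifs <;> try simp
  refine LinearMap.ext fun f => ?_
  refine divDiff_braid ?_ ?_ ?_ f <;> simp only [ne_eq, Fin.mk.injEq] <;> omega

theorem ddOp_mul_xOp {a : ℕ} (h : a + 1 < m) :
    ddOp k m a * xOp k m a = xOp k m (a + 1) * ddOp k m a + 1 := by
  rw [ddOp, xOp, xOp, dif_pos h, dif_pos h, dif_pos (by omega)]
  refine LinearMap.ext fun f => ?_
  exact (divDiff_X_mul_left (by simp) f).trans (add_comm _ _)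

/-- The product of the two exchanged variables is symmetric in them, so the divided difference is
linear over it. This is the braid relation for two bosonic strands and a fermionic one on their
right. -/
theorem ddOp_mul_xOp_mul_xOp (a : ℕ) :
    ddOp k m a * xOp k m a * xOp k m (a + 1) = xOp k m a * xOp k m (a + 1) * ddOp k m a := by
  by_cases h : a + 1 < m
  · rw [ddOp, xOp, xOp, dif_pos h, dif_pos h, dif_pos (by omega)]
    refine LinearMap.ext fun f => ?_
    simp only [Module.End.mul_apply, LinearMap.mulLeft_apply, divDiffₗ_apply]
    rw [divDiff_X_mul_left (by simp), divDiff_X_mul_right (by simp)]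
    ring
  · rw [ddOp, dif_neg h]; simp

/-- The action of a crossing with labels `c`, `d` on polynomials, where `a` is the number of
bosonic strands to the left. -/
def polyOp (k : Type*) [Field k] (m : ℕ) :
    Bool → Bool → ℕ → Module.End k (MvPolynomial (Fin m) k)
  | true, true, a => ddOp k m a
  | true, false, a => xOp k m a
  | false, _, _ => 1

/-- The bound says that the second crossing lies to the right of the bosonic strands in the first
one, so the two operators do not share a variable. -/
theorem polyOp_comm {c d c' d' : Bool} {a b : ℕ}
    (h : a + (if c = true then 1 else 0) + (if d = true then 1 else 0) ≤ b) :
    polyOp k m c' d' b * polyOp k m c d a = polyOp k m c d a * polyOp k m c' d' b := by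
  cases c <;> cases d <;> cases c' <;> cases d' <;>
    simp only [polyOp, if_true, Bool.false_eq_true, if_false, mul_one, one_mul] at h ⊢
  · exact xOp_comm _ _
  · exact ddOp_xOp_comm (by omega) (by omega)
  · exact (ddOp_xOp_comm (by omega) (by omega)).symm
  · exact (ddOp_comm (by omega)).symm

/-- The braid relation for the operators on polynomials. -/
theorem polyOp_braid {c d e : Bool} {a : ℕ} (h : ¬ (c = true ∧ d = false ∧ e = true)) :
    polyOp k m d e a * polyOp k m c e (a + if d = true then 1 else 0) * polyOp k m c d a =
      polyOp k m c d (a + if e = true then 1 else 0) * polyOp k m c e a *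
        polyOp k m d e (a + if c = true then 1 else 0) := by
  cases c <;> cases d <;> cases e <;>
    simp only [polyOp, if_true, Bool.false_eq_true, if_false, mul_one, one_mul, add_zero,
      not_true_eq_false, and_self] at h ⊢
  · exact (ddOp_mul_xOp_mul_xOp a).symm
  · exact ddOp_braid a

theorem polyOp_braid_even_odd_even {a : ℕ} (h : a + 1 < m) :
    polyOp k m false true a * polyOp k m true true a * polyOp k m true false a =
      polyOp k m true false (a + 1) * polyOp k m true true a * polyOp k m false true (a + 1)
        + 1 := by
  simp only [polyOp, one_mul, mul_one]
  exact ddOp_mul_xOp h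

/-- The sign with which a crossing with labels `c`, `d` acts on a permutation, where `b` is the
number of fermionic strands to the left. -/
def permCoef (n : ℕ) : Bool → Bool → ℕ → Equiv.Perm (Fin n) → ℤ
  | false, false, b, w => if h : b < n - 1 then fermCoef w ⟨b, h⟩ else 0
  | true, _, _, _ => 1
  | false, true, _, _ => 1

/-- The permutation to which a crossing with labels `c`, `d` takes `w`, where `b` is the
number of fermionic strands to the left. -/
def permOp (n : ℕ) : Bool → Bool → ℕ → Equiv.Perm (Fin n) → Equiv.Perm (Fin n)
  | false, false, b, w => if h : b < n - 1 then simple ⟨b, h⟩ * w else w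
  | true, _, _, w => w
  | false, true, _, w => w

theorem permOp_comm {c d c' d' : Bool} {a b : ℕ}
    (h : a + (if c = false then 1 else 0) + (if d = false then 1 else 0) ≤ b)
    (w : Equiv.Perm (Fin n)) :
    permOp n c' d' b (permOp n c d a w) = permOp n c d a (permOp n c' d' b w) := by
  cases c <;> cases d <;> cases c' <;> cases d' <;>
    simp only [permOp, if_true, Bool.true_eq_false, if_false] at h ⊢
  split_ifs with h1 h2
  · have h' : ((⟨a, h2⟩ : Fin (n - 1)) : ℕ) + 1 < (⟨b, h1⟩ : Fin (n - 1)) := h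
    rw [← mul_assoc, ← mul_assoc, ← simple_comm h']
  all_goals rfl

/-- Only three fermionic strands give a nontrivial case. The bound then keeps both simple
transpositions in range; with the default value outside the range the relation could fail. -/
theorem permOp_braid {c d e : Bool} {a : ℕ} (w : Equiv.Perm (Fin n))
    (hn : c = false → d = false → e = false → a + 1 < n - 1) :
    permOp n d e a (permOp n c e (a + if d = false then 1 else 0) (permOp n c d a w)) =
      permOp n c d (a + if e = false then 1 else 0) (permOp n c e a
        (permOp n d e (a + if c = false then 1 else 0) w)) := by
  cases c <;> cases d <;> cases e <;>
    simp only [permOp, if_true, Bool.true_eq_false, if_false, add_zero]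
  have h1 := hn rfl rfl rfl
  have h2 : a < n - 1 := by omega
  rw [dif_pos h2, dif_pos h1, dif_pos h2, dif_pos h2, dif_pos h1, dif_pos h1]
  simpa only [mul_assoc] using congrArg (· * w) (simple_braid (a := ⟨a, h2⟩) (b := ⟨a + 1, h1⟩) rfl)

theorem permCoef_far_odd {a b : ℕ} (h : a + 2 ≤ b) (w : Equiv.Perm (Fin n)) :
    permCoef n false false b (permOp n false false a w) * permCoef n false false a w =
      -(permCoef n false false a (permOp n false false b w) * permCoef n false false b w) := by
  simp only [permCoef, permOp]
  by_cases hb : b < n - 1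
  · have ha : a < n - 1 := by omega
    rw [dif_pos hb, dif_pos hb, dif_pos ha, dif_pos ha, dif_pos ha, dif_pos hb,
      fermCoef_far w (a := ⟨a, ha⟩) (b := ⟨b, hb⟩) (by simp; omega), neg_neg]
  · simp [hb]

theorem permCoef_far_even {c d c' d' : Bool} {a b : ℕ}
    (h : ¬ ((c = false ∧ d = false) ∧ (c' = false ∧ d' = false))) (w : Equiv.Perm (Fin n)) :
    permCoef n c' d' b (permOp n c d a w) * permCoef n c d a w =
      permCoef n c d a (permOp n c' d' b w) * permCoef n c' d' b w := by
  cases c <;> cases d <;> cases c' <;> cases d' <;> simp [permCoef, permOp] at h ⊢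

theorem permCoef_braid {c d e : Bool} {a : ℕ} (w : Equiv.Perm (Fin n))
    (hn : c = false → d = false → e = false → a + 1 < n - 1) :
    permCoef n d e a (permOp n c e (a + if d = false then 1 else 0) (permOp n c d a w)) *
        permCoef n c e (a + if d = false then 1 else 0) (permOp n c d a w) *
        permCoef n c d a w =
      permCoef n c d (a + if e = false then 1 else 0) (permOp n c e a
        (permOp n d e (a + if c = false then 1 else 0) w)) *
        permCoef n c e a (permOp n d e (a + if c = false then 1 else 0) w) *
        permCoef n d e (a + if c = false then 1 else 0) w := by
  cases c <;> cases d <;> cases e <;>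
    simp only [permOp, permCoef, if_true, Bool.true_eq_false, if_false, add_zero, mul_one, one_mul]
  have h1 := hn rfl rfl rfl
  have h2 : a < n - 1 := by omega
  rw [dif_pos h2, dif_pos h1, dif_pos h2, dif_pos h1, dif_pos h2, dif_pos h2, dif_pos h1,
    dif_pos h1, dif_pos h2, dif_pos h1]
  exact fermCoef_braid w (a := ⟨a, h2⟩) (b := ⟨a + 1, h1⟩) rfl

end Operators

/-! ### The action on `Pol` -/

section Action

variable (k : Type*) [Field k] {n m : ℕ}

/-- The action of a crossing on polynomials. -/
def crossPoly (i : Labels n m) (t : Fin (n + m - 1)) : Module.End k (MvPolynomial (Fin m) k) :=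
  polyOp k m (i.1 (lo t)) (i.1 (hi t)) (cnt i true t)

/-- The sign with which a crossing acts on a permutation of the fermionic strands. -/
def crossCoef (i : Labels n m) (t : Fin (n + m - 1)) (w : Equiv.Perm (Fin n)) : ℤ :=
  permCoef n (i.1 (lo t)) (i.1 (hi t)) (cnt i false t) w

/-- The action of a crossing on permutations of the fermionic strands. -/
def crossPerm (i : Labels n m) (t : Fin (n + m - 1)) (w : Equiv.Perm (Fin n)) :
    Equiv.Perm (Fin n) :=
  permOp n (i.1 (lo t)) (i.1 (hi t)) (cnt i false t) w

open Classical in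
/-- The projection to the summands `Pol(i,w)`. -/
def idemOp (i : Labels n m) : Module.End k (Pol k n m) :=
  Finsupp.lsum k fun x => if x.1 = i then Finsupp.lsingle x else 0

open Classical in
/-- The action of a dot. -/
def dotOp (i : Labels n m) (a : Fin m) : Module.End k (Pol k n m) :=
  Finsupp.lsum k fun x =>
    if x.1 = i then Finsupp.lsingle x ∘ₗ LinearMap.mulLeft k (X a) else 0

open Classical in
/-- The action of a crossing. -/
def crossOp (i : Labels n m) (t : Fin (n + m - 1)) : Module.End k (Pol k n m) :=
  Finsupp.lsum k fun x =>
    if x.1 = i then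
      (crossCoef i t x.2 : k) • (Finsupp.lsingle (i.sw t, crossPerm i t x.2) ∘ₗ crossPoly k i t)
    else 0

variable {k}

theorem idemOp_self (i : Labels n m) (w : Equiv.Perm (Fin n)) (f : MvPolynomial (Fin m) k) :
    idemOp k i (Finsupp.single (i, w) f) = Finsupp.single (i, w) f := by
  simp [idemOp]

theorem idemOp_ne {i j : Labels n m} (h : j ≠ i) (w : Equiv.Perm (Fin n))
    (f : MvPolynomial (Fin m) k) : idemOp k i (Finsupp.single (j, w) f) = 0 := by
  simp [idemOp, h]

theorem dotOp_self (i : Labels n m) (a : Fin m) (w : Equiv.Perm (Fin n))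
    (f : MvPolynomial (Fin m) k) :
    dotOp k i a (Finsupp.single (i, w) f) = Finsupp.single (i, w) (X a * f) := by
  simp [dotOp]

theorem dotOp_ne {i j : Labels n m} (h : j ≠ i) (a : Fin m) (w : Equiv.Perm (Fin n))
    (f : MvPolynomial (Fin m) k) : dotOp k i a (Finsupp.single (j, w) f) = 0 := by
  simp [dotOp, h]

theorem crossOp_self (i : Labels n m) (t : Fin (n + m - 1)) (w : Equiv.Perm (Fin n))
    (f : MvPolynomial (Fin m) k) :
    crossOp k i t (Finsupp.single (i, w) f) =
      (crossCoef i t w : k) • Finsupp.single (i.sw t, crossPerm i t w) (crossPoly k i t f) := by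
  simp [crossOp]

theorem crossOp_ne {i j : Labels n m} (h : j ≠ i) (t : Fin (n + m - 1)) (w : Equiv.Perm (Fin n))
    (f : MvPolynomial (Fin m) k) : crossOp k i t (Finsupp.single (j, w) f) = 0 := by
  simp [crossOp, h]

/-- Every relation between diagrams with fixed lower labels `i` is tested on the summands of `i`
alone, because both sides vanish on the others. -/
theorem pol_ext {A B : Module.End k (Pol k n m)} (i : Labels n m)
    (h : ∀ w f, A (Finsupp.single (i, w) f) = B (Finsupp.single (i, w) f))
    (hA : ∀ j, j ≠ i → ∀ w f, A (Finsupp.single (j, w) f) = 0)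
    (hB : ∀ j, j ≠ i → ∀ w f, B (Finsupp.single (j, w) f) = 0) : A = B := by
  refine Finsupp.lhom_ext fun x f => ?_
  obtain ⟨j, w⟩ := x
  by_cases hj : j = i
  · subst hj; exact h w f
  · rw [hA j hj, hB j hj]

theorem crossPoly_of_labels {i : Labels n m} {t : Fin (n + m - 1)} {c d : Bool} {a : ℕ}
    (hc : i.1 (lo t) = c) (hd : i.1 (hi t) = d) (ha : cnt i true t = a) :
    crossPoly k i t = polyOp k m c d a := by
  rw [crossPoly, hc, hd, ha]

theorem crossPerm_of_labels {i : Labels n m} {t : Fin (n + m - 1)} {c d : Bool} {a : ℕ}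
    (hc : i.1 (lo t) = c) (hd : i.1 (hi t) = d) (ha : cnt i false t = a) :
    crossPerm i t = permOp n c d a := by
  funext w; rw [crossPerm, hc, hd, ha]

theorem crossCoef_of_labels {i : Labels n m} {t : Fin (n + m - 1)} {c d : Bool} {a : ℕ}
    (hc : i.1 (lo t) = c) (hd : i.1 (hi t) = d) (ha : cnt i false t = a) :
    crossCoef i t = permCoef n c d a := by
  funext w; rw [crossCoef, hc, hd, ha]

theorem sw_lo_far (i : Labels n m) {t u : Fin (n + m - 1)} (h : (t : ℕ) + 1 < u)
    : (i.sw t).1 (lo u) = i.1 (lo u) := by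
  rw [Labels.sw_apply, simple_of_ne] <;> simp only [lo, hi, ne_eq, Fin.ext_iff] <;> omega

theorem sw_hi_far (i : Labels n m) {t u : Fin (n + m - 1)} (h : (t : ℕ) + 1 < u)
    : (i.sw t).1 (hi u) = i.1 (hi u) := by
  rw [Labels.sw_apply, simple_of_ne] <;> simp only [lo, hi, ne_eq, Fin.ext_iff] <;> omega

theorem sw_lo_far' (i : Labels n m) {t u : Fin (n + m - 1)} (h : (t : ℕ) + 1 < u)
    : (i.sw u).1 (lo t) = i.1 (lo t) := by
  rw [Labels.sw_apply, simple_of_ne] <;> simp only [lo, hi, ne_eq, Fin.ext_iff] <;> omega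

theorem sw_hi_far' (i : Labels n m) {t u : Fin (n + m - 1)} (h : (t : ℕ) + 1 < u)
    : (i.sw u).1 (hi t) = i.1 (hi t) := by
  rw [Labels.sw_apply, simple_of_ne] <;> simp only [lo, hi, ne_eq, Fin.ext_iff] <;> omega

theorem cnt_add_le_far (i : Labels n m) {t u : Fin (n + m - 1)} (h : (t : ℕ) + 1 < u)
    (c : Bool) : cnt i c t + (if i.1 (lo t) = c then 1 else 0) +
    (if i.1 (hi t) = c then 1 else 0) ≤ cnt i c u := by
  rw [← cnt_two]; exact cnt_mono i c (by omega)

/-- A far crossing changes neither the labels nor the counts seen by the other one. The polynomial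
and the permutation parts commute, and the whole discrepancy `s` lies in the coefficients. -/
theorem crossOp_far (i : Labels n m) {t u : Fin (n + m - 1)} (h : (t : ℕ) + 1 < u) (s : ℤ)
    (hs : ∀ w, crossCoef i u (crossPerm i t w) * crossCoef i t w =
      s * (crossCoef i t (crossPerm i u w) * crossCoef i u w)) :
    crossOp k (i.sw t) u * crossOp k i t = s • (crossOp k (i.sw u) t * crossOp k i u) := by
  refine pol_ext i (fun w f => ?_) (fun j hj w f => ?_) (fun j hj w f => ?_)
  · have p1 : crossPerm (i.sw t) u = crossPerm i u :=
      crossPerm_of_labels (sw_lo_far i h) (sw_hi_far i h) (cnt_sw i _ (by omega))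
    have p2 : crossPerm (i.sw u) t = crossPerm i t :=
      crossPerm_of_labels (sw_lo_far' i h) (sw_hi_far' i h) (cnt_sw i _ (by omega))
    have c1 : crossCoef (i.sw t) u = crossCoef i u :=
      crossCoef_of_labels (sw_lo_far i h) (sw_hi_far i h) (cnt_sw i _ (by omega))
    have c2 : crossCoef (i.sw u) t = crossCoef i t :=
      crossCoef_of_labels (sw_lo_far' i h) (sw_hi_far' i h) (cnt_sw i _ (by omega))
    have q1 : crossPoly k (i.sw t) u = crossPoly k i u :=
      crossPoly_of_labels (sw_lo_far i h) (sw_hi_far i h) (cnt_sw i _ (by omega))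
    have q2 : crossPoly k (i.sw u) t = crossPoly k i t :=
      crossPoly_of_labels (sw_lo_far' i h) (sw_hi_far' i h) (cnt_sw i _ (by omega))
    have e1 : crossPoly k i u (crossPoly k i t f) = crossPoly k i t (crossPoly k i u f) :=
      LinearMap.congr_fun (polyOp_comm (cnt_add_le_far i h true)) f
    have e2 : crossPerm i u (crossPerm i t w) = crossPerm i t (crossPerm i u w) :=
      permOp_comm (cnt_add_le_far i h false) w
    have e3 := congrArg (Int.cast : ℤ → k) (hs w)
    push_cast at e3
    simp only [LinearMap.smul_apply, Module.End.mul_apply, crossOp_self, map_smul, smul_smul,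
      p1, p2, c1, c2, q1, q2, e1, e2, Labels.sw_comm i h]
    rw [← Int.cast_smul_eq_zsmul k, smul_smul]
    congr 1
    linear_combination e3
  · rw [Module.End.mul_apply, crossOp_ne hj, map_zero]
  · rw [LinearMap.smul_apply, Module.End.mul_apply, crossOp_ne hj, map_zero, smul_zero]

theorem crossOp_triple_apply (i : Labels n m) (t u : Fin (n + m - 1)) (w : Equiv.Perm (Fin n)) (f : MvPolynomial (Fin m) k) :
    (crossOp k ((i.sw t).sw u) t * crossOp k (i.sw t) u * crossOp k i t)
      (Finsupp.single (i, w) f) =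
    (((crossCoef ((i.sw t).sw u) t (crossPerm (i.sw t) u (crossPerm i t w))) *
      crossCoef (i.sw t) u (crossPerm i t w) * crossCoef i t w : ℤ) : k) •
      Finsupp.single (((i.sw t).sw u).sw t,
        crossPerm ((i.sw t).sw u) t (crossPerm (i.sw t) u (crossPerm i t w)))
        (crossPoly k ((i.sw t).sw u) t (crossPoly k (i.sw t) u (crossPoly k i t f))) := by
  simp only [Module.End.mul_apply, crossOp_self, map_smul, smul_smul]
  congr 1
  push_cast
  ring

theorem sw_lo_adj (i : Labels n m) {t u : Fin (n + m - 1)} (h : (t : ℕ) + 1 = u)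
    : (i.sw t).1 (lo u) = i.1 (lo t) := by
  rw [← hi_eq_lo h, Labels.sw_hi]

theorem sw_hi_adj (i : Labels n m) {t u : Fin (n + m - 1)} (h : (t : ℕ) + 1 = u)
    : (i.sw t).1 (hi u) = i.1 (hi u) := by
  rw [Labels.sw_apply, simple_hi_adj h]

theorem sw_hi_adj' (i : Labels n m) {t u : Fin (n + m - 1)} (h : (t : ℕ) + 1 = u)
    : (i.sw u).1 (hi t) = i.1 (hi u) := by
  rw [hi_eq_lo h, Labels.sw_lo]

theorem sw_lo_adj' (i : Labels n m) {t u : Fin (n + m - 1)} (h : (t : ℕ) + 1 = u)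
    : (i.sw u).1 (lo t) = i.1 (lo t) := by
  rw [Labels.sw_apply, simple_lo_adj h]

theorem sw_sw_lo (i : Labels n m) {t u : Fin (n + m - 1)} (h : (t : ℕ) + 1 = u)
    : ((i.sw t).sw u).1 (lo t) = i.1 (hi t) := by
  rw [sw_lo_adj' _ h, Labels.sw_lo]

theorem sw_sw_hi (i : Labels n m) {t u : Fin (n + m - 1)} (h : (t : ℕ) + 1 = u)
    : ((i.sw t).sw u).1 (hi t) = i.1 (hi u) := by
  rw [sw_hi_adj' _ h, sw_hi_adj i h]

theorem sw_sw_lo' (i : Labels n m) {t u : Fin (n + m - 1)} (h : (t : ℕ) + 1 = u)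
    : ((i.sw u).sw t).1 (lo u) = i.1 (lo t) := by
  rw [sw_lo_adj _ h, sw_lo_adj' i h]

theorem sw_sw_hi' (i : Labels n m) {t u : Fin (n + m - 1)} (h : (t : ℕ) + 1 = u)
    : ((i.sw u).sw t).1 (hi u) = i.1 (hi t) := by
  rw [sw_hi_adj _ h, Labels.sw_hi, hi_eq_lo h]

theorem cnt_adj (i : Labels n m) {t u : Fin (n + m - 1)} (h : (t : ℕ) + 1 = u)
    (c : Bool) : cnt i c u = cnt i c t + if i.1 (lo t) = c then 1 else 0 := by
  rw [← h, cnt_hi]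

theorem cnt_sw_adj (i : Labels n m) {t u : Fin (n + m - 1)} (h : (t : ℕ) + 1 = u) (c : Bool) :
    cnt (i.sw t) c u = cnt i c t + if i.1 (hi t) = c then 1 else 0 := by
  rw [cnt_adj _ h, cnt_sw i c (by omega), Labels.sw_lo]

theorem cnt_sw_sw (i : Labels n m) {t u : Fin (n + m - 1)} (h : (t : ℕ) + 1 = u)
    (c : Bool) : cnt ((i.sw t).sw u) c t = cnt i c t := by
  rw [cnt_sw _ c (by omega), cnt_sw i c (by omega)]

theorem cnt_sw_sw' (i : Labels n m) {t u : Fin (n + m - 1)} (h : (t : ℕ) + 1 = u) (c : Bool) :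
    cnt ((i.sw u).sw t) c u = cnt i c t + if i.1 (hi u) = c then 1 else 0 := by
  rw [cnt_sw_adj _ h, cnt_sw i c (by omega), sw_hi_adj' i h]

/-- The rightmost of the three strands has number `cnt i false t + 2`, which is less than `n`. -/
theorem fermionic_triple_lt (i : Labels n m) {t u : Fin (n + m - 1)} (h : (t : ℕ) + 1 = u)
    (h₁ : i.1 (lo t) = false) (h₂ : i.1 (hi t) = false)
    (h₃ : i.1 (hi u) = false) : cnt i false t + 1 < n - 1 := by
  obtain ⟨a, ha⟩ := exists_ferm h₃
  have := (ferm_eq_iff.1 ha).2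
  have e : cnt i false (hi u) = cnt i false t + 1 + 1 := by
    have := cnt_hi i false u
    rwa [if_pos (hi_eq_lo h ▸ h₂), cnt_adj i h, if_pos h₁] at this
  omega

/-- The permutations and signs always satisfy the braid relation, so its defect is the defect `A` of
the polynomial operators. It is `0`, or `1` for labels even, odd, even. -/
theorem crossOp_triple (i : Labels n m) {t u : Fin (n + m - 1)} (h : (t : ℕ) + 1 = u)
    (A : Module.End k (MvPolynomial (Fin m) k))
    (hA : polyOp k m (i.1 (hi t)) (i.1 (hi u)) (cnt i true t) *
        polyOp k m (i.1 (lo t)) (i.1 (hi u)) (cnt i true t + if i.1 (hi t) = true then 1 else 0) *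
        polyOp k m (i.1 (lo t)) (i.1 (hi t)) (cnt i true t) =
      polyOp k m (i.1 (lo t)) (i.1 (hi t)) (cnt i true t + if i.1 (hi u) = true then 1 else 0) *
        polyOp k m (i.1 (lo t)) (i.1 (hi u)) (cnt i true t) *
        polyOp k m (i.1 (hi t)) (i.1 (hi u)) (cnt i true t + if i.1 (lo t) = true then 1 else 0)
        + A)
    (w : Equiv.Perm (Fin n)) (f : MvPolynomial (Fin m) k) :
    (crossOp k ((i.sw t).sw u) t * crossOp k (i.sw t) u * crossOp k i t)
      (Finsupp.single (i, w) f) =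
    (crossOp k ((i.sw u).sw t) u * crossOp k (i.sw u) t * crossOp k i u)
      (Finsupp.single (i, w) f) +
    (((crossCoef ((i.sw t).sw u) t (crossPerm (i.sw t) u (crossPerm i t w))) *
      crossCoef (i.sw t) u (crossPerm i t w) * crossCoef i t w : ℤ) : k) •
      Finsupp.single (((i.sw t).sw u).sw t,
        crossPerm ((i.sw t).sw u) t (crossPerm (i.sw t) u (crossPerm i t w))) (A f) := by
  have lu : i.1 (lo u) = i.1 (hi t) := by rw [hi_eq_lo h]
  have hn : i.1 (lo t) = false → i.1 (hi t) = false → i.1 (hi u) = false →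
    cnt i false t + 1 < n - 1 := fermionic_triple_lt i h
  have p1 := crossPerm_of_labels (sw_lo_adj i h) (sw_hi_adj i h) (cnt_sw_adj i h false)
  have p2 := crossPerm_of_labels (sw_sw_lo i h) (sw_sw_hi i h) (cnt_sw_sw i h false)
  have p3 := crossPerm_of_labels lu rfl (cnt_adj i h false)
  have p4 := crossPerm_of_labels (sw_lo_adj' i h) (sw_hi_adj' i h)
    (cnt_sw i false (t := u) (u := t) (by omega))
  have p5 := crossPerm_of_labels (sw_sw_lo' i h) (sw_sw_hi' i h) (cnt_sw_sw' i h false)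
  have p6 := crossPerm_of_labels (i := i) (t := t) rfl rfl rfl
  have c1 := crossCoef_of_labels (sw_lo_adj i h) (sw_hi_adj i h) (cnt_sw_adj i h false)
  have c2 := crossCoef_of_labels (sw_sw_lo i h) (sw_sw_hi i h) (cnt_sw_sw i h false)
  have c3 := crossCoef_of_labels lu rfl (cnt_adj i h false)
  have c4 := crossCoef_of_labels (sw_lo_adj' i h) (sw_hi_adj' i h)
    (cnt_sw i false (t := u) (u := t) (by omega))
  have c5 := crossCoef_of_labels (sw_sw_lo' i h) (sw_sw_hi' i h) (cnt_sw_sw' i h false)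
  have c6 := crossCoef_of_labels (i := i) (t := t) rfl rfl rfl
  have q1 := crossPoly_of_labels (k := k) (sw_lo_adj i h) (sw_hi_adj i h) (cnt_sw_adj i h true)
  have q2 := crossPoly_of_labels (k := k) (sw_sw_lo i h) (sw_sw_hi i h) (cnt_sw_sw i h true)
  have q3 := crossPoly_of_labels (k := k) lu rfl (cnt_adj i h true)
  have q4 := crossPoly_of_labels (k := k) (sw_lo_adj' i h) (sw_hi_adj' i h)
    (cnt_sw i true (t := u) (u := t) (by omega))
  have q5 := crossPoly_of_labels (k := k) (sw_sw_lo' i h) (sw_sw_hi' i h) (cnt_sw_sw' i h true)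
  have q6 := crossPoly_of_labels (k := k) (i := i) (t := t) rfl rfl rfl
  have hA' := LinearMap.congr_fun hA f
  simp only [LinearMap.add_apply, Module.End.mul_apply] at hA'
  rw [crossOp_triple_apply]
  simp only [Module.End.mul_apply, crossOp_self, map_smul, smul_smul,
    p1, p2, p3, p4, p5, p6, c1, c2, c3, c4, c5, c6, q1, q2, q3, q4, q5, q6]
  rw [hA', Finsupp.single_add, smul_add, Labels.sw_braid i h, permOp_braid w hn,
    permCoef_braid w hn]
  congr 2
  push_cast
  ring

end Action

/-! ### Verification of the defining relations on `Pol` -/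

section Action

variable (k : Type*) [Field k] {n m : ℕ}

/-- The action of the generating diagrams. -/
def genOp : Gen n m → Module.End k (Pol k n m)
  | .idem i => idemOp k i
  | .dot i a => dotOp k i a
  | .cross i t => crossOp k i t

variable {k}

theorem crossPoly_bos_bos {i : Labels n m} {t : Fin (n + m - 1)} {a b : Fin m}
    (ha : bos i a = lo t) (hb : bos i b = hi t) :
    (a : ℕ) + 1 = b ∧ ∀ f : MvPolynomial (Fin m) k, crossPoly k i t f = divDiff k a b f := by
  obtain ⟨h1, h2⟩ := bos_eq_iff.1 ha
  obtain ⟨h3, h4⟩ := bos_eq_iff.1 hb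
  have e : (a : ℕ) + 1 = b := by
    have := cnt_hi i true t
    rw [if_pos h1] at this
    change cnt i true (t + 1) = b at h4
    change cnt i true t = a at h2
    omega
  refine ⟨e, fun f => ?_⟩
  rw [crossPoly_of_labels h1 h3 h2, polyOp, ddOp_apply e]

theorem crossCoef_of_bos_lo {i : Labels n m} {t : Fin (n + m - 1)} (h : i.1 (lo t) = true)
    (w : Equiv.Perm (Fin n)) : crossCoef i t w = 1 := by
  rw [crossCoef_of_labels h rfl rfl, permCoef]

theorem crossPerm_of_bos_lo {i : Labels n m} {t : Fin (n + m - 1)} (h : i.1 (lo t) = true)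
    (w : Equiv.Perm (Fin n)) : crossPerm i t w = w := by
  rw [crossPerm_of_labels h rfl rfl, permOp]

theorem crossCoef_of_bos_hi {i : Labels n m} {t : Fin (n + m - 1)} (h : i.1 (hi t) = true)
    (w : Equiv.Perm (Fin n)) : crossCoef i t w = 1 := by
  rw [crossCoef_of_labels rfl h rfl]
  cases i.1 (lo t) <;> rfl

theorem crossPerm_of_bos_hi {i : Labels n m} {t : Fin (n + m - 1)} (h : i.1 (hi t) = true)
    (w : Equiv.Perm (Fin n)) : crossPerm i t w = w := by
  rw [crossPerm_of_labels rfl h rfl]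
  cases i.1 (lo t) <;> rfl

theorem crossOp_bos_bos {i : Labels n m} {t : Fin (n + m - 1)} {a b : Fin m}
    (ha : bos i a = lo t) (hb : bos i b = hi t) (w : Equiv.Perm (Fin n))
    (f : MvPolynomial (Fin m) k) :
    crossOp k i t (Finsupp.single (i, w) f) = Finsupp.single (i, w) (divDiff k a b f) := by
  have h1 := (bos_eq_iff.1 ha).1
  rw [crossOp_self, (crossPoly_bos_bos ha hb).2, crossCoef_of_bos_lo h1, crossPerm_of_bos_lo h1,
    Labels.sw_eq_self (h1.trans (bos_eq_iff.1 hb).1.symm), Int.cast_one, one_smul]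

theorem crossOp_ferm_bos {i : Labels n m} {t : Fin (n + m - 1)} (h₁ : i.1 (lo t) = false)
    (h₂ : i.1 (hi t) = true) (w : Equiv.Perm (Fin n)) (f : MvPolynomial (Fin m) k) :
    crossOp k i t (Finsupp.single (i, w) f) = Finsupp.single (i.sw t, w) f := by
  rw [crossOp_self, crossCoef_of_bos_hi h₂, crossPerm_of_bos_hi h₂, crossPoly_of_labels h₁ h₂ rfl,
    Int.cast_one, one_smul, polyOp, Module.End.one_apply]

theorem crossOp_bos_ferm {i : Labels n m} {t : Fin (n + m - 1)} {a : Fin m}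
    (ha : bos i a = lo t) (h₂ : i.1 (hi t) = false) (w : Equiv.Perm (Fin n))
    (f : MvPolynomial (Fin m) k) :
    crossOp k i t (Finsupp.single (i, w) f) = Finsupp.single (i.sw t, w) (X a * f) := by
  obtain ⟨h1, h3⟩ := bos_eq_iff.1 ha
  rw [crossOp_self, crossCoef_of_bos_lo h1, crossPerm_of_bos_lo h1, crossPoly_of_labels h1 h₂ h3,
    Int.cast_one, one_smul, polyOp, xOp_apply]

theorem crossOp_ferm_ferm {i : Labels n m} {t : Fin (n + m - 1)} {a : Fin (n - 1)}
    (h₁ : ferm i (lo a) = lo t) (h₂ : ferm i (hi a) = hi t) (w : Equiv.Perm (Fin n))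
    (f : MvPolynomial (Fin m) k) :
    crossOp k i t (Finsupp.single (i, w) f) =
      (fermCoef w a : k) • Finsupp.single (i, simple a * w) f := by
  obtain ⟨h3, h4⟩ := ferm_eq_iff.1 h₁
  obtain ⟨h5, -⟩ := ferm_eq_iff.1 h₂
  rw [crossOp_self, crossCoef_of_labels h3 h5 h4, crossPerm_of_labels h3 h5 h4,
    crossPoly_of_labels h3 h5 rfl, Labels.sw_eq_self (h3.trans h5.symm)]
  have : ((lo a : Fin n) : ℕ) < n - 1 := a.2
  simp only [permCoef, permOp, dif_pos this, polyOp, Module.End.one_apply]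
  rfl

/-- Two adjacent strands: both bosonic, fermionic and bosonic, bosonic and fermionic, or both
fermionic. -/
theorem strand_cases (i : Labels n m) (t : Fin (n + m - 1)) :
    (∃ a b : Fin m, bos i a = lo t ∧ bos i b = hi t) ∨
    (i.1 (lo t) = false ∧ ∃ a, bos i a = hi t) ∨
    ((∃ a, bos i a = lo t) ∧ i.1 (hi t) = false) ∨
    ∃ a : Fin (n - 1), ferm i (lo a) = lo t ∧ ferm i (hi a) = hi t := by
  cases h1 : i.1 (lo t) <;> cases h2 : i.1 (hi t)
  · exact Or.inr (Or.inr (Or.inr (exists_ferm_ferm h1 h2)))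
  · exact Or.inr (Or.inl ⟨rfl, exists_bos h2⟩)
  · exact Or.inr (Or.inr (Or.inl ⟨exists_bos h1, rfl⟩))
  · obtain ⟨a, ha⟩ := exists_bos h1
    obtain ⟨b, hb⟩ := exists_bos h2
    exact Or.inl ⟨a, b, ha, hb⟩

theorem dotOp_mul_crossOp {i : Labels n m} {t : Fin (n + m - 1)} {a : Fin m}
    (h : ∀ f : MvPolynomial (Fin m) k, crossPoly k i t (X a * f) = X a * crossPoly k i t f) :
    dotOp k (i.sw t) a * crossOp k i t = crossOp k i t * dotOp k i a := by
  refine pol_ext i (fun w f => ?_) (fun j hj w f => ?_) (fun j hj w f => ?_)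
  · rw [Module.End.mul_apply, Module.End.mul_apply, dotOp_self, crossOp_self, crossOp_self,
      map_smul, dotOp_self, h]
  · rw [Module.End.mul_apply, crossOp_ne hj, map_zero]
  · rw [Module.End.mul_apply, dotOp_ne hj, map_zero]

/-- Only a crossing of two bosonic strands acts by a divided difference; any other is a
multiplication operator and hence linear over polynomials. -/
theorem crossPoly_X_mul_of_not {i : Labels n m} {t : Fin (n + m - 1)}
    (h : ¬ (i.1 (lo t) = true ∧ i.1 (hi t) = true)) (p f : MvPolynomial (Fin m) k) :
    crossPoly k i t (p * f) = p * crossPoly k i t f := by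
  rw [crossPoly]
  cases h1 : i.1 (lo t)
  · simp [polyOp]
  · cases h2 : i.1 (hi t)
    · obtain ⟨b, hb⟩ := exists_bos h1
      have hb' : cnt i true t = b := (bos_eq_iff.1 hb).2
      rw [polyOp, hb', xOp_apply, xOp_apply]
      ring
    · exact absurd ⟨h1, h2⟩ h

theorem genOp_rel {x y : FreeAlgebra k (Gen n m)} (h : Rel k n m x y) :
    FreeAlgebra.lift k (genOp k) x = FreeAlgebra.lift k (genOp k) y := by
  induction h with
  | idem_mul_self i =>
    simp only [map_mul, FreeAlgebra.lift_ι_apply, genOp]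
    refine pol_ext i (fun w f => ?_) (fun j hj w f => ?_) (fun j hj w f => ?_)
    · rw [Module.End.mul_apply, idemOp_self, idemOp_self]
    · rw [Module.End.mul_apply, idemOp_ne hj, map_zero]
    · rw [idemOp_ne hj]
  | idem_mul_ne i j h =>
    simp only [map_mul, FreeAlgebra.lift_ι_apply, genOp, map_zero]
    refine pol_ext j (fun w f => ?_) (fun j hj w f => ?_) (fun j hj w f => rfl)
    · rw [Module.End.mul_apply, idemOp_self, idemOp_ne h.symm]; rfl
    · rw [Module.End.mul_apply, idemOp_ne hj, map_zero]
  | sum_idem =>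
    simp only [map_sum, FreeAlgebra.lift_ι_apply, genOp, map_one]
    refine Finsupp.lhom_ext fun x f => ?_
    obtain ⟨j, w⟩ := x
    rw [LinearMap.sum_apply, Finset.sum_eq_single j (fun i _ h => idemOp_ne h.symm w f)
      (fun h => absurd (Finset.mem_univ _) h), idemOp_self, Module.End.one_apply]
  | idem_dot i a =>
    simp only [map_mul, FreeAlgebra.lift_ι_apply, genOp]
    refine pol_ext i (fun w f => ?_) (fun j hj w f => ?_) (fun j hj w f => ?_)
    · rw [Module.End.mul_apply, dotOp_self, idemOp_self]
    · rw [Module.End.mul_apply, dotOp_ne hj, map_zero]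
    · rw [dotOp_ne hj]
  | dot_idem i a =>
    simp only [map_mul, FreeAlgebra.lift_ι_apply, genOp]
    refine pol_ext i (fun w f => ?_) (fun j hj w f => ?_) (fun j hj w f => ?_)
    · rw [Module.End.mul_apply, idemOp_self]
    · rw [Module.End.mul_apply, idemOp_ne hj, map_zero]
    · rw [dotOp_ne hj]
  | idem_cross i t =>
    simp only [map_mul, FreeAlgebra.lift_ι_apply, genOp]
    refine pol_ext i (fun w f => ?_) (fun j hj w f => ?_) (fun j hj w f => ?_)
    · rw [Module.End.mul_apply, crossOp_self, map_smul, idemOp_self]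
    · rw [Module.End.mul_apply, crossOp_ne hj, map_zero]
    · rw [crossOp_ne hj]
  | cross_idem i t =>
    simp only [map_mul, FreeAlgebra.lift_ι_apply, genOp]
    refine pol_ext i (fun w f => ?_) (fun j hj w f => ?_) (fun j hj w f => ?_)
    · rw [Module.End.mul_apply, idemOp_self]
    · rw [Module.End.mul_apply, idemOp_ne hj, map_zero]
    · rw [crossOp_ne hj]
  | far_odd i t u h ht hu =>
    simp only [map_mul, map_neg, FreeAlgebra.lift_ι_apply, genOp]
    refine (crossOp_far i h (-1) fun w => ?_).trans
      -- The scalar in `crossOp_far` is an integer, so the negative has to be rewritten as the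
      -- multiple by `-1`.
      (LinearMap.ext fun x => by rw [LinearMap.smul_apply, LinearMap.neg_apply, neg_one_smul])
    rw [crossCoef_of_labels ht.1 ht.2 rfl, crossPerm_of_labels ht.1 ht.2 rfl,
      crossCoef_of_labels hu.1 hu.2 rfl, crossPerm_of_labels hu.1 hu.2 rfl, neg_one_mul]
    refine permCoef_far_odd ?_ w
    have := cnt_add_le_far i h false
    rwa [if_pos ht.1, if_pos ht.2] at this
  | far_even i t u h hb =>
    simp only [map_mul, FreeAlgebra.lift_ι_apply, genOp]
    rw [crossOp_far i h 1, one_smul]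
    intro w
    rw [one_mul]
    exact permCoef_far_even hb w
  | dot_far i t a h₁ h₂ =>
    simp only [map_mul, FreeAlgebra.lift_ι_apply, genOp]
    refine dotOp_mul_crossOp fun f => ?_
    by_cases hb : i.1 (lo t) = true ∧ i.1 (hi t) = true
    · obtain ⟨b, hb1⟩ := exists_bos hb.1
      obtain ⟨c, hc1⟩ := exists_bos hb.2
      obtain ⟨hbc, hf⟩ := crossPoly_bos_bos (k := k) hb1 hc1
      rw [hf, hf, divDiff_X_mul_of_ne]
      · intro e; rw [e] at hbc; omega
      · rintro rfl; exact h₁ hb1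
      · rintro rfl; exact h₂ hc1
    · exact crossPoly_X_mul_of_not hb _ _
  | dot_dot i a b =>
    simp only [map_mul, FreeAlgebra.lift_ι_apply, genOp]
    refine pol_ext i (fun w f => ?_) (fun j hj w f => ?_) (fun j hj w f => ?_)
    · simp only [Module.End.mul_apply, dotOp_self]
      rw [mul_left_comm]
    · rw [Module.End.mul_apply, dotOp_ne hj, map_zero]
    · rw [Module.End.mul_apply, dotOp_ne hj, map_zero]
  | dot_mixed i t a hm ha =>
    simp only [map_mul, FreeAlgebra.lift_ι_apply, genOp]
    exact dotOp_mul_crossOp fun f =>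
      crossPoly_X_mul_of_not (fun h => hm (h.1.trans h.2.symm)) _ f
  | nil_top i t a b ha hb =>
    simp only [map_sub, map_mul, FreeAlgebra.lift_ι_apply, genOp]
    have hab : a ≠ b := fun e => lo_ne_hi t (by rw [← ha, ← hb, e])
    refine pol_ext i (fun w f => ?_) (fun j hj w f => ?_) (fun j hj w f => idemOp_ne hj w f)
    · rw [LinearMap.sub_apply, Module.End.mul_apply, Module.End.mul_apply, dotOp_self,
        crossOp_bos_bos ha hb, crossOp_bos_bos ha hb, dotOp_self, idemOp_self,
        divDiff_X_mul_right hab, ← Finsupp.single_sub, sub_sub_cancel]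
    · rw [LinearMap.sub_apply, Module.End.mul_apply, Module.End.mul_apply, dotOp_ne hj,
        crossOp_ne hj, map_zero, map_zero, sub_zero]
  | nil_bot i t a b ha hb =>
    simp only [map_sub, map_mul, FreeAlgebra.lift_ι_apply, genOp]
    have hab : a ≠ b := fun e => lo_ne_hi t (by rw [← ha, ← hb, e])
    refine pol_ext i (fun w f => ?_) (fun j hj w f => ?_) (fun j hj w f => idemOp_ne hj w f)
    · rw [LinearMap.sub_apply, Module.End.mul_apply, Module.End.mul_apply, dotOp_self,
        crossOp_bos_bos ha hb, crossOp_bos_bos ha hb, dotOp_self, idemOp_self,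
        divDiff_X_mul_left hab, ← Finsupp.single_sub, add_sub_cancel_right]
    · rw [LinearMap.sub_apply, Module.End.mul_apply, Module.End.mul_apply, dotOp_ne hj,
        crossOp_ne hj, map_zero, map_zero, sub_zero]
  | double_same i t h =>
    simp only [map_mul, map_zero, FreeAlgebra.lift_ι_apply, genOp]
    rw [Labels.sw_eq_self h]
    refine pol_ext i (fun w f => ?_) (fun j hj w f => ?_) (fun j hj w f => rfl)
    · rcases strand_cases i t with ⟨a, b, ha, hb⟩ | ⟨h1, a, ha⟩ | ⟨⟨a, ha⟩, h2⟩ | ⟨a, h1, h2⟩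
      · have hab : a ≠ b := fun e => lo_ne_hi t (by rw [← ha, ← hb, e])
        rw [Module.End.mul_apply, crossOp_bos_bos ha hb, crossOp_bos_bos ha hb,
          divDiff_divDiff_self hab, Finsupp.single_zero, LinearMap.zero_apply]
      · rw [h1, (bos_eq_iff.1 ha).1] at h; cases h
      · rw [h2, (bos_eq_iff.1 ha).1] at h; cases h
      · rw [Module.End.mul_apply, crossOp_ferm_ferm h1 h2, map_smul, crossOp_ferm_ferm h1 h2,
          smul_smul, mul_comm, ← Int.cast_mul, fermCoef_sq, Int.cast_zero, zero_smul,
          LinearMap.zero_apply]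
    · rw [Module.End.mul_apply, crossOp_ne hj, map_zero]
  | double_mixed i t a hm ha =>
    simp only [map_mul, FreeAlgebra.lift_ι_apply, genOp]
    refine pol_ext i (fun w f => ?_) (fun j hj w f => ?_) (fun j hj w f => dotOp_ne hj a w f)
    · rw [Module.End.mul_apply, dotOp_self]
      rcases ha with ha | ha
      · have h1 := (bos_eq_iff.1 ha).1
        have h2 : i.1 (hi t) = false := by
          rw [h1] at hm; exact (Bool.eq_false_of_not_eq_true fun e => hm e.symm)
        rw [crossOp_bos_ferm ha h2, crossOp_ferm_bos (by rw [Labels.sw_lo, h2])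
          (by rw [Labels.sw_hi, h1]), Labels.sw_sw]
      · have h1 := (bos_eq_iff.1 ha).1
        have h2 : i.1 (lo t) = false := by
          rw [h1] at hm; exact (Bool.eq_false_of_not_eq_true hm)
        have ha' : bos (i.sw t) a = lo t := by
          rw [← simple_bos_of_not (by simp [h2]), ha, simple_hi]
        rw [crossOp_ferm_bos h2 h1, crossOp_bos_ferm ha' (by rw [Labels.sw_hi, h2]),
          Labels.sw_sw]
    · rw [Module.End.mul_apply, crossOp_ne hj, map_zero]
  | triple i t u h hb =>
    simp only [map_mul, FreeAlgebra.lift_ι_apply, genOp]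
    refine pol_ext i (fun w f => ?_) (fun j hj w f => ?_) (fun j hj w f => ?_)
    · rw [crossOp_triple i h 0 (by rw [add_zero]; exact polyOp_braid hb)]
      simp
    · rw [Module.End.mul_apply, crossOp_ne hj, map_zero]
    · rw [Module.End.mul_apply, crossOp_ne hj, map_zero]
  | triple_even_odd_even i t u h hb =>
    simp only [map_mul, map_add, FreeAlgebra.lift_ι_apply, genOp]
    obtain ⟨h1, h2, h3⟩ := hb
    -- The second bosonic strand of the triple has number `cnt i true t + 1`, so the divided
    -- difference and both variables are in range.
    have hm : cnt i true t + 1 < m := by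
      obtain ⟨b, hb⟩ := exists_bos h3
      have hb' : cnt i true (u + 1) = b := (bos_eq_iff.1 hb).2
      have := cnt_hi i true u
      have hu := cnt_adj i h true
      rw [← hi_eq_lo h, h2, if_neg (by simp)] at this
      rw [if_pos h1] at hu
      omega
    refine pol_ext i (fun w f => ?_) (fun j hj w f => ?_) (fun j hj w f => ?_)
    · rw [crossOp_triple i h 1 (by
        rw [h1, h2, h3]; simpa using polyOp_braid_even_odd_even (k := k) hm), LinearMap.add_apply,
        idemOp_self, Module.End.one_apply]
      congr 1
      have e1 : (i.sw t).1 (lo u) = true := by rw [sw_lo_adj i h, h1]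
      have e2 : ((i.sw t).sw u).1 (hi t) = true := by rw [sw_sw_hi i h, h3]
      have e3 : ((i.sw t).sw u).1 (lo t) = false := by rw [sw_sw_lo i h, h2]
      have e4 : (i.sw t).sw u = i.sw t :=
        Labels.sw_eq_self (by rw [e1, sw_hi_adj i h, h3])
      rw [crossCoef_of_bos_lo h1, crossPerm_of_bos_lo h1, crossCoef_of_bos_lo e1,
        crossPerm_of_bos_lo e1, crossCoef_of_bos_hi e2, crossPerm_of_bos_hi e2, e4, Labels.sw_sw]
      simp
    · rw [Module.End.mul_apply, crossOp_ne hj, map_zero]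
    · rw [LinearMap.add_apply, Module.End.mul_apply, crossOp_ne hj, idemOp_ne hj, map_zero,
        add_zero]

/-- The representation of `R(n,m)` on `Pol`. -/
def polRep (k : Type*) [Field k] (n m : ℕ) : RAlg k n m →ₐ[k] Module.End k (Pol k n m) :=
  RingQuot.liftAlgHom k ⟨FreeAlgebra.lift k (genOp k), fun _ _ => genOp_rel⟩

theorem polRep_idem (i : Labels n m) : polRep k n m (idem k i) = idemOp k i := by
  rw [polRep, idem, RingQuot.liftAlgHom_mkAlgHom_apply, FreeAlgebra.lift_ι_apply, genOp]

theorem polRep_dot (i : Labels n m) (a : Fin m) : polRep k n m (dot k i a) = dotOp k i a := by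
  rw [polRep, dot, RingQuot.liftAlgHom_mkAlgHom_apply, FreeAlgebra.lift_ι_apply, genOp]

theorem polRep_cross (i : Labels n m) (t : Fin (n + m - 1)) :
    polRep k n m (cross k i t) = crossOp k i t := by
  rw [polRep, cross, RingQuot.liftAlgHom_mkAlgHom_apply, FreeAlgebra.lift_ι_apply, genOp]

theorem isPolAction_polRep : IsPolAction (polRep k n m) where
  idem_self i w f := by rw [polRep_idem, idemOp_self]
  idem_ne i j w f h := by rw [polRep_idem, idemOp_ne h]
  dot_self i a w f := by rw [polRep_dot, dotOp_self]
  dot_ne i j a w f h := by rw [polRep_dot, dotOp_ne h]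
  cross_ne i j t w f h := by rw [polRep_cross, crossOp_ne h]
  cross_bos_bos i t a b w f ha hb := by rw [polRep_cross, crossOp_bos_bos ha hb]
  cross_ferm_bos i t w f h₁ h₂ := by rw [polRep_cross, crossOp_ferm_bos h₁ h₂]
  cross_bos_ferm i t a w f ha h := by rw [polRep_cross, crossOp_bos_ferm ha h]
  cross_ferm_ferm_up i t a w f h₁ h₂ hl := by
    rw [polRep_cross, crossOp_ferm_ferm h₁ h₂, eps_eq_fermCoef k (up_iff_len.2 hl),
      Finsupp.smul_single]
  cross_ferm_ferm_down i t a w f h₁ h₂ hl := by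
    rw [polRep_cross, crossOp_ferm_ferm h₁ h₂, fermCoef_down, Int.cast_zero, zero_smul]
    intro h
    have := len_up h
    omega

end Action

/-! ### Spanning sets -/

section Relations

variable {k : Type*} [Field k] {n m : ℕ}

theorem mk_eq_of_rel {x y : FreeAlgebra k (Gen n m)} (h : Rel k n m x y) :
    RingQuot.mkAlgHom k (Rel k n m) x = RingQuot.mkAlgHom k (Rel k n m) y :=
  RingQuot.mkAlgHom_rel k h

theorem idem_mul_self (i : Labels n m) : idem k i * idem k i = idem k i := by
  simpa only [map_mul, idem, dot, cross] using mk_eq_of_rel (Rel.idem_mul_self (k := k) i)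

theorem idem_mul_ne {i j : Labels n m} (h : i ≠ j) : idem k i * idem k j = 0 := by
  simpa only [map_mul, map_zero, idem] using mk_eq_of_rel (Rel.idem_mul_ne (k := k) i j h)

theorem sum_idem : ∑ i : Labels n m, idem k i = 1 := by
  simpa only [map_sum, map_one, idem] using mk_eq_of_rel (Rel.sum_idem (k := k) (n := n) (m := m))

theorem idem_mul_dot (i : Labels n m) (a : Fin m) : idem k i * dot k i a = dot k i a := by
  simpa only [map_mul, idem, dot, cross] using mk_eq_of_rel (Rel.idem_dot (k := k) i a)

theorem dot_mul_idem (i : Labels n m) (a : Fin m) : dot k i a * idem k i = dot k i a := by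
  simpa only [map_mul, idem, dot, cross] using mk_eq_of_rel (Rel.dot_idem (k := k) i a)

theorem idem_mul_cross (i : Labels n m) (t : Fin (n + m - 1)) :
    idem k (i.sw t) * cross k i t = cross k i t := by
  simpa only [map_mul, idem, dot, cross] using mk_eq_of_rel (Rel.idem_cross (k := k) i t)

theorem cross_mul_idem (i : Labels n m) (t : Fin (n + m - 1)) :
    cross k i t * idem k i = cross k i t := by
  simpa only [map_mul, idem, dot, cross] using mk_eq_of_rel (Rel.cross_idem (k := k) i t)

theorem idem_mul_dot_ne {i j : Labels n m} (h : i ≠ j) (a : Fin m) :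
    idem k i * dot k j a = 0 := by
  rw [← idem_mul_dot, ← mul_assoc, idem_mul_ne h, zero_mul]

theorem dot_mul_idem_ne {i j : Labels n m} (h : i ≠ j) (a : Fin m) :
    dot k i a * idem k j = 0 := by
  rw [← dot_mul_idem, mul_assoc, idem_mul_ne h, mul_zero]

theorem idem_mul_dotSum (i : Labels n m) (a : Fin m) : idem k i * dotSum k n a = dot k i a := by
  rw [dotSum, Finset.mul_sum, Finset.sum_eq_single i, idem_mul_dot]
  · exact fun j _ h => idem_mul_dot_ne h.symm a
  · exact fun h => absurd (Finset.mem_univ _) h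

theorem dotSum_mul_idem (i : Labels n m) (a : Fin m) : dotSum k n a * idem k i = dot k i a := by
  rw [dotSum, Finset.sum_mul, Finset.sum_eq_single i, dot_mul_idem]
  · exact fun j _ h => dot_mul_idem_ne h a
  · exact fun h => absurd (Finset.mem_univ _) h

theorem dotSum_mul_cross (i : Labels n m) (t : Fin (n + m - 1)) (a : Fin m) :
    dotSum k n a * cross k i t = dot k (i.sw t) a * cross k i t := by
  rw [← idem_mul_cross, ← mul_assoc, dotSum_mul_idem, ← mul_assoc, dot_mul_idem]

theorem cross_mul_dotSum (i : Labels n m) (t : Fin (n + m - 1)) (a : Fin m) :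
    cross k i t * dotSum k n a = cross k i t * dot k i a := by
  rw [← cross_mul_idem, mul_assoc, idem_mul_dotSum, mul_assoc, idem_mul_dot]

/-! ### Moving polynomials in dots through idempotents and crossings -/

theorem idem_mul_polyDots (i : Labels n m) (p : MvPolynomial (Fin m) k) :
    idem k i * polyDots k n m p = polyDots k n m p * idem k i := by
  induction p using MvPolynomial.induction_on with
  | C c =>
    rw [← algebraMap_eq, AlgHom.commutes, Algebra.commutes]
  | add p q hp hq => rw [map_add, mul_add, add_mul, hp, hq]
  | mul_X p a hp =>
    rw [map_mul, ← mul_assoc, hp, mul_assoc, mul_assoc, polyDots_X, idem_mul_dotSum,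
      dotSum_mul_idem]

theorem cross_mul_dotSum_of_not {i : Labels n m} {t : Fin (n + m - 1)}
    (h : ¬ (i.1 (lo t) = true ∧ i.1 (hi t) = true)) (a : Fin m) :
    cross k i t * dotSum k n a = dotSum k n a * cross k i t := by
  rw [dotSum_mul_cross, cross_mul_dotSum, eq_comm]
  by_cases h' : bos i a = lo t ∨ bos i a = hi t
  · have hm : i.1 (lo t) ≠ i.1 (hi t) := by
      intro e
      rcases h' with h' | h'
      · have := (bos_eq_iff.1 h').1
        exact h ⟨this, e ▸ this⟩
      · have := (bos_eq_iff.1 h').1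
        exact h ⟨e.trans this, this⟩
    simpa only [map_mul, idem, dot, cross] using mk_eq_of_rel (Rel.dot_mixed (k := k) i t a hm h')
  · rw [not_or] at h'
    simpa only [map_mul, idem, dot, cross] using mk_eq_of_rel (Rel.dot_far (k := k) i t a h'.1 h'.2)

theorem cross_mul_polyDots_of_not {i : Labels n m} {t : Fin (n + m - 1)}
    (h : ¬ (i.1 (lo t) = true ∧ i.1 (hi t) = true)) (p : MvPolynomial (Fin m) k) :
    cross k i t * polyDots k n m p = polyDots k n m p * cross k i t := by
  induction p using MvPolynomial.induction_on with
  | C c => rw [← algebraMap_eq, AlgHom.commutes, Algebra.commutes]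
  | add p q hp hq => rw [map_add, mul_add, add_mul, hp, hq]
  | mul_X p a hp =>
    rw [map_mul, ← mul_assoc, hp, mul_assoc, mul_assoc, polyDots_X, cross_mul_dotSum_of_not h]

theorem cross_mul_dotSum_bos {i : Labels n m} {t : Fin (n + m - 1)} {a b : Fin m}
    (ha : bos i a = lo t) (hb : bos i b = hi t) (c : Fin m) :
    cross k i t * dotSum k n c = dotSum k n (Equiv.swap a b c) * cross k i t +
      polyDots k n m (divDiff k a b (X c)) * idem k i := by
  have hab : a ≠ b := fun e => lo_ne_hi t (by rw [← ha, ← hb, e])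
  have hi' : i.sw t = i :=
    Labels.sw_eq_self ((bos_eq_iff.1 ha).1.trans (bos_eq_iff.1 hb).1.symm)
  rw [dotSum_mul_cross, cross_mul_dotSum, hi']
  by_cases hca : c = a
  · subst hca
    have := mk_eq_of_rel (Rel.nil_bot (k := k) i t c b ha hb)
    simp only [map_mul, map_sub] at this
    rw [Equiv.swap_apply_left, divDiff_X_left hab, map_one, one_mul, add_comm]
    exact sub_eq_iff_eq_add.1 this
  by_cases hcb : c = b
  · subst hcb
    have := mk_eq_of_rel (Rel.nil_top (k := k) i t a c ha hb)
    simp only [map_mul, map_sub] at this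
    have h2 : dot k i a * cross k i t = idem k i + cross k i t * dot k i c :=
      sub_eq_iff_eq_add.1 this
    have h3 : polyDots k n m (-1) * idem k i + idem k i = 0 := by
      rw [← add_one_mul, ← map_one (polyDots k n m), ← map_add, neg_add_cancel, map_zero, zero_mul]
    rw [Equiv.swap_apply_right, divDiff_X_right hab, h2, add_right_comm, add_comm (idem k i), h3,
      zero_add]
  rw [Equiv.swap_apply_of_ne_of_ne hca hcb, divDiff_of_symm hab, map_zero, zero_mul, add_zero]
  · have h1 : bos i c ≠ lo t := fun e => hca ((bos_strictMono i).injective (e.trans ha.symm))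
    have h2 : bos i c ≠ hi t := fun e => hcb ((bos_strictMono i).injective (e.trans hb.symm))
    have := mk_eq_of_rel (Rel.dot_far (k := k) i t c h1 h2)
    simp only [map_mul] at this
    rw [hi'] at this
    exact this.symm
  · rw [rename_X, Equiv.swap_apply_of_ne_of_ne hca hcb]

/-- The nilHecke relations are the case of a variable; the general case follows by induction from
the twisted Leibniz rule `divDiff_mul`. -/
theorem cross_mul_polyDots_bos {i : Labels n m} {t : Fin (n + m - 1)} {a b : Fin m}
    (ha : bos i a = lo t) (hb : bos i b = hi t) (p : MvPolynomial (Fin m) k) :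
    cross k i t * polyDots k n m p =
      polyDots k n m (rename (Equiv.swap a b) p) * cross k i t +
        polyDots k n m (divDiff k a b p) * idem k i := by
  have hab : a ≠ b := fun e => lo_ne_hi t (by rw [← ha, ← hb, e])
  induction p using MvPolynomial.induction_on with
  | C c =>
    rw [rename_C, divDiff_of_symm hab (rename_C _ _), map_zero, zero_mul, add_zero,
      ← algebraMap_eq, AlgHom.commutes, Algebra.commutes]
  | add p q hp hq =>
    have : divDiff k a b (p + q) = divDiff k a b p + divDiff k a b q :=
      map_add (divDiffₗ k a b hab) p q
    rw [this, map_add, map_add, map_add, map_add, mul_add, hp, hq]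
    simp only [add_mul]
    abel
  | mul_X p c hp =>
    rw [divDiff_mul hab]
    simp only [map_mul, map_add]
    rw [← mul_assoc, hp, add_mul, mul_assoc, mul_assoc, polyDots_X, cross_mul_dotSum_bos ha hb,
      idem_mul_dotSum, mul_add, rename_X, polyDots_X, ← dotSum_mul_idem]
    simp only [mul_assoc, add_mul]
    abel

end Relations

/-! ### Filtration by the number of crossings -/

section Spanning

variable {k : Type*} [Field k] {n m : ℕ}

/-- `R(n,m)` as a left module over the polynomials in dots. -/
abbrev polyModule (k : Type*) [Field k] (n m : ℕ) :
    Module (MvPolynomial (Fin m) k) (RAlg k n m) :=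
  Module.compHom _ (polyDots k n m).toRingHom

attribute [local instance] polyModule

theorem poly_smul_def (p : MvPolynomial (Fin m) k) (x : RAlg k n m) :
    p • x = polyDots k n m p * x := rfl

theorem C_smul_eq (c : k) (x : RAlg k n m) : (C c : MvPolynomial (Fin m) k) • x = c • x := by
  rw [poly_smul_def, ← algebraMap_eq, AlgHom.commutes, Algebra.smul_def]

theorem idem_mul_wordDiagram (i : Labels n m) (l : List (Fin (n + m - 1))) :
    idem k (topLabels i l) * wordDiagram k i l = wordDiagram k i l := by
  cases l with
  | nil => exact idem_mul_self i
  | cons t l => rw [wordDiagram, topLabels, ← mul_assoc, idem_mul_cross]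

theorem idem_mul_wordDiagram_ne {i j : Labels n m} {l : List (Fin (n + m - 1))}
    (h : j ≠ topLabels i l) : idem k j * wordDiagram k i l = 0 := by
  rw [← idem_mul_wordDiagram, ← mul_assoc, idem_mul_ne h, zero_mul]

theorem cross_mul_wordDiagram_ne {i j : Labels n m} {l : List (Fin (n + m - 1))}
    (t : Fin (n + m - 1)) (h : j ≠ topLabels i l) : cross k j t * wordDiagram k i l = 0 := by
  rw [← cross_mul_idem, mul_assoc, idem_mul_wordDiagram_ne h, mul_zero]

variable (k) in
/-- The span of the diagrams with fewer than `d` crossings. -/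
def lowSpan (n m d : ℕ) : Submodule (MvPolynomial (Fin m) k) (RAlg k n m) :=
  Submodule.span _ {x | ∃ i l, l.length < d ∧ x = wordDiagram k i l}

theorem wordDiagram_mem_lowSpan (i : Labels n m) {l : List (Fin (n + m - 1))} {d : ℕ}
    (h : l.length < d) : wordDiagram k i l ∈ lowSpan k n m d :=
  Submodule.subset_span ⟨i, l, h, rfl⟩

theorem lowSpan_mono {d d' : ℕ} (h : d ≤ d') : lowSpan k n m d ≤ lowSpan k n m d' :=
  Submodule.span_mono fun _ ⟨i, l, hl, e⟩ => ⟨i, l, hl.trans_le h, e⟩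

theorem smul_mem_lowSpan (c : k) {x : RAlg k n m} {d : ℕ} (h : x ∈ lowSpan k n m d) :
    c • x ∈ lowSpan k n m d := by
  rw [← C_smul_eq]; exact Submodule.smul_mem _ _ h

theorem idem_mul_smul (i : Labels n m) (p : MvPolynomial (Fin m) k) (x : RAlg k n m) :
    idem k i * p • x = p • (idem k i * x) := by
  rw [poly_smul_def, ← mul_assoc, idem_mul_polyDots, mul_assoc, poly_smul_def]

theorem idem_mul_mem_lowSpan (i : Labels n m) {x : RAlg k n m} {d : ℕ}
    (h : x ∈ lowSpan k n m d) : idem k i * x ∈ lowSpan k n m d := by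
  induction h using Submodule.span_induction with
  | mem x hx =>
    obtain ⟨j, l, hl, rfl⟩ := hx
    by_cases h : i = topLabels j l
    · rw [h, idem_mul_wordDiagram]; exact wordDiagram_mem_lowSpan j hl
    · rw [idem_mul_wordDiagram_ne h]; exact zero_mem _
  | zero => rw [mul_zero]; exact zero_mem _
  | add x y _ _ hx hy => rw [mul_add]; exact add_mem hx hy
  | smul p x _ hx =>
    rw [idem_mul_smul]; exact Submodule.smul_mem _ _ hx

theorem exists_cross_mul_polyDots (i : Labels n m) (t : Fin (n + m - 1))
    (p : MvPolynomial (Fin m) k) : ∃ p' p'' : MvPolynomial (Fin m) k,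
      cross k i t * polyDots k n m p = polyDots k n m p' * cross k i t +
        polyDots k n m p'' * idem k i := by
  by_cases h : i.1 (lo t) = true ∧ i.1 (hi t) = true
  · obtain ⟨a, ha⟩ := exists_bos h.1
    obtain ⟨b, hb⟩ := exists_bos h.2
    exact ⟨_, _, cross_mul_polyDots_bos ha hb p⟩
  · exact ⟨p, 0, by rw [cross_mul_polyDots_of_not h, map_zero, zero_mul, add_zero]⟩

/-- Moving the crossing below a polynomial changes the polynomial and adds a term without the
crossing, which lies even lower in the filtration. -/
theorem cross_mul_mem_lowSpan (i : Labels n m) (t : Fin (n + m - 1)) {x : RAlg k n m} {d : ℕ}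
    (h : x ∈ lowSpan k n m d) : cross k i t * x ∈ lowSpan k n m (d + 1) := by
  induction h using Submodule.span_induction with
  | mem x hx =>
    obtain ⟨j, l, hl, rfl⟩ := hx
    by_cases h : i = topLabels j l
    · rw [h]; exact wordDiagram_mem_lowSpan j (l := t :: l) (by simpa using hl)
    · rw [cross_mul_wordDiagram_ne t h]; exact zero_mem _
  | zero => rw [mul_zero]; exact zero_mem _
  | add x y _ _ hx hy => rw [mul_add]; exact add_mem hx hy
  | smul p x hx' hx =>
    obtain ⟨p', p'', e⟩ := exists_cross_mul_polyDots i t p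
    rw [poly_smul_def, ← mul_assoc, e, add_mul, mul_assoc, mul_assoc]
    exact add_mem (Submodule.smul_mem _ p' hx) (Submodule.smul_mem _ p''
      (idem_mul_mem_lowSpan i (lowSpan_mono (Nat.le_succ d) hx')))

theorem cross_mul_cross_far (i : Labels n m) {t u : Fin (n + m - 1)} (h : (t : ℕ) + 1 < u) :
    ∃ c : k, c ≠ 0 ∧ cross k (i.sw u) t * cross k i u = c • (cross k (i.sw t) u * cross k i t) := by
  by_cases hb : (i.1 (lo t) = false ∧ i.1 (hi t) = false) ∧
      (i.1 (lo u) = false ∧ i.1 (hi u) = false)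
  · have := mk_eq_of_rel (Rel.far_odd (k := k) i t u h hb.1 hb.2)
    simp only [map_mul, map_neg] at this
    refine ⟨-1, by simp, ?_⟩
    exact (neg_eq_iff_eq_neg.2 this).symm.trans (neg_one_smul k _).symm
  · have := mk_eq_of_rel (Rel.far_even (k := k) i t u h hb)
    simp only [map_mul] at this
    exact ⟨1, one_ne_zero, by rw [one_smul]; exact this.symm⟩

theorem cross_mul_cross_self (i : Labels n m) (t : Fin (n + m - 1)) :
    ∃ p : MvPolynomial (Fin m) k, cross k (i.sw t) t * cross k i t = polyDots k n m p * idem k i := by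
  by_cases h : i.1 (lo t) = i.1 (hi t)
  · have := mk_eq_of_rel (Rel.double_same (k := k) i t h)
    simp only [map_mul, map_zero] at this
    exact ⟨0, by rw [map_zero, zero_mul]; exact this⟩
  · obtain ⟨a, ha⟩ : ∃ a, bos i a = lo t ∨ bos i a = hi t := by
      cases h1 : i.1 (lo t)
      · have : i.1 (hi t) = true := by
          rw [h1] at h; exact (Bool.eq_true_of_not_eq_false fun e => h e.symm)
        obtain ⟨a, ha⟩ := exists_bos this
        exact ⟨a, Or.inr ha⟩
      · obtain ⟨a, ha⟩ := exists_bos h1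
        exact ⟨a, Or.inl ha⟩
    have := mk_eq_of_rel (Rel.double_mixed (k := k) i t a h ha)
    simp only [map_mul] at this
    exact ⟨X a, by rw [polyDots_X, dotSum_mul_idem]; exact this⟩

theorem cross_triple (i : Labels n m) {t u : Fin (n + m - 1)} (h : (t : ℕ) + 1 = u) :
    ∃ c : k, cross k ((i.sw t).sw u) t * cross k (i.sw t) u * cross k i t =
      cross k ((i.sw u).sw t) u * cross k (i.sw u) t * cross k i u + c • idem k i := by
  by_cases hb : i.1 (lo t) = true ∧ i.1 (hi t) = false ∧ i.1 (hi u) = true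
  · have := mk_eq_of_rel (Rel.triple_even_odd_even (k := k) i t u h hb)
    simp only [map_mul, map_add] at this
    exact ⟨1, by rw [one_smul]; exact this⟩
  · have := mk_eq_of_rel (Rel.triple (k := k) i t u h hb)
    simp only [map_mul] at this
    exact ⟨0, by rw [zero_smul, add_zero]; exact this⟩

/-- The diagrams of two reduced words of a permutation agree up to a scalar and diagrams with
fewer crossings. -/
theorem wordDiagram_sub_mem_lowSpan {l l' : List (Fin (n + m - 1))}
    (hw : wordPerm l = wordPerm l') (hl : Reduced l) (hl' : Reduced l') (i : Labels n m) :
    ∃ c : k, c ≠ 0 ∧ wordDiagram k i l - c • wordDiagram k i l' ∈ lowSpan k n m l.length := by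
  refine (rel_of_reduced (r := fun l l' => l.length = l'.length ∧ ∃ c : k, c ≠ 0 ∧
    wordDiagram k i l - c • wordDiagram k i l' ∈ lowSpan k n m l.length)
    ?_ ?_ ?_ ?_ ?_ ?_ hw hl hl').2
  · exact fun l _ => ⟨rfl, 1, one_ne_zero, by rw [one_smul, sub_self]; exact zero_mem _⟩
  · rintro l l' ⟨hlen, c, hc, h⟩
    refine ⟨hlen.symm, c⁻¹, inv_ne_zero hc, ?_⟩
    have e : wordDiagram k i l' - c⁻¹ • wordDiagram k i l =
        (-c⁻¹) • (wordDiagram k i l - c • wordDiagram k i l') := by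
      rw [smul_sub, smul_smul, neg_mul, inv_mul_cancel₀ hc, neg_smul, neg_smul, one_smul]
      abel
    rw [e, ← hlen]
    exact smul_mem_lowSpan _ h
  · rintro l l' l'' ⟨hlen, c, hc, h⟩ ⟨hlen', c', hc', h'⟩
    refine ⟨hlen.trans hlen', c * c', mul_ne_zero hc hc', ?_⟩
    have e : wordDiagram k i l - (c * c') • wordDiagram k i l'' =
        (wordDiagram k i l - c • wordDiagram k i l') +
          c • (wordDiagram k i l' - c' • wordDiagram k i l'') := by
      rw [smul_sub, smul_smul]; abel
    rw [e]
    exact add_mem h (smul_mem_lowSpan _ (hlen ▸ h'))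
  -- A further crossing on top raises the filtration bound by one, just as it raises the length of
  -- the word.
  · rintro a l l' hw - - ⟨hlen, c, hc, h⟩
    refine ⟨by simp [hlen], c, hc, ?_⟩
    have := cross_mul_mem_lowSpan (topLabels i l) a h
    rw [mul_sub, mul_smul_comm] at this
    rw [wordDiagram, wordDiagram, ← topLabels_congr i hw]
    exact this
  · intro a b l h _ _
    obtain ⟨c, hc, e⟩ := cross_mul_cross_far (k := k) (topLabels i l) h
    refine ⟨rfl, c, hc, ?_⟩
    have : wordDiagram k i (a :: b :: l) = c • wordDiagram k i (b :: a :: l) := by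
      simp only [wordDiagram, topLabels, ← mul_assoc]
      rw [e, smul_mul_assoc]
    rw [this, sub_self]
    exact zero_mem _
  · intro a b l h _ _
    obtain ⟨c, e⟩ := cross_triple (k := k) (topLabels i l) h
    refine ⟨rfl, 1, one_ne_zero, ?_⟩
    have : wordDiagram k i (a :: b :: a :: l) =
        wordDiagram k i (b :: a :: b :: l) + c • wordDiagram k i l := by
      simp only [wordDiagram, topLabels, ← mul_assoc]
      rw [e, add_mul, smul_mul_assoc, idem_mul_wordDiagram]
    rw [this, one_smul, add_sub_cancel_left]
    exact smul_mem_lowSpan _ (wordDiagram_mem_lowSpan i (by simp; omega))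

/-- At the first letter `a` from the bottom that destroys reducedness, the reduced word below can be
replaced, up to a scalar and lower terms, by one that begins with `a`. The resulting double crossing
is a polynomial in dots, so two crossings disappear. -/
theorem wordDiagram_mem_lowSpan_of_not_reduced {l : List (Fin (n + m - 1))} (h : ¬ Reduced l)
    (i : Labels n m) : wordDiagram k i l ∈ lowSpan k n m l.length := by
  induction l with
  | nil => exact absurd reduced_nil h
  | cons a l ih =>
    by_cases hl : Reduced l
    · have hu : ¬ Up a (wordPerm l) := fun hu => h (reduced_cons.2 ⟨hl, hu⟩)
      obtain ⟨u, hw, hr⟩ := exists_reduced_cons hu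
      obtain ⟨c, -, hc⟩ := wordDiagram_sub_mem_lowSpan (k := k) hw.symm hl hr i
      have h1 := cross_mul_mem_lowSpan (topLabels i l) a hc
      rw [mul_sub, mul_smul_comm] at h1
      have h2 : cross k (topLabels i l) a * wordDiagram k i (a :: u) ∈
          lowSpan k n m (l.length + 1) := by
        obtain ⟨p, hp⟩ := cross_mul_cross_self (k := k) (topLabels i u) a
        rw [← topLabels_congr i hw, wordDiagram, topLabels, ← mul_assoc, hp, mul_assoc,
          idem_mul_wordDiagram]
        refine Submodule.smul_mem _ p (wordDiagram_mem_lowSpan i ?_)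
        have : (a :: u).length = l.length := by rw [hr, hw, ← hl]
        simp only [List.length_cons] at this
        omega
      have := add_mem h1 (smul_mem_lowSpan c h2)
      rwa [sub_add_cancel] at this
    · exact cross_mul_mem_lowSpan _ a (ih hl)

/-- The union of the filtration is stable under left multiplication by the generators and contains
`1`. -/
theorem exists_mem_lowSpan (x : RAlg k n m) : ∃ d, x ∈ lowSpan k n m d := by
  have hmul : ∀ (y : FreeAlgebra k (Gen n m)) (x : RAlg k n m), (∃ d, x ∈ lowSpan k n m d) →
      ∃ d, RingQuot.mkAlgHom k (Rel k n m) y * x ∈ lowSpan k n m d := by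
    intro y
    induction y with
    | grade0 c =>
      rintro x ⟨d, h⟩
      rw [AlgHom.commutes, ← Algebra.smul_def]
      exact ⟨d, smul_mem_lowSpan c h⟩
    | grade1 g =>
      rintro x ⟨d, h⟩
      cases g with
      | idem i => exact ⟨d, idem_mul_mem_lowSpan i h⟩
      | dot i a =>
        refine ⟨d, ?_⟩
        change dot k i a * x ∈ _
        rw [← dotSum_mul_idem, mul_assoc, ← polyDots_X]
        exact Submodule.smul_mem _ (X a) (idem_mul_mem_lowSpan i h)
      | cross i t => exact ⟨d + 1, cross_mul_mem_lowSpan i t h⟩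
    | mul y z hy hz =>
      intro x h
      rw [map_mul, mul_assoc]
      exact hy _ (hz _ h)
    | add y z hy hz =>
      intro x h
      obtain ⟨d, hd⟩ := hy x h
      obtain ⟨d', hd'⟩ := hz x h
      rw [map_add, add_mul]
      exact ⟨max d d', add_mem (lowSpan_mono (le_max_left _ _) hd)
        (lowSpan_mono (le_max_right _ _) hd')⟩
  obtain ⟨y, rfl⟩ := RingQuot.mkAlgHom_surjective k (Rel k n m) x
  have h1 : (1 : RAlg k n m) ∈ lowSpan k n m 1 := by
    rw [← sum_idem]
    exact sum_mem fun i _ => wordDiagram_mem_lowSpan i (l := []) (by simp)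
  simpa using hmul y 1 ⟨1, h1⟩

/-- The diagrams of fixed reduced words of all permutations span `R(n,m)` over the polynomials
in dots. -/
theorem span_wordDiagram {word : Equiv.Perm (Fin (n + m)) → List (Fin (n + m - 1))}
    (hword : ∀ w, IsReducedWord (word w) w) :
    Submodule.span (MvPolynomial (Fin m) k)
      (Set.range fun x : Labels n m × Equiv.Perm (Fin (n + m)) =>
        wordDiagram k x.1 (word x.2)) = ⊤ := by
  rw [eq_top_iff]
  intro x _
  obtain ⟨d, hx⟩ := exists_mem_lowSpan x
  suffices h : ∀ d, lowSpan k n m d ≤ Submodule.span (MvPolynomial (Fin m) k)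
      (Set.range fun x : Labels n m × Equiv.Perm (Fin (n + m)) =>
        wordDiagram k x.1 (word x.2)) from h d hx
  intro d
  induction d with
  | zero =>
    refine Submodule.span_le.2 ?_
    rintro _ ⟨i, l, hl, rfl⟩
    exact absurd hl (Nat.not_lt_zero _)
  | succ d ih =>
    refine Submodule.span_le.2 ?_
    rintro _ ⟨i, l, hl, rfl⟩
    have hle : lowSpan k n m l.length ≤ lowSpan k n m d := lowSpan_mono (Nat.lt_succ_iff.1 hl)
    by_cases hr : Reduced l
    · have hw := isReducedWord_iff.1 (hword (wordPerm l))
      obtain ⟨c, -, hc⟩ := wordDiagram_sub_mem_lowSpan (k := k) hw.1.symm hr hw.2 i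
      have h1 := ih (hle hc)
      rw [← C_smul_eq] at h1
      have h2 := add_mem h1 (Submodule.smul_mem _ (C c) (Submodule.subset_span
        (Set.mem_range_self (f := fun x : Labels n m × Equiv.Perm (Fin (n + m)) =>
        wordDiagram k x.1 (word x.2)) (i, wordPerm l))))
      rwa [sub_add_cancel] at h2
    · exact ih (hle (wordDiagram_mem_lowSpan_of_not_reduced hr i))

end Spanning

/-! ### Leading terms -/

section Leading

variable {k : Type*} [Field k] {m : ℕ}

/-- Permutations of the variables are linearly independent over the field of fractions. -/
theorem eq_zero_of_sum_rename {d : Equiv.Perm (Fin m) → FractionRing (MvPolynomial (Fin m) k)}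
    (h : ∀ f : MvPolynomial (Fin m) k, ∑ v, d v * algebraMap _ _ (rename v f) = 0)
    (v : Equiv.Perm (Fin m)) : d v = 0 := by
  let φ : Equiv.Perm (Fin m) → (MvPolynomial (Fin m) k →* FractionRing (MvPolynomial (Fin m) k)) :=
    fun v => ((algebraMap (MvPolynomial (Fin m) k) (FractionRing (MvPolynomial (Fin m) k))).comp
      (rename v).toRingHom : _ →* _)
  have hφ : ∀ v f, φ v f = algebraMap _ _ (rename v f) := fun _ _ => rfl
  have hinj : Function.Injective φ := by
    intro v v' e
    ext a
    have h1 : φ v (X a) = φ v' (X a) := by rw [e]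
    rw [hφ, hφ, rename_X, rename_X] at h1
    exact congrArg Fin.val (X_injective (IsFractionRing.injective _ _ h1))
  -- Dedekind's independence of characters, for the multiplicative maps that permute the variables.
  have hli := (linearIndependent_monoidHom (MvPolynomial (Fin m) k)
    (FractionRing (MvPolynomial (Fin m) k))).comp φ hinj
  refine Fintype.linearIndependent_iff.1 hli d ?_ v
  funext f
  simpa [hφ] using h f

/-- The operator `T` is a combination of permutations of the variables, with coefficients in the
field of fractions, in which `v` is the longest one. -/
def HasLeading (T : MvPolynomial (Fin m) k → MvPolynomial (Fin m) k)
    (v : Equiv.Perm (Fin m)) : Prop :=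
  ∃ c : Equiv.Perm (Fin m) → FractionRing (MvPolynomial (Fin m) k), c v ≠ 0 ∧
    (∀ v', c v' ≠ 0 → v' = v ∨ len v' < len v) ∧
    ∀ f, algebraMap _ _ (T f) = ∑ v', c v' * algebraMap _ _ (rename v' f)

theorem hasLeading_id : HasLeading (fun f : MvPolynomial (Fin m) k => f) 1 := by
  classical
  refine ⟨Pi.single 1 1, by simp, fun v' h => Or.inl ?_, fun f => ?_⟩
  · by_contra hv
    exact h (Pi.single_eq_of_ne hv _)
  · rw [Finset.sum_eq_single 1]
    · simp
    · intro v _ hv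
      rw [Pi.single_eq_of_ne hv, zero_mul]
    · simp

theorem HasLeading.mul_left {T : MvPolynomial (Fin m) k → MvPolynomial (Fin m) k}
    {v : Equiv.Perm (Fin m)} (h : HasLeading T v) {p : MvPolynomial (Fin m) k} (hp : p ≠ 0) :
    HasLeading (fun f => p * T f) v := by
  obtain ⟨c, hc, hle, hT⟩ := h
  refine ⟨fun v' => algebraMap _ _ p * c v', ?_, fun v' hv' => hle v' (right_ne_zero_of_mul hv'),
    fun f => ?_⟩
  · refine mul_ne_zero ?_ hc
    rwa [ne_eq, IsFractionRing.to_map_eq_zero_iff]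
  · rw [map_mul, hT, Finset.mul_sum]
    exact Finset.sum_congr rfl fun v' _ => (mul_assoc _ _ _).symm

/-- With `θ` the action of `s_a` on fractions, the coefficient of `v'` in `∂_a T` is `(c v' - θ (c
(s_a v'))) / (x_a - x_{a+1})`. At `s_a v` the first term vanishes because `s_a v` is longer than
`v`, and the second does not. -/
theorem HasLeading.divDiff {T : MvPolynomial (Fin m) k → MvPolynomial (Fin m) k}
    {v : Equiv.Perm (Fin m)} (h : HasLeading T v) {a : Fin (m - 1)} (ha : Up a v) :
    HasLeading (fun f => divDiff k (lo a) (hi a) (T f)) (simple a * v) := by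
  obtain ⟨c, hc, hle, hT⟩ := h
  let θ : FractionRing (MvPolynomial (Fin m) k) ≃+* FractionRing (MvPolynomial (Fin m) k) :=
    IsFractionRing.ringEquivOfRingEquiv (renameEquiv k (simple a)).toRingEquiv
  have hθ : ∀ f : MvPolynomial (Fin m) k,
      θ (algebraMap _ _ f) = algebraMap _ _ (rename (simple a) f) := fun f =>
    IsFractionRing.ringEquivOfRingEquiv_algebraMap _ f
  set D : FractionRing (MvPolynomial (Fin m) k) :=
    algebraMap _ _ (X (lo a) - X (hi a) : MvPolynomial (Fin m) k) with hD
  have hD0 : D ≠ 0 := by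
    rw [hD, ne_eq, IsFractionRing.to_map_eq_zero_iff]
    exact X_sub_X_ne_zero (lo_ne_hi a)
  have hlen := len_up ha
  refine ⟨fun v' => (c v' - θ (c (simple a * v'))) / D, ?_, fun v' hv' => ?_, fun f => ?_⟩
  · have h0 : c (simple a * v) = 0 := by
      by_contra hne
      rcases hle _ hne with e | e
      · rw [e] at hlen; omega
      · omega
    simp only [h0, simple_mul_cancel, zero_sub]
    exact div_ne_zero (neg_ne_zero.2 ((map_ne_zero_iff θ θ.injective).2 hc)) hD0
  · have hor : c v' ≠ 0 ∨ c (simple a * v') ≠ 0 := by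
      by_contra hcon
      push Not at hcon
      apply hv'
      simp only [hcon.1, hcon.2, map_zero, sub_zero, zero_div]
    rcases hor with h1 | h1
    · right
      rcases hle _ h1 with rfl | e <;> omega
    · rcases hle _ h1 with e | e
      · left; rw [← e, simple_mul_cancel]
      · right
        have := len_simple_mul_le a (simple a * v')
        rw [simple_mul_cancel] at this
        omega
  · have e1 := congrArg (algebraMap _ (FractionRing (MvPolynomial (Fin m) k)))
      (divDiff_spec k (lo a) (hi a) (T f))
    rw [map_sub, map_mul, ← hD] at e1
    have e2 : algebraMap _ (FractionRing (MvPolynomial (Fin m) k))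
        (rename (Equiv.swap (lo a) (hi a)) (T f)) =
        ∑ v', θ (c (simple a * v')) * algebraMap _ _ (rename v' f) := by
      change algebraMap _ _ (rename (simple a) (T f)) = _
      rw [← hθ, hT, map_sum, ← Equiv.sum_comp (Equiv.mulLeft (simple a))]
      refine Finset.sum_congr rfl fun v' _ => ?_
      rw [Equiv.coe_mulLeft, map_mul, hθ, rename_rename, ← Equiv.Perm.coe_mul, simple_mul_cancel]
    rw [e2, hT, ← Finset.sum_sub_distrib] at e1
    rw [← mul_right_inj' hD0, ← e1, Finset.mul_sum]
    refine Finset.sum_congr rfl fun v' _ => ?_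
    field_simp

/-- Operators with different leading permutations are linearly independent over the
polynomials. -/
theorem eq_zero_of_sum_hasLeading {ι : Type*} (s : Finset ι)
    {T : ι → MvPolynomial (Fin m) k → MvPolynomial (Fin m) k} {v : ι → Equiv.Perm (Fin m)}
    (hT : ∀ x ∈ s, HasLeading (T x) (v x)) (hv : Set.InjOn v s)
    {g : ι → MvPolynomial (Fin m) k} (h : ∀ f, ∑ x ∈ s, g x * T x f = 0) :
    ∀ x ∈ s, g x = 0 := by
  classical
  by_contra hcon
  push Not at hcon
  obtain ⟨x₀, hx₀, hg₀⟩ := hcon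
  -- Among the operators with nonzero coefficient, take one whose leading permutation is longest. At
  -- that permutation no other operator contributes: its own leading term is different, and its
  -- remaining terms are shorter.
  obtain ⟨x₁, hx₁, hmax⟩ := Finset.exists_max_image (s.filter fun x => g x ≠ 0)
    (fun x => len (v x)) ⟨x₀, Finset.mem_filter.2 ⟨hx₀, hg₀⟩⟩
  obtain ⟨hx₁, hg₁⟩ := Finset.mem_filter.1 hx₁
  choose! c hc hle hcT using hT
  have key := eq_zero_of_sum_rename (k := k) (m := m)
    (d := fun v' => ∑ x ∈ s, algebraMap _ _ (g x) * c x v') (fun f => by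
      have := congrArg (algebraMap _ (FractionRing (MvPolynomial (Fin m) k))) (h f)
      rw [map_sum, map_zero] at this
      rw [← this]
      simp only [Finset.sum_mul]
      rw [Finset.sum_comm]
      refine Finset.sum_congr rfl fun x hx => ?_
      rw [map_mul, hcT x hx, Finset.mul_sum]
      exact Finset.sum_congr rfl fun v' _ => mul_assoc _ _ _) (v x₁)
  rw [Finset.sum_eq_single_of_mem x₁ hx₁] at key
  · refine mul_ne_zero ?_ (hc x₁ hx₁) key
    rwa [ne_eq, IsFractionRing.to_map_eq_zero_iff]
  · intro x hx hne
    by_contra hn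
    have h1 := right_ne_zero_of_mul hn
    have h2 : g x ≠ 0 := fun e => left_ne_zero_of_mul hn (by rw [e, map_zero])
    rcases hle x hx _ h1 with e | e
    · exact hne (hv hx hx₁ e.symm)
    · exact absurd (hmax x (Finset.mem_filter.2 ⟨hx, h2⟩)) (not_le.2 e)

end Leading

/-! ### Linear independence of the reduced diagrams -/

section Independence

variable {k : Type*} [Field k] {n m : ℕ}

attribute [local instance] polyModule

theorem polRep_dotSum (a : Fin m) (x : Labels n m × Equiv.Perm (Fin n))
    (f : MvPolynomial (Fin m) k) :
    polRep k n m (dotSum k n a) (Finsupp.single x f) = Finsupp.single x (X a * f) := by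
  obtain ⟨i, w⟩ := x
  rw [dotSum, map_sum, LinearMap.sum_apply, Finset.sum_eq_single i, polRep_dot, dotOp_self]
  · intro j _ hj
    rw [polRep_dot, dotOp_ne hj.symm]
  · exact fun h => absurd (Finset.mem_univ _) h

theorem polRep_polyDots (p : MvPolynomial (Fin m) k) (x : Labels n m × Equiv.Perm (Fin n))
    (f : MvPolynomial (Fin m) k) :
    polRep k n m (polyDots k n m p) (Finsupp.single x f) = Finsupp.single x (p * f) := by
  induction p using MvPolynomial.induction_on generalizing f with
  | C c =>
    rw [← algebraMap_eq, AlgHom.commutes, AlgHom.commutes, Module.algebraMap_end_apply,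
      Finsupp.smul_single, Algebra.smul_def]
  | add p q hp hq => rw [map_add, map_add, LinearMap.add_apply, hp, hq, add_mul, Finsupp.single_add]
  | mul_X p a hp =>
    rw [map_mul, map_mul, Module.End.mul_apply, polyDots_X, polRep_dotSum, hp, mul_assoc]

theorem wordDiagram_mul_idem (i : Labels n m) (l : List (Fin (n + m - 1))) :
    wordDiagram k i l * idem k i = wordDiagram k i l := by
  induction l with
  | nil => exact idem_mul_self i
  | cons t l ih => rw [wordDiagram, mul_assoc, ih]

theorem polRep_wordDiagram_ne {i j : Labels n m} (h : j ≠ i) (l : List (Fin (n + m - 1)))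
    (w : Equiv.Perm (Fin n)) (f : MvPolynomial (Fin m) k) :
    polRep k n m (wordDiagram k i l) (Finsupp.single (j, w) f) = 0 := by
  rw [← wordDiagram_mul_idem, map_mul, Module.End.mul_apply, polRep_idem, idemOp_ne h, map_zero]

/-- The permutations of the fermionic and bosonic strands in a reduced diagram, and its action
on `Pol(i,1)`. -/
theorem exists_polRep_wordDiagram (i : Labels n m) {l : List (Fin (n + m - 1))}
    (hl : Reduced l) :
    ∃ (u : Equiv.Perm (Fin n)) (v : Equiv.Perm (Fin m))
      (T : MvPolynomial (Fin m) k → MvPolynomial (Fin m) k),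
      (∀ x, wordPerm l (ferm i x) = ferm (topLabels i l) (u x)) ∧
      (∀ x, wordPerm l (bos i x) = bos (topLabels i l) (v x)) ∧
      HasLeading T v ∧
      ∀ f, polRep k n m (wordDiagram k i l) (Finsupp.single (i, 1) f) =
        Finsupp.single (topLabels i l, u) (T f) := by
  induction l with
  | nil =>
    refine ⟨1, 1, fun f => f, fun x => ?_, fun x => ?_, hasLeading_id, fun f => ?_⟩
    · simp [wordPerm, topLabels]
    · simp [wordPerm, topLabels]
    · rw [wordDiagram, polRep_idem, idemOp_self, topLabels]
  | cons t l ih =>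
    obtain ⟨hr, hup⟩ := reduced_cons.1 hl
    obtain ⟨u, v, T, hu, hv, hT, hρ⟩ := ih hr
    set j := topLabels i l with hj
    have hρ' : ∀ f, polRep k n m (wordDiagram k i (t :: l)) (Finsupp.single (i, 1) f) =
        crossOp k j t (Finsupp.single (j, u) (T f)) := by
      intro f
      rw [wordDiagram, map_mul, Module.End.mul_apply, hρ, polRep_cross]
    have htop : topLabels i (t :: l) = j.sw t := rfl
    simp only [hρ', htop, wordPerm_cons, Equiv.Perm.mul_apply, hu, hv]
    by_cases hbb : j.1 (lo t) = true ∧ j.1 (hi t) = true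
    · obtain ⟨a, h1, h2⟩ := exists_bos_bos hbb.1 hbb.2
      -- The embeddings `bos i` and `bos j` are increasing, so a crossing that creates an inversion
      -- of the whole permutation creates one of `v`.
      have hup' : Up a v := by
        have e : ∀ y, (wordPerm l)⁻¹ (bos j y) = bos i (v⁻¹ y) := by
          intro y
          rw [Equiv.Perm.inv_eq_iff_eq, hv]; simp
        unfold Up at hup ⊢
        rw [← h1, ← h2, e, e] at hup
        exact (bos_strictMono i).lt_iff_lt.1 hup
      refine ⟨u, simple a * v, _, fun x => ?_, fun x => ?_, hT.divDiff hup', fun f => ?_⟩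
      · rw [simple_ferm_of_not (by simp [hbb.1])]
      · rw [simple_bos h1 h2, Labels.sw_eq_self (hbb.1.trans hbb.2.symm), Equiv.Perm.mul_apply]
      · rw [crossOp_bos_bos h1 h2, Labels.sw_eq_self (hbb.1.trans hbb.2.symm)]
    by_cases hff : j.1 (lo t) = false ∧ j.1 (hi t) = false
    · obtain ⟨a, h1, h2⟩ := exists_ferm_ferm hff.1 hff.2
      have hup' : Up a u := by
        have e : ∀ y, (wordPerm l)⁻¹ (ferm j y) = ferm i (u⁻¹ y) := by
          intro y
          rw [Equiv.Perm.inv_eq_iff_eq, hu]; simp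
        unfold Up at hup ⊢
        rw [← h1, ← h2, e, e] at hup
        exact (ferm_strictMono i).lt_iff_lt.1 hup
      -- A crossing of two fermionic strands multiplies by a sign. Reducedness excludes the zero
      -- case of the action and keeps the leading coefficient nonzero.
      have hne : (C (fermCoef u a : k) : MvPolynomial (Fin m) k) ≠ 0 := by
        rw [ne_eq, C_eq_zero, fermCoef_up hup']
        rcases topSign_eq_or u (cr a u) with e | e <;> simp [e]
      refine ⟨simple a * u, v, _, fun x => ?_, fun x => ?_, hT.mul_left hne, fun f => ?_⟩
      · rw [simple_ferm h1 h2, Labels.sw_eq_self (hff.1.trans hff.2.symm), Equiv.Perm.mul_apply]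
      · rw [simple_bos_of_not (by simp [hff.1])]
      · rw [crossOp_ferm_ferm h1 h2, Labels.sw_eq_self (hff.1.trans hff.2.symm),
          Finsupp.smul_single, C_mul']
    · rcases strand_cases j t with ⟨a, b, ha, hb⟩ | ⟨h1, a, ha⟩ | ⟨⟨a, ha⟩, h2⟩ | ⟨a, h1, h2⟩
      · exact absurd ⟨(bos_eq_iff.1 ha).1, (bos_eq_iff.1 hb).1⟩ hbb
      · exact ⟨u, v, T, fun x => simple_ferm_of_not hff _, fun x => simple_bos_of_not hbb _, hT,
          fun f => crossOp_ferm_bos h1 (bos_eq_iff.1 ha).1 u (T f)⟩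
      · exact ⟨u, v, _, fun x => simple_ferm_of_not hff _, fun x => simple_bos_of_not hbb _,
          hT.mul_left (X_ne_zero a), fun f => crossOp_bos_ferm ha h2 u (T f)⟩
      · exact absurd ⟨(ferm_eq_iff.1 h1).1, (ferm_eq_iff.1 h2).1⟩ hff

/-- Combinations of the diagrams of reduced words of different permutations act nontrivially. -/
theorem eq_zero_of_polRep_eq_zero {word : Equiv.Perm (Fin (n + m)) → List (Fin (n + m - 1))}
    (hword : ∀ w, IsReducedWord (word w) w)
    {g : Labels n m × Equiv.Perm (Fin (n + m)) → MvPolynomial (Fin m) k}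
    (h : polRep k n m (∑ x, g x • wordDiagram k x.1 (word x.2)) = 0)
    (x : Labels n m × Equiv.Perm (Fin (n + m))) : g x = 0 := by
  classical
  obtain ⟨i, w₀⟩ := x
  have hred : ∀ w, Reduced (word w) := fun w => (isReducedWord_iff.1 (hword w)).2
  have hperm : ∀ w, wordPerm (word w) = w := fun w => (hword w).1
  choose u v T hu hv hT hρ using fun w => exists_polRep_wordDiagram (k := k) i (hred w)
  have key : ∀ f, ∑ w, Finsupp.single (topLabels i (word w), u w) (g (i, w) * T w f) =
      (0 : Pol k n m) := by
    intro f
    have e := LinearMap.congr_fun h (Finsupp.single (i, 1) f)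
    rw [map_sum, LinearMap.sum_apply, LinearMap.zero_apply, Fintype.sum_prod_type,
      Finset.sum_eq_single i] at e
    · rw [← e]
      refine Finset.sum_congr rfl fun w _ => ?_
      rw [poly_smul_def, map_mul, Module.End.mul_apply, hρ, polRep_polyDots]
    · intro j _ hj
      refine Finset.sum_eq_zero fun w _ => ?_
      rw [poly_smul_def, map_mul, Module.End.mul_apply, polRep_wordDiagram_ne hj.symm, map_zero]
    · exact fun h => absurd (Finset.mem_univ _) h
  -- Compare the components in one summand `(topLabels, u)`: only diagrams with this target
  -- contribute, and among these the leading permutations `v` are distinct.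
  refine eq_zero_of_sum_hasLeading (T := T) (v := v) (g := fun w => g (i, w))
    (Finset.univ.filter fun w => (topLabels i (word w), u w) = (topLabels i (word w₀), u w₀))
    (fun w _ => hT w) ?_ ?_ w₀ (by simp)
  -- Each lower endpoint is fermionic or bosonic, and its upper endpoint is given by `u` or by `v`
  -- together with the top labels. Hence equal data force equal permutations.
  · intro w hw w' hw' e
    simp only [Finset.coe_filter, Finset.mem_univ, true_and, Set.mem_ofPred_eq,
      Prod.mk.injEq] at hw hw'
    ext p
    congr 1
    cases hp : i.1 p
    · obtain ⟨x, rfl⟩ := exists_ferm hp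
      have h1 := hu w x
      have h2 := hu w' x
      rw [hperm, hw.1, hw.2] at h1
      rw [hperm, hw'.1, hw'.2] at h2
      rw [h1, h2]
    · obtain ⟨x, rfl⟩ := exists_bos hp
      have h1 := hv w x
      have h2 := hv w' x
      rw [hperm, hw.1, e] at h1
      rw [hperm, hw'.1] at h2
      rw [h1, h2]
  · intro f
    have e := DFunLike.congr_fun (key f) (topLabels i (word w₀), u w₀)
    rw [Finsupp.finsetSum_apply, Finsupp.zero_apply] at e
    rw [← e, Finset.sum_filter]
    exact Finset.sum_congr rfl fun w _ => by rw [Finsupp.single_apply]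

end Independence

/-! ### Polynomials over symmetric polynomials -/

section Adjoin

variable {S A : Type*} [CommRing S] [CommRing A] [Algebra S A]

theorem mem_lifts_of_coeff_mem {T : Subalgebra S A} {q : Polynomial A} (hq : ∀ r, q.coeff r ∈ T) :
    q ∈ Polynomial.lifts (algebraMap T A) :=
  (Polynomial.lifts_iff_coeff_lifts _).2 fun r => ⟨⟨_, hq r⟩, rfl⟩

/-- The divisor is monic with coefficients in `T`, so the division can be carried out over `T`, and
its quotient is unique over `A`. -/
theorem coeff_mem_of_X_sub_C_mul {T : Subalgebra S A} {x : A} (hx : x ∈ T) {p q : Polynomial A}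
    (h : q = (Polynomial.X - Polynomial.C x) * p) (hq : ∀ r, q.coeff r ∈ T) (r : ℕ) :
    p.coeff r ∈ T := by
  obtain ⟨q', hq'⟩ := (Polynomial.mem_lifts _).1 (mem_lifts_of_coeff_mem hq)
  have hdiv : (Polynomial.divByMonic q' (Polynomial.X - Polynomial.C (⟨x, hx⟩ : T))).map
      (algebraMap T A) = p := by
    rw [Polynomial.map_divByMonic _ (Polynomial.monic_X_sub_C _), hq', h, Polynomial.map_sub,
      Polynomial.map_X, Polynomial.map_C]
    exact Polynomial.mul_divByMonic_cancel_left _ (Polynomial.monic_X_sub_C _)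
  rw [← hdiv, Polynomial.coeff_map]
  exact SetLike.coe_mem _

/-- Adjoining a root of a monic polynomial: reduction modulo the polynomial leaves only powers below
its degree. -/
theorem exists_sum_of_mem_adjoin {s : Set A} {x : A} {q : Polynomial A} (hm : q.Monic)
    (hq : ∀ r, q.coeff r ∈ Algebra.adjoin S s) (h0 : q.eval x = 0) {p : A}
    (hp : p ∈ Algebra.adjoin S (s ∪ {x})) :
    ∃ c : ℕ → Algebra.adjoin S s, ∑ r ∈ Finset.range q.natDegree, (c r : A) * x ^ r = p := by
  classical
  obtain ⟨q', hq', hdeg, hmon⟩ :=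
    Polynomial.lifts_and_natDegree_eq_and_monic (mem_lifts_of_coeff_mem hq) hm
  rw [Algebra.adjoin_union_eq_adjoin_adjoin, Subalgebra.mem_restrictScalars,
    ← Subalgebra.mem_toSubmodule, ← Submodule.span_range_natDegree_eq_adjoin hmon (by
      rw [Polynomial.aeval_def, ← Polynomial.eval_map, hq', h0]), hdeg, Finset.coe_image,
    Submodule.mem_span_image_finset_iff_exists_fun'] at hp
  obtain ⟨c, rfl⟩ := hp
  exact ⟨c, rfl⟩

end Adjoin

/-! ### Freeness over symmetric polynomials -/

section Symmetric

variable (k : Type*) [Field k] (m : ℕ)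

variable {k m} in
/-- A spanning family of the polynomials over the symmetric polynomials that has as many elements
as there are permutations of the variables is linearly independent. -/
theorem linearIndependent_of_span_eq_top {g : Equiv.Perm (Fin m) → MvPolynomial (Fin m) k}
    (hg : ⊤ ≤ Submodule.span (symmetricSubalgebra (Fin m) k) (Set.range g)) :
    LinearIndependent (symmetricSubalgebra (Fin m) k) g := by
  classical
  let M : Matrix (Equiv.Perm (Fin m)) (Equiv.Perm (Fin m))
    (FractionRing (MvPolynomial (Fin m) k)) := fun v e => algebraMap _ _ (rename v (g e))
  have hdet : M.det ≠ 0 := by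
    intro h0
    -- A left null vector is a relation between the permutations of the variables on the family `g`.
    -- Permutations are linear over symmetric polynomials, so it holds on the span, that is, on all
    -- polynomials, contrary to Dedekind's theorem.
    obtain ⟨d, hd, hdM⟩ := Matrix.exists_vecMul_eq_zero_iff.2 h0
    apply hd
    funext v
    refine eq_zero_of_sum_rename (k := k) (m := m) (d := d) (fun f => ?_) v
    have hf := hg (Submodule.mem_top (x := f))
    induction hf using Submodule.span_induction with
    | mem f hf =>
      obtain ⟨e, rfl⟩ := hf
      exact congrFun hdM e
    | zero => simp
    | add f f' _ _ h h' =>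
      simp only [map_add, mul_add, Finset.sum_add_distrib, h, h', add_zero]
    | smul s f _ h =>
      have : ∀ v : Equiv.Perm (Fin m), rename v (s • f) = (s : MvPolynomial (Fin m) k) *
          rename v f := by
        intro v
        rw [Subalgebra.smul_def, smul_eq_mul, map_mul, (mem_symmetricSubalgebra _).1 s.2 v]
      simp only [this, map_mul]
      rw [← mul_zero (algebraMap _ _ (s : MvPolynomial (Fin m) k)), ← h, Finset.mul_sum]
      exact Finset.sum_congr rfl fun v _ => mul_left_comm _ _ _
  rw [Fintype.linearIndependent_iff]
  intro s hs e
  -- Applying every permutation to a relation with symmetric coefficients gives a right null vector.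
  have hv : M.mulVec (fun e => algebraMap _ _ (s e : MvPolynomial (Fin m) k)) = 0 := by
    funext v
    have := congrArg (fun f => algebraMap _ (FractionRing (MvPolynomial (Fin m) k))
      (rename v f)) hs
    simp only [map_sum, map_zero] at this
    rw [Pi.zero_apply, ← this]
    refine Finset.sum_congr rfl fun e _ => ?_
    rw [Subalgebra.smul_def, smul_eq_mul, map_mul, (mem_symmetricSubalgebra _).1 (s e).2 v,
      map_mul, mul_comm]
  have := congrFun (Matrix.eq_zero_of_mulVec_eq_zero hdet hv) e
  simp only [Pi.zero_apply, IsFractionRing.to_map_eq_zero_iff] at this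
  exact Subtype.ext this

/-- The algebra generated by the symmetric polynomials and the variables from the `j`-th on. -/
def symAdjoin (j : ℕ) : Subalgebra (symmetricSubalgebra (Fin m) k) (MvPolynomial (Fin m) k) :=
  Algebra.adjoin _ {p | ∃ i : Fin m, j ≤ i ∧ p = X i}

/-- The monic polynomial whose roots are the first `j` variables. -/
def rootPoly (j : ℕ) : Polynomial (MvPolynomial (Fin m) k) :=
  ∏ i ∈ Finset.univ.filter (fun i : Fin m => (i : ℕ) < j), (Polynomial.X - Polynomial.C (X i))

theorem rootPoly_monic (j : ℕ) : (rootPoly k m j).Monic :=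
  Polynomial.monic_prod_of_monic _ _ fun _ _ => Polynomial.monic_X_sub_C _

variable {m} in
theorem filter_lt_succ (j : Fin m) : Finset.univ.filter (fun i : Fin m => (i : ℕ) < j + 1) =
    insert j (Finset.univ.filter fun i : Fin m => (i : ℕ) < j) := by
  ext i
  simp only [Finset.mem_filter, Finset.mem_univ, true_and, Finset.mem_insert, Fin.ext_iff]
  omega

variable {m} in
theorem rootPoly_succ (j : Fin m) :
    rootPoly k m (j + 1) = (Polynomial.X - Polynomial.C (X j)) * rootPoly k m j := by
  rw [rootPoly, filter_lt_succ, Finset.prod_insert (by simp), rootPoly]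

variable {m} in
theorem natDegree_rootPoly_succ (j : Fin m) : (rootPoly k m (j + 1)).natDegree = j + 1 := by
  rw [rootPoly, Polynomial.natDegree_prod_of_monic _ _ fun _ _ => Polynomial.monic_X_sub_C _]
  simp only [Polynomial.natDegree_X_sub_C, Finset.sum_const, smul_eq_mul, mul_one]
  have : Finset.univ.filter (fun i : Fin m => (i : ℕ) < j + 1) = Finset.Iic j := by
    ext i
    simp only [Finset.mem_filter, Finset.mem_univ, true_and, Finset.mem_Iic]
    exact Nat.lt_succ_iff
  rw [this, Fin.card_Iic]

variable {m} in
theorem setOf_X_succ (j : Fin m) : {p : MvPolynomial (Fin m) k | ∃ i : Fin m, j ≤ i ∧ p = X i} =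
    {p | ∃ i : Fin m, (j : ℕ) + 1 ≤ i ∧ p = X i} ∪ {X j} := by
  ext p
  simp only [Set.mem_union, Set.mem_singleton_iff]
  constructor
  · rintro ⟨i, hi, rfl⟩
    rcases hi.eq_or_lt with h | h
    · exact Or.inr (congrArg X h.symm)
    · exact Or.inl ⟨i, h, rfl⟩
  · rintro (⟨i, hi, rfl⟩ | rfl)
    · exact ⟨i, Fin.le_def.2 (by omega), rfl⟩
    · exact ⟨j, le_rfl, rfl⟩

/-- Downward induction on `j`. The full product has symmetric coefficients, and each step divides by
`X - x_j`, where `x_j` has just been adjoined. -/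
theorem coeff_rootPoly_mem (d : ℕ) : ∀ j, j + d = m → ∀ r, (rootPoly k m j).coeff r ∈
    symAdjoin k m j := by
  induction d with
  | zero =>
    rintro j rfl r
    have hsymm : (rootPoly k j j).coeff r ∈ symmetricSubalgebra (Fin j) k := by
      rw [mem_symmetricSubalgebra]
      intro σ
      have : (rootPoly k j j).map (rename (R := k) σ).toRingHom = rootPoly k j j := by
        have hall : Finset.univ.filter (fun i : Fin j => (i : ℕ) < j) = Finset.univ := by
          ext i; simp
        rw [rootPoly, hall, Polynomial.map_prod]
        simp
        exact Equiv.prod_comp σ fun i => (Polynomial.X - Polynomial.C (X i : MvPolynomial _ k))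
      conv_rhs => rw [← this]
      rw [Polynomial.coeff_map]
      rfl
    exact (symAdjoin k j j).algebraMap_mem ⟨_, hsymm⟩
  | succ d ih =>
    intro j hj r
    have hjm : j < m := by omega
    have hle : symAdjoin k m (j + 1) ≤ symAdjoin k m j :=
      Algebra.adjoin_mono fun p ⟨i, hi, e⟩ => ⟨i, by omega, e⟩
    have hx : (X ⟨j, hjm⟩ : MvPolynomial (Fin m) k) ∈ symAdjoin k m j :=
      Algebra.subset_adjoin ⟨⟨j, hjm⟩, le_rfl, rfl⟩
    have hc : ∀ r, (rootPoly k m (j + 1)).coeff r ∈ symAdjoin k m j := fun r =>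
      hle (ih (j + 1) (by omega) r)
    exact coeff_mem_of_X_sub_C_mul hx (rootPoly_succ k (⟨j, hjm⟩ : Fin m)) hc r

variable {m} in
/-- The monomial with exponents `e`. -/
def stairMonomial (e : (i : Fin m) → Fin (i + 1)) : MvPolynomial (Fin m) k :=
  ∏ i, X i ^ (e i : ℕ)

/-- The span of the monomials below the staircase in the variables from the `j`-th on. -/
def stairSpan (j : ℕ) : Submodule (symmetricSubalgebra (Fin m) k) (MvPolynomial (Fin m) k) :=
  Submodule.span _ {p | ∃ e : (i : Fin m) → Fin (i + 1), (∀ i : Fin m, (i : ℕ) < j → e i = 0) ∧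
    p = stairMonomial k e}

variable {m} in
theorem mul_pow_mem_stairSpan {j : Fin m} {p : MvPolynomial (Fin m) k}
    (hp : p ∈ stairSpan k m (j + 1)) {r : ℕ} (hr : r < j + 1) :
    p * X j ^ r ∈ stairSpan k m j := by
  induction hp using Submodule.span_induction with
  | mem p hp =>
    obtain ⟨e, he, rfl⟩ := hp
    refine Submodule.subset_span ⟨Function.update e j ⟨r, hr⟩, fun i hi => ?_, ?_⟩
    · rw [Function.update_of_ne (by rintro rfl; omega), he i (by omega)]
    · have h0 : e j = 0 := he j (by omega)
      rw [stairMonomial, stairMonomial, ← Finset.prod_erase_mul _ _ (Finset.mem_univ j),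
        ← Finset.prod_erase_mul (a := j) _ _ (Finset.mem_univ j), Function.update_self, h0]
      simp only [Fin.val_zero, pow_zero, mul_one]
      congr 1
      refine Finset.prod_congr rfl fun i hi => ?_
      rw [Function.update_of_ne (Finset.ne_of_mem_erase hi)]
  | zero => rw [zero_mul]; exact zero_mem _
  | add p q _ _ hp hq => rw [add_mul]; exact add_mem hp hq
  | smul s p _ hp => rw [smul_mul_assoc]; exact Submodule.smul_mem _ s hp

/-- The variable `x_j`, counted from zero, is a root of a monic polynomial of degree `j + 1` over
the algebra generated by the symmetric polynomials and the later variables. Its powers up to the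
`j`-th therefore suffice, which is the staircase bound. -/
theorem symAdjoin_le_stairSpan (d : ℕ) : ∀ j, j + d = m → ∀ p ∈ symAdjoin k m j,
    p ∈ stairSpan k m j := by
  induction d with
  | zero =>
    intro j hj p hp
    have hempty : {p : MvPolynomial (Fin m) k | ∃ i : Fin m, j ≤ i ∧ p = X i} = ∅ := by
      rw [Set.eq_empty_iff_forall_notMem]
      rintro p ⟨i, hi, -⟩
      omega
    rw [symAdjoin, hempty, Algebra.adjoin_empty, Algebra.mem_bot] at hp
    obtain ⟨s, rfl⟩ := hp
    rw [Algebra.algebraMap_eq_smul_one]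
    refine Submodule.smul_mem _ s (Submodule.subset_span ⟨fun _ => 0, fun _ _ => rfl, ?_⟩)
    simp [stairMonomial]
  | succ d ih =>
    intro j hj p hp
    have hjm : j < m := by omega
    have hs := setOf_X_succ k (⟨j, hjm⟩ : Fin m)
    have hroot : (rootPoly k m (j + 1)).eval (X ⟨j, hjm⟩) = 0 := by
      have := rootPoly_succ k (⟨j, hjm⟩ : Fin m)
      simp only at this
      rw [this]
      simp
    have hdeg := natDegree_rootPoly_succ k (⟨j, hjm⟩ : Fin m)
    simp only at hdeg
    simp only [Fin.le_def] at hs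
    rw [symAdjoin, hs] at hp
    obtain ⟨c, rfl⟩ := exists_sum_of_mem_adjoin (rootPoly_monic k m (j + 1))
      (coeff_rootPoly_mem k m d (j + 1) (by omega)) hroot hp
    refine sum_mem fun r hr => ?_
    exact mul_pow_mem_stairSpan k (j := ⟨j, hjm⟩) (ih (j + 1) (by omega) _ (c r).2)
      (by rw [hdeg] at hr; exact Finset.mem_range.1 hr)

theorem span_stairMonomial : (⊤ : Submodule (symmetricSubalgebra (Fin m) k)
    (MvPolynomial (Fin m) k)) ≤ Submodule.span _ (Set.range (stairMonomial k (m := m))) := by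
  intro p _
  have hp : p ∈ symAdjoin k m 0 := by
    induction p using MvPolynomial.induction_on with
    | C c => exact (symAdjoin k m 0).algebraMap_mem (algebraMap k _ c)
    | add p q hp hq => exact add_mem (hp trivial) (hq trivial)
    | mul_X p i hp =>
      exact mul_mem (hp trivial) (Algebra.subset_adjoin ⟨i, Nat.zero_le _, rfl⟩)
  refine Submodule.span_mono ?_ (symAdjoin_le_stairSpan k m m 0 (by omega) p hp)
  rintro _ ⟨e, -, rfl⟩
  exact ⟨e, rfl⟩

/-- Polynomials are free over symmetric polynomials. -/
theorem exists_basis_symmetric : Nonempty (Module.Basis (Equiv.Perm (Fin m))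
    (symmetricSubalgebra (Fin m) k) (MvPolynomial (Fin m) k)) := by
  -- There are `1 · 2 ⋯ m = m!` exponents below the staircase, the number needed for the determinant
  -- argument.
  have hcard : Fintype.card (Equiv.Perm (Fin m)) =
      Fintype.card ((i : Fin m) → Fin ((i : ℕ) + 1)) := by
    rw [Fintype.card_perm, Fintype.card_fin, Fintype.card_pi]
    simp only [Fintype.card_fin]
    rw [Fin.prod_univ_eq_prod_range (fun i => i + 1), Finset.prod_range_add_one_eq_factorial]
  obtain ⟨φ⟩ := Fintype.card_eq.1 hcard
  have hspan : ⊤ ≤ Submodule.span (symmetricSubalgebra (Fin m) k)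
      (Set.range (stairMonomial k ∘ φ)) := by
    rw [Set.range_comp, φ.surjective.range_eq, Set.image_univ]
    exact span_stairMonomial k m
  exact ⟨Module.Basis.mk (linearIndependent_of_span_eq_top hspan) hspan⟩

end Symmetric

/-! ### The structure of `R(n,m)` -/

section Structure

variable {k : Type*} [Field k] {n m : ℕ}

attribute [local instance] polyModule

instance isScalarTower_polyModule : IsScalarTower k (MvPolynomial (Fin m) k) (RAlg k n m) :=
  ⟨fun c p x => by
    rw [poly_smul_def, poly_smul_def, map_smul, smul_mul_assoc]⟩

/-- The diagrams of fixed reduced words form a basis over the polynomials in dots. -/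
def polyBasis {word : Equiv.Perm (Fin (n + m)) → List (Fin (n + m - 1))}
    (hword : ∀ w, IsReducedWord (word w) w) :
    Module.Basis (Labels n m × Equiv.Perm (Fin (n + m))) (MvPolynomial (Fin m) k) (RAlg k n m) :=
  Module.Basis.mk (v := fun x => wordDiagram k x.1 (word x.2))
    (Fintype.linearIndependent_iff.2 fun g hg =>
      eq_zero_of_polRep_eq_zero hword (by rw [hg, map_zero]))
    (span_wordDiagram hword).ge

theorem polyBasis_apply {word : Equiv.Perm (Fin (n + m)) → List (Fin (n + m - 1))}
    (hword : ∀ w, IsReducedWord (word w) w) (i : Labels n m) (w : Equiv.Perm (Fin (n + m))) :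
    polyBasis (k := k) hword (i, w) = wordDiagram k i (word w) := by
  rw [polyBasis, Module.Basis.mk_apply]

/-- Independence was proved for the images in `End Pol`, so the coordinates of an element of the
kernel in the polynomial basis all vanish. -/
theorem polRep_injective : Function.Injective (polRep k n m) := by
  choose word hword using exists_reducedWord (N := n + m)
  rw [injective_iff_map_eq_zero]
  intro x hx
  have hsum := (polyBasis (k := k) hword).sum_repr x
  have hg := eq_zero_of_polRep_eq_zero (k := k) hword
    (g := fun y => (polyBasis (k := k) hword).repr x y) (by
      rw [← hx]
      congr 1
      refine Eq.trans (Finset.sum_congr rfl fun y _ => ?_) hsum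
      rw [polyBasis_apply hword])
  rw [← hsum]
  exact Finset.sum_eq_zero fun y _ => by rw [hg y, zero_smul]

/-- On elements with top labels `j`, the sum of dots over all labels acts by its summand for `j`.
The second part records that the top labels persist, as iteration requires. -/
theorem dot_pow_mul {j : Labels n m} (a : Fin m) (r : ℕ) {y : RAlg k n m}
    (hy : idem k j * y = y) :
    dotSum k n a ^ r * y = dot k j a ^ r * y ∧ idem k j * (dot k j a ^ r * y) = dot k j a ^ r * y := by
  induction r with
  | zero => simpa using hy
  | succ r ih =>
    have e : dotSum k n a * (dot k j a ^ r * y) = dot k j a * (dot k j a ^ r * y) := by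
      rw [← ih.2, ← mul_assoc, dotSum_mul_idem, ← mul_assoc (dot k j a) (idem k j), dot_mul_idem]
    constructor
    · rw [pow_succ', pow_succ', mul_assoc, mul_assoc, ih.1, e]
    · rw [pow_succ', mul_assoc, ← mul_assoc (idem k j), idem_mul_dot]

theorem list_dot_mul {j : Labels n m} (e : Fin m → ℕ) (L : List (Fin m)) {y : RAlg k n m}
    (hy : idem k j * y = y) :
    (L.map fun a => dotSum k n a ^ e a).prod * y = (L.map fun a => dot k j a ^ e a).prod * y ∧
      idem k j * ((L.map fun a => dot k j a ^ e a).prod * y) =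
        (L.map fun a => dot k j a ^ e a).prod * y := by
  induction L with
  | nil => simpa using hy
  | cons a L ih =>
    have h := dot_pow_mul a (e a) ih.2
    simp only [List.map_cons, List.prod_cons, mul_assoc]
    exact ⟨by rw [ih.1, h.1], h.2⟩

theorem monomial_smul_wordDiagram (i : Labels n m) (l : List (Fin (n + m - 1)))
    (e : Fin m →₀ ℕ) :
    (monomial e 1 : MvPolynomial (Fin m) k) • wordDiagram k i l = dottedDiagram k i l e := by
  have h : (monomial e 1 : MvPolynomial (Fin m) k) =
      ((List.finRange m).map fun a => X a ^ e a).prod := by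
    rw [monomial_eq, C_1, one_mul, Finsupp.prod_fintype _ _ (fun _ => pow_zero _),
      ← List.ofFn_eq_map, List.prod_ofFn]
  rw [poly_smul_def, h, map_list_prod, List.map_map, dottedDiagram, List.ofFn_eq_map,
    ← (list_dot_mul e (List.finRange m) (idem_mul_wordDiagram i l)).1]
  congr 3
  funext a
  rw [Function.comp_apply, map_pow, polyDots_X]

theorem exists_basis_dottedDiagram {word : Equiv.Perm (Fin (n + m)) → List (Fin (n + m - 1))}
    (hword : ∀ w, IsReducedWord (word w) w) :
    ∃ b : Module.Basis (Labels n m × Equiv.Perm (Fin (n + m)) × (Fin m → ℕ)) k (RAlg k n m),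
      ∀ i w e, b (i, w, e) = dottedDiagram k i (word w) e := by
  let φ : (Fin m →₀ ℕ) × (Labels n m × Equiv.Perm (Fin (n + m))) ≃
      Labels n m × Equiv.Perm (Fin (n + m)) × (Fin m → ℕ) :=
    (Equiv.prodComm _ _).trans ((Equiv.prodAssoc _ _ _).trans
      (Equiv.prodCongr (Equiv.refl _) (Equiv.prodCongr (Equiv.refl _) Finsupp.equivFunOnFinite)))
  refine ⟨((basisMonomials (Fin m) k).smulTower (polyBasis hword)).reindex φ, fun i w e => ?_⟩
  have hφ : φ.symm (i, w, e) = (Finsupp.equivFunOnFinite.symm e, (i, w)) := rfl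
  rw [Module.Basis.reindex_apply, hφ, Module.Basis.smulTower_apply, coe_basisMonomials,
    polyBasis_apply, monomial_smul_wordDiagram]
  rfl

theorem nonempty_labels (n m : ℕ) : Nonempty (Labels n m) := by
  refine ⟨⟨fun p => decide (n ≤ (p : ℕ)), ?_⟩⟩
  have : Finset.univ.filter (fun p : Fin (n + m) => decide (n ≤ (p : ℕ)) = true) =
      Finset.univ.map (Fin.natAddEmb n) := by
    ext p
    simp only [Finset.mem_filter, Finset.mem_univ, true_and, decide_eq_true_eq, Finset.mem_map]
    constructor
    · exact fun h => ⟨⟨p - n, by omega⟩, Fin.ext (by simp; omega)⟩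
    · rintro ⟨q, rfl⟩; simp
  rw [this, Finset.card_map, Finset.card_univ, Fintype.card_fin]

/-! ### Center, finite rank and the Noetherian property -/

theorem polyDots_injective : Function.Injective (polyDots k n m) := by
  rw [injective_iff_map_eq_zero]
  intro p hp
  obtain ⟨i⟩ := nonempty_labels n m
  have h := polRep_polyDots (k := k) (n := n) p (i, 1) 1
  rw [hp, map_zero, LinearMap.zero_apply, eq_comm, Finsupp.single_eq_zero, mul_one] at h
  exact h

/-- For symmetric `p` the twisted rule loses its twist and its correction term, because `s p = p`
and `∂p = 0`. -/
theorem cross_mul_polyDots_of_symmetric {p : MvPolynomial (Fin m) k} (hp : p.IsSymmetric)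
    (i : Labels n m) (t : Fin (n + m - 1)) :
    cross k i t * polyDots k n m p = polyDots k n m p * cross k i t := by
  by_cases h : i.1 (lo t) = true ∧ i.1 (hi t) = true
  · obtain ⟨a, ha⟩ := exists_bos h.1
    obtain ⟨b, hb⟩ := exists_bos h.2
    have hab : a ≠ b := fun e => lo_ne_hi t (by rw [← ha, ← hb, e])
    rw [cross_mul_polyDots_bos ha hb, hp, divDiff_of_symm hab (hp _), map_zero, zero_mul, add_zero]
  · exact cross_mul_polyDots_of_not h p

theorem symDots_le_center : symDots k n m ≤ Subalgebra.center k (RAlg k n m) := by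
  rintro _ ⟨p, hp, rfl⟩
  have hp' : p.IsSymmetric := (mem_symmetricSubalgebra p).1 hp
  rw [Subalgebra.mem_center_iff]
  intro x
  obtain ⟨y, rfl⟩ := RingQuot.mkAlgHom_surjective k (Rel k n m) x
  change _ * polyDots k n m p = polyDots k n m p * _
  induction y with
  | grade0 c => rw [AlgHom.commutes, Algebra.commutes]
  | grade1 g =>
    cases g with
    | idem i => exact idem_mul_polyDots i p
    | dot i a =>
      change dot k i a * _ = _ * dot k i a
      rw [← dotSum_mul_idem, mul_assoc, idem_mul_polyDots, ← mul_assoc, ← mul_assoc, ← polyDots_X,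
        ← map_mul, ← map_mul, mul_comm]
    | cross i t => exact cross_mul_polyDots_of_symmetric hp' i t
  | mul y z hy hz => rw [map_mul, mul_assoc, hz, ← mul_assoc, hy, mul_assoc]
  | add y z hy hz => rw [map_add, add_mul, hy, hz, mul_add]

/-- The symmetric polynomials and their images in `R(n,m)`. -/
def symEquiv (k : Type*) [Field k] (n m : ℕ) :
    symmetricSubalgebra (Fin m) k ≃ₐ[k] symDots k n m :=
  (symmetricSubalgebra (Fin m) k).equivMapOfInjective _ polyDots_injective

theorem exists_basis_symDots : ∃ ι : Type, ∃ _ : Finite ι,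
    Nonempty (Module.Basis ι (symDots k n m) (RAlg k n m)) := by
  choose word hword using exists_reducedWord (N := n + m)
  obtain ⟨b⟩ := exists_basis_symmetric k m
  let b' := b.smulTower (polyBasis (k := k) hword)
  -- The subalgebra `symDots` acts by left multiplication, which is how polynomials act by
  -- definition; so the two scalar actions agree definitionally.
  exact ⟨_, inferInstance, ⟨b'.mapCoeffs (symEquiv k n m).toRingEquiv fun c x => rfl⟩⟩

theorem free_symDots : Module.Free (symDots k n m) (RAlg k n m) := by
  obtain ⟨ι, _, ⟨b⟩⟩ := exists_basis_symDots (k := k) (n := n) (m := m)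
  exact Module.Free.of_basis b

theorem finite_symDots : Module.Finite (symDots k n m) (RAlg k n m) := by
  obtain ⟨ι, _, ⟨b⟩⟩ := exists_basis_symDots (k := k) (n := n) (m := m)
  exact Module.Finite.of_basis b

theorem isNoetherian_symDots : IsNoetherian (symDots k n m) (RAlg k n m) := by
  -- By the fundamental theorem, the symmetric polynomials are a polynomial ring in `m` elementary
  -- ones, hence Noetherian.
  have : IsNoetherianRing (symDots k n m) := isNoetherianRing_of_ringEquiv _
    ((esymmAlgEquiv (Fin m) k (Fintype.card_fin m)).trans (symEquiv k n m)).toRingEquiv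
  have := finite_symDots (k := k) (n := n) (m := m)
  exact isNoetherian_of_isNoetherianRing_of_finite (symDots k n m) (RAlg k n m)

theorem isNoetherianRing_RAlg : IsNoetherianRing (RAlg k n m) :=
  isNoetherian_of_tower (symDots k n m) isNoetherian_symDots

theorem isNoetherianRing_RAlg_op : IsNoetherianRing (RAlg k n m)ᵐᵒᵖ := by
  -- Here centrality is needed: it makes the left action of `symDots` commute with the reversed
  -- multiplication, so that right ideals are submodules over it.
  have : IsScalarTower (symDots k n m) (RAlg k n m)ᵐᵒᵖ (RAlg k n m)ᵐᵒᵖ := by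
    refine ⟨fun s x y => MulOpposite.unop_injective ?_⟩
    have hs := (Subalgebra.mem_center_iff.1 (symDots_le_center s.2)) y.unop
    simp only [smul_eq_mul, MulOpposite.unop_smul, MulOpposite.unop_mul, Subalgebra.smul_def]
    rw [← mul_assoc, hs, mul_assoc]
  have := isNoetherian_symDots (k := k) (n := n) (m := m)
  exact isNoetherian_of_tower (symDots k n m)
    (isNoetherian_of_linearEquiv (MulOpposite.opLinearEquiv (symDots k n m)))

end Structure

end GL12

end

theorem mainTheorem3 (k : Type*) [Field k] (n m : ℕ) :
    -- `σ_w` does not depend on the reduced presentation of `w`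
    (∀ (w : Equiv.Perm (Fin n)) (l : List (Fin (n - 1))), IsReducedWord l w →
      sigma k w = wordSign l • (l.map (sigmaGen k)).prod) ∧
    -- the signs in the rules for the action are the ones that the formula for `σ_w` determines
    (∀ (w : Equiv.Perm (Fin n)) (a : Fin (n - 1)), len (simple a * w) = len w + 1 →
      sigma k (simple a * w) = eps k w a • (sigmaGen k a * sigma k w)) ∧
    -- the rules define an action on `Pol`, and it is faithful
    (∃ ρ : RAlg k n m →ₐ[k] Module.End k (Pol k n m), IsPolAction ρ ∧ Function.Injective ρ) ∧
    -- the dotted diagrams of fixed reduced presentations form a basis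
    (∀ word : Equiv.Perm (Fin (n + m)) → List (Fin (n + m - 1)),
      (∀ w, IsReducedWord (word w) w) →
      ∃ b : Module.Basis (Labels n m × Equiv.Perm (Fin (n + m)) × (Fin m → ℕ)) k (RAlg k n m),
        ∀ i w e, b (i, w, e) = dottedDiagram k i (word w) e) ∧
    -- `Sym(n,m)` is a central copy of the symmetric polynomials, `R(n,m)` is free of finite rank
    -- over it
    Function.Injective (polyDots k n m) ∧
    symDots k n m ≤ Subalgebra.center k (RAlg k n m) ∧
    Module.Free (symDots k n m) (RAlg k n m) ∧ Module.Finite (symDots k n m) (RAlg k n m) ∧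
    -- `R(n,m)` is left and right Noetherian
    IsNoetherianRing (RAlg k n m) ∧ IsNoetherianRing (RAlg k n m)ᵐᵒᵖ := by
  exact ⟨fun w l hl => sigma_eq_of_reduced k hl,
    fun w a h => sigma_simple_mul_eps k (up_iff_len.2 h),
    ⟨polRep k n m, isPolAction_polRep, polRep_injective⟩,
    fun word hword => exists_basis_dottedDiagram hword,
    polyDots_injective, symDots_le_center, free_symDots, finite_symDots,
    isNoetherianRing_RAlg, isNoetherianRing_RAlg_op⟩
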